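/- **Setting.** Let $d\in\mathbb N$ and let $\eta\in C^\infty(\mathbb R)$, $\varphi\in C^\infty(\mathbb R^d)$ be real-valued, supported in $\{\frac12\le|\tau|\le2\}$ and $\{\frac12\le|\xi|\le 2\}$, with $\sum_{l\in\mathbb Z}\eta_l(\tau)=1$ for $\tau\ne0$ and $\sum_{j\in\mathbb Z}\varphi_j(\xi)=1$ for $\xi\neq0$, where $\eta_l:=\eta(2^{-l}\cdot)$, $\varphi_j:=\varphi(2^{-j}\cdot)$. Let $\mathcal F_{t,x},\mathcal F_x$ be the Fourier transforms in $(t,x)\in\mathbb R\times\mathbb R^d$ and in $x$ (frequencies dual through $e^{it\tau+ix\cdot\xi}$). For a function $h$ on $\mathbb R^{d+1}$ defining a tempered distribution, $\sigma_t,\sigma_x\in\mathbb R$ and $q\in[1,\infty]$ (in the second norm $q\in(1,\infty)$), put $$\|h\|_{S^{(\sigma_t,\sigma_x)}_{q,\infty}\dot B}:=\sup_{l,j\in\mathbb Z}2^{\sigma_tl}2^{\sigma_xj}\|\mathcal F_{t,x}^{-1}\eta_l\varphi_j\mathcal F_{t,x}h\|_{L^q},\qquad \|h\|_{S^{(\sigma_t,\sigma_x)}_{q,\infty,(\infty)}\dot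 B}:=\sup_{l,j\in\mathbb Z}2^{\sigma_tl}2^{\sigma_xj}\|\mathcal F_{t,x}^{-1}\eta_l\varphi_j\mathcal F_{t,x}h\|_{L^{q,\infty}},$$ $$\|h\|_{\tilde L^q_t\dot B^{\sigma_x}_{q,\infty}}:=\sup_{j\in\mathbb Z}2^{\sigma_xj}\|\mathcal F_x^{-1}\varphi_j\mathcal F_xh\|_{L^q},$$ with all Lebesgue norms over $\mathbb R^{d+1}$ and $\|h\|_{L^{q,\infty}}:=\sup_{a>0}a\,|\{|h|>a\}|^{1/q}$. The function $h$ belongs to the space if the norm is finite. **Lemma (averaging lemma).** Let $m\in(1,\infty)$, $\gamma\in(-\infty,m)$, $\mu\in[1,m+1-\gamma)$, $\rho\in(0,1)$, let $\beta$ be given by $\beta'=\frac1\rho$ (that is, $\frac1\beta=1-\rho$), and let $s\in(\frac{\mu-2+\gamma}{m-1},1]\cap[0,1]$. Define $$p:=\frac{s(m-1)+1-\gamma+\rho}{\rho\mu+(1-\rho)(s(m-1)+1-\gamma)},\qquad \kappa_t:=\frac{(1-s)(\mu-1+\rho)}{s(m-1)+1-\gamma+\rho},\qquad \kappa_x:=\frac{2s(\mu-1+\rho)}{s(m-1)+1-\gamma+\rho}$$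 and $\overline\kappa:=(\kappa_t,\kappa_x)$. Consider (real- or complex-valued) $f\in L^\beta(\mathbb R_t\times\mathbb R^d_x\times\mathbb R_v)$ and Radon measures $g_0,g_1$ such that $|v|^{1-\gamma}g_0$ and $|v|^{-\gamma}g_1$ have finite total variation and $$\partial_tf-|v|^{m-1}\Delta_xf=g_0+\partial_vg_1\quad\text{on }\mathbb R_t\times\mathbb R^d_x\times\mathbb R_v$$ in the sense of distributions, and such that the average $$\overline f(t,x):=\int f(t,x,v)|v|^{\mu-1}\,dv$$ is well defined as a tempered distribution, i.e. $(1+|(t,x)|)^{-N}|v|^{\mu-1}f\in L^1(\mathbb R_t\times\mathbb R^d_x\times\mathbb R_v)$ for some $N\in\mathbb N$. Write $$A:=\||v|^{1-\gamma}g_0\|_{\mathcal M_{TV}}+\||v|^{-\gamma}g_1\|_{\mathcal M_{TV}}+\|f\|_{L^\beta_{t,x,v}}.$$ The constants $C$ below depend only on $d,m,\gamma,\mu,\rho,s,\eta,\varphi$ (and in 2 and 3 also on $r,q$), not on $f,g_0,g_1$. 1. $\overline f\in S^{\overline\kappa}_{p,\infty,(\infty)}\dot B$ and $\|\overline f\|_{S^{\overline\kappa}_{p,\infty,(\infty)}\dot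 B}\le C\,A$. 2. Let $r\in[1,\infty]$, $r\ne p$, $q\in(\min\{p,r\},\max\{p,r\})$, and let $\vartheta\in(0,1)$ satisfy $\frac1q=\frac{1-\vartheta}r+\frac\vartheta p$. If additionally $\overline f\in L^r(\mathbb R^{d+1})$, then $\overline f\in S^{\vartheta\overline\kappa}_{q,\infty}\dot B$ and $\|\overline f\|_{S^{\vartheta\overline\kappa}_{q,\infty}\dot B}\le C\,(A+\|\overline f\|_{L^r})$. 3. If $s=1$, then $\kappa_t=0$, and 2 remains true with $S^{\vartheta\overline\kappa}_{q,\infty}\dot B$ replaced by $\tilde L^q_t\dot B^{\vartheta\kappa_x}_{q,\infty}$, that is, $\overline f\in\tilde L^q_t\dot B^{\vartheta\kappa_x}_{q,\infty}$ and $\|\overline f\|_{\tilde L^q_t\dot B^{\vartheta\kappa_x}_{q,\infty}}\le C\,(A+\|\overline f\|_{L^r})$. -/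

import Mathlib

open MeasureTheory
open scoped NNReal ENNReal ContDiff SchwartzMap Laplacian

noncomputable section

namespace KineticAveraging

/-- The spatial domain `ℝ^d`. -/
abbrev Space (d : ℕ) : Type := EuclideanSpace ℝ (Fin d)

/-- Space-time `ℝ_t × ℝ^d_x` with its Euclidean structure (and Lebesgue measure). -/
abbrev SpaceTime (d : ℕ) : Type := WithLp 2 (ℝ × Space d)

/-- The point `(t, x)` of space-time. -/
abbrev pt {d : ℕ} (t : ℝ) (x : Space d) : SpaceTime d := WithLp.toLp 2 (t, x)

/-- Phase space `(ℝ_t × ℝ^d_x) × ℝ_v` (with Lebesgue measure). -/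
abbrev Phase (d : ℕ) : Type := SpaceTime d × ℝ

/-! ### Radon measures -/

/-- A complex Radon measure `g` on phase space, possibly of infinite total variation, given through
its polar decomposition `dg = phase · d|g|`: the variation `|g|` is a positive Radon measure and the
phase has modulus one. Real signed Radon measures are those with `phase = ±1`. -/
structure RadonMeasure (d : ℕ) where
  /-- the total variation measure `|g|` -/
  variation : Measure (Phase d)
  /-- the density of `g` with respect to `|g|` -/
  phase : Phase d → ℂ
  finite_on_compacts : IsFiniteMeasureOnCompacts variation
  measurable_phase : Measurable phase
  norm_phase : ∀ z, ‖phase z‖ = 1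

/-- `∫ ψ dg` for a real-valued function `ψ` on phase space. -/
def RadonMeasure.integral {d : ℕ} (g : RadonMeasure d) (ψ : Phase d → ℝ) : ℂ :=
  ∫ z, (ψ z : ℂ) * g.phase z ∂g.variation

/-- The total variation norm `‖ |v|^a g ‖` of the measure `|v|^a g`, with values in `[0, ∞]`.
For `a < 0` the weight is `∞` at `v = 0`. -/
def RadonMeasure.weightedTV {d : ℕ} (g : RadonMeasure d) (a : ℝ) : ℝ≥0∞ :=
  ∫⁻ z, ‖z.2‖ₑ ^ a ∂g.variation

/-! ### The kinetic equation -/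

/-- `f` solves `∂_t f - |v|^(m-1) Δ_x f = g₀ + ∂_v g₁` in the sense of distributions on the
whole phase space. -/
def IsKineticSolution {d : ℕ} (m : ℝ) (f : Phase d → ℂ) (g₀ g₁ : RadonMeasure d) : Prop :=
  ∀ ψ : Phase d → ℝ, ContDiff ℝ ∞ ψ → HasCompactSupport ψ →
    ∫ z : Phase d, f z *
        ((- deriv (fun t => ψ (pt t z.1.snd, z.2)) z.1.fst
          - |z.2| ^ (m - 1) * (Δ fun x : Space d => ψ (pt z.1.fst x, z.2)) z.1.snd : ℝ) : ℂ)
      = g₀.integral ψ - g₁.integral (fun z => deriv (fun v => ψ (z.1, v)) z.2)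

/-- The velocity average `(t, x) ↦ ∫ f(t, x, v) |v|^(μ-1) dv`. -/
def velocityAverage {d : ℕ} (μ : ℝ) (f : Phase d → ℂ) (y : SpaceTime d) : ℂ :=
  ∫ v : ℝ, f (y, v) * ((|v| ^ (μ - 1) : ℝ) : ℂ)

/-- The integral defining the velocity average converges absolutely and defines a tempered
distribution: `f |v|^(μ-1)` is integrable on phase space up to a polynomial weight in `(t, x)`. -/
def HasVelocityAverage {d : ℕ} (μ : ℝ) (f : Phase d → ℂ) : Prop :=
  ∃ N : ℕ, Integrable fun z : Phase d =>
    f z * (((1 + ‖z.1‖) ^ (-(N : ℤ)) * |z.2| ^ (μ - 1) : ℝ) : ℂ)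

/-! ### Lebesgue and Lorentz norms of tempered distributions -/

/-- The tempered distribution `u` is given by integration against the function `h`. -/
def IsRepresentedBy {d : ℕ} (u : 𝓢'(SpaceTime d, ℂ)) (h : SpaceTime d → ℂ) : Prop :=
  AEStronglyMeasurable h volume ∧
    ∀ ζ : 𝓢(SpaceTime d, ℂ), Integrable (fun y => ζ y * h y) ∧ u ζ = ∫ y, ζ y * h y

/-- The weak Lebesgue (Lorentz) quasi-norm
`‖h‖_{L^{p,∞}} = sup_{a > 0} a |{|h| > a}|^{1/p}`. -/
def weakLpNorm {d : ℕ} (p : ℝ) (h : SpaceTime d → ℂ) : ℝ≥0∞ :=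
  ⨆ a : ℝ≥0, (a : ℝ≥0∞) * volume {y | (a : ℝ≥0∞) < ‖h y‖ₑ} ^ (1 / p)

/-- The `L^q` norm of a tempered distribution (`∞` if it is not a function); the representing
function is unique up to null sets. -/
def lpNormDist {d : ℕ} (q : ℝ≥0∞) (u : 𝓢'(SpaceTime d, ℂ)) : ℝ≥0∞ :=
  ⨅ (h : SpaceTime d → ℂ) (_ : IsRepresentedBy u h), eLpNorm h q volume

/-- The `L^{p,∞}` quasi-norm of a tempered distribution (`∞` if it is not a function). -/
def weakLpNormDist {d : ℕ} (p : ℝ) (u : 𝓢'(SpaceTime d, ℂ)) : ℝ≥0∞ :=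
  ⨅ (h : SpaceTime d → ℂ) (_ : IsRepresentedBy u h), weakLpNorm p h

/-! ### Littlewood–Paley decomposition and function spaces -/

/-- A pair of smooth dyadic partitions of unity, `η` in the time frequency on `ℝ ∖ {0}` and
`φ` in the space frequency on `ℝ^d ∖ {0}`. -/
structure DyadicPartition (d : ℕ) where
  η : ℝ → ℝ
  φ : Space d → ℝ
  smooth_η : ContDiff ℝ ∞ η
  smooth_φ : ContDiff ℝ ∞ φ
  support_η : Function.support η ⊆ {τ | 1 / 2 ≤ |τ| ∧ |τ| ≤ 2}
  support_φ : Function.support φ ⊆ {ξ | 1 / 2 ≤ ‖ξ‖ ∧ ‖ξ‖ ≤ 2}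
  sum_η : ∀ τ : ℝ, τ ≠ 0 → HasSum (fun l : ℤ => η ((2 : ℝ) ^ (-l) * τ)) 1
  sum_φ : ∀ ξ : Space d, ξ ≠ 0 → HasSum (fun j : ℤ => φ ((2 : ℝ) ^ (-j) • ξ)) 1

variable {d : ℕ}

/-- The block `F_{t,x}⁻¹ η_l φ_j F_{t,x} u`. Here `(τ, ξ)` is the angular frequency, dual to
`(t, x)` through `exp (i t τ + i x · ξ)`; Mathlib's frequency variable `w` is `(τ, ξ) = 2 π w`. -/
def DyadicPartition.block (P : DyadicPartition d) (l j : ℤ) (u : 𝓢'(SpaceTime d, ℂ)) :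
    𝓢'(SpaceTime d, ℂ) :=
  TemperedDistribution.fourierMultiplierCLM ℂ
    (fun w : SpaceTime d => ((P.η ((2 : ℝ) ^ (-l) * (2 * Real.pi * w.fst)) *
      P.φ ((2 : ℝ) ^ (-j) • ((2 * Real.pi) • w.snd)) : ℝ) : ℂ)) u

/-- The block `F_x⁻¹ φ_j F_x u`, localized in the space frequency only. -/
def DyadicPartition.blockX (P : DyadicPartition d) (j : ℤ) (u : 𝓢'(SpaceTime d, ℂ)) :
    𝓢'(SpaceTime d, ℂ) :=
  TemperedDistribution.fourierMultiplierCLM ℂ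
    (fun w : SpaceTime d => ((P.φ ((2 : ℝ) ^ (-j) • ((2 * Real.pi) • w.snd)) : ℝ) : ℂ)) u

/-- The norm of the homogeneous Besov space with dominating mixed derivatives
`S^{(σt, σx)}_{q,∞} Ḃ`, of (the tempered distribution given by) a function `h`. It is `∞` if `h`
does not define a tempered distribution. Since all the multipliers `η_l φ_j` are supported in
`{τ |ξ| ≠ 0}`, it only depends on the functional that `h` induces on Schwartz functions whose
Fourier transform is compactly supported in `{τ |ξ| ≠ 0}`. -/
def DyadicPartition.besovNorm (P : DyadicPartition d) (σt σx : ℝ) (q : ℝ≥0∞)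
    (h : SpaceTime d → ℂ) : ℝ≥0∞ :=
  ⨅ (u : 𝓢'(SpaceTime d, ℂ)) (_ : IsRepresentedBy u h),
    ⨆ (l : ℤ) (j : ℤ), (2 : ℝ≥0∞) ^ (σt * l) * (2 : ℝ≥0∞) ^ (σx * j) *
      lpNormDist q (P.block l j u)

/-- The norm of `S^{(σt, σx)}_{p,∞,(∞)} Ḃ`, with `L^{p,∞}` in place of `L^p`. -/
def DyadicPartition.weakBesovNorm (P : DyadicPartition d) (σt σx : ℝ) (p : ℝ)
    (h : SpaceTime d → ℂ) : ℝ≥0∞ :=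
  ⨅ (u : 𝓢'(SpaceTime d, ℂ)) (_ : IsRepresentedBy u h),
    ⨆ (l : ℤ) (j : ℤ), (2 : ℝ≥0∞) ^ (σt * l) * (2 : ℝ≥0∞) ^ (σx * j) *
      weakLpNormDist p (P.block l j u)

/-- The norm of the homogeneous Chemin–Lerner space `L̃^q_t Ḃ^{σx}_{q,∞}`. -/
def DyadicPartition.cheminLernerNorm (P : DyadicPartition d) (σx : ℝ) (q : ℝ≥0∞)
    (h : SpaceTime d → ℂ) : ℝ≥0∞ :=
  ⨅ (u : 𝓢'(SpaceTime d, ℂ)) (_ : IsRepresentedBy u h),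
    ⨆ j : ℤ, (2 : ℝ≥0∞) ^ (σx * j) * lpNormDist q (P.blockX j u)

/-! ### The data of the averaging lemma -/

/-- `f ∈ L^β` solves the kinetic equation with right-hand side `g₀ + ∂_v g₁`, the measures
`|v|^(1-γ) g₀` and `|v|^(-γ) g₁` are finite, and the velocity average of `f` is well defined. -/
structure AveragingData (m γ μ β : ℝ) (f : Phase d → ℂ) (g₀ g₁ : RadonMeasure d) : Prop where
  memLp : MemLp f (ENNReal.ofReal β) volume
  solution : IsKineticSolution m f g₀ g₁
  finite_g₀ : g₀.weightedTV (1 - γ) < ⊤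
  finite_g₁ : g₁.weightedTV (-γ) < ⊤
  average : HasVelocityAverage μ f

/-- `‖|v|^(1-γ) g₀‖_{TV} + ‖|v|^(-γ) g₁‖_{TV} + ‖f‖_{L^β}`. -/
def dataNorm (γ β : ℝ) (f : Phase d → ℂ) (g₀ g₁ : RadonMeasure d) : ℝ≥0∞ :=
  g₀.weightedTV (1 - γ) + g₁.weightedTV (-γ) + eLpNorm f (ENNReal.ofReal β) volume

/-- `q` lies strictly between `p` and `r ∈ [1, ∞]`, `r ≠ p`, and `ϑ ∈ (0, 1)` is given by
`1/q = (1-ϑ)/r + ϑ/p`. -/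
structure InterpolationExponents (p : ℝ) (r q : ℝ≥0∞) (ϑ : ℝ) : Prop where
  one_le : 1 ≤ r
  ne : ENNReal.ofReal p ≠ r
  lower : min (ENNReal.ofReal p) r < q
  upper : q < max (ENNReal.ofReal p) r
  pos : 0 < ϑ
  lt_one : ϑ < 1
  eq : (q⁻¹).toReal = (1 - ϑ) * (r⁻¹).toReal + ϑ / p

end KineticAveraging

end

/-! At velocity `v` the kinetic operator has the symbol `iτ + |v|^(m-1) |ξ|²`, which is invertible
on a frequency block `|τ| ∼ a`, `|ξ| ∼ c` but loses its control of `ξ` as `v → 0`. The average is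
therefore split at a threshold `|v| ∼ δ`. Put `M = a^(-(1-s)) c^(-2s)`, `a₀ = μ - 1 + ρ` and `a₁ =
s(m-1) + 2 - γ - μ`; the lower bound on `s` says exactly that `a₁ > 0`.

Small velocities: Hölder's inequality in `v` (`eLpNorm_lowAverage_le`) and Young's inequality bound
the block in `L^β` by `C δ^a₀ ‖f‖`.

Large velocities: the equation is tested with a velocity cutoff times the frequency-localized
fundamental solution at velocity `v` (`kinetic_identity`). This expresses the block through `g₀` and
`g₁` alone. With `r = |v|^(m-1) c² / a`, the `L¹` norm of that kernel is at most a constant times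
`a⁻¹ min(1, r⁻¹) ≤ a⁻¹ r^(-s) = M |v|^(-s(m-1))` (`exists_lintegral_kineticKernel_le`). Its
derivative in `log |v|` obeys the same bound, so `∂_v` costs just one factor `|v|⁻¹`, which is the
difference between the weights on `g₀` and `g₁`. The block is thus bounded in `L¹` by `C M δ^(-a₁)`
times the weighted total variations (`exists_lintegral_highAverage_le`).

For each level `t`, Chebyshev's inequality is applied to both pieces with a threshold `δ` depending
on `t` that makes the two bounds comparable (`velocity_balance`). This is real interpolation by
hand: it gives weak `L^p` with the factor `M^(a₀/(a₀+a₁)) = a^(-κt) c^(-κx)`, which is assertion 1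
(`AveragingParameters.exists_weakLpNorm_le`). Blocks are bounded on `L^r` by Young's inequality, and
interpolation between weak `L^p` and `L^r` gives assertion 2.

For `s = 1` no power of `a` is lost, and the kernel bound persists for time cutoffs equal to `1`
near `τ = 0`: a dyadic decomposition of the low time frequencies sums to the same `r⁻¹`
(`IsHomogeneousMultiplier.low_frequency`). Letting `a → ∞` removes the time localization, and lower
semicontinuity of the `L^q` norm (`IsMultiplierLimit.eLpNorm_le`) gives assertion 3. -/

open MeasureTheory
open scoped NNReal ENNReal ContDiff SchwartzMap Laplacian

noncomputable section

namespace KineticAveraging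

open Real FourierTransform Filter Topology

/-! ### Kernels of smooth families of compactly supported symbols -/

section SymbolFamilies

variable {V : Type*} [NormedAddCommGroup V] [InnerProductSpace ℝ V]

/-- A smooth one-parameter family of symbols on `V` with uniformly bounded supports. -/
structure IsSymbolFamily (Φ : ℝ → V → ℂ) (R : ℝ) : Prop where
  smooth : ContDiff ℝ ∞ (fun q : ℝ × V => Φ q.1 q.2)
  vanish : ∀ u w, R < ‖w‖ → Φ u w = 0

namespace IsSymbolFamily

variable {Φ : ℝ → V → ℂ} {R : ℝ}

lemma contDiff (h : IsSymbolFamily Φ R) (u : ℝ) : ContDiff ℝ ∞ (Φ u) :=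
  h.smooth.comp (contDiff_const.prodMk contDiff_id)

lemma tsupport_subset (h : IsSymbolFamily Φ R) (u : ℝ) :
    tsupport (Φ u) ⊆ Metric.closedBall 0 R := by
  refine closure_minimal (fun w hw => ?_) Metric.isClosed_closedBall
  by_contra hc
  exact hw (h.vanish u w (by simpa using hc))

lemma comp_neg (h : IsSymbolFamily Φ R) : IsSymbolFamily (fun u w => Φ u (-w)) R where
  smooth := h.smooth.comp (contDiff_fst.prodMk contDiff_snd.neg)
  vanish u w hw := h.vanish u (-w) (by simpa using hw)

variable [FiniteDimensional ℝ V]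

lemma hasCompactSupport (h : IsSymbolFamily Φ R) (u : ℝ) : HasCompactSupport (Φ u) :=
  (isCompact_closedBall (0 : V) R).of_isClosed_subset (isClosed_tsupport _) (h.tsupport_subset u)

/-- The derivatives in `w` are restrictions to the second factor of the joint derivatives in `(u,
w)`, which are continuous and hence bounded on the compact set `[a, b] × closedBall 0 R`. -/
lemma exists_norm_iteratedFDeriv_le (h : IsSymbolFamily Φ R) (a b : ℝ) (n : ℕ) :
    ∃ C : ℝ, 0 ≤ C ∧ ∀ u ∈ Set.Icc a b, ∀ w, ‖iteratedFDeriv ℝ n (Φ u) w‖ ≤ C := by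
  set F : ℝ × V → ℂ := fun q => Φ q.1 q.2
  have hF : Continuous (fun q => ‖iteratedFDeriv ℝ n F q‖) :=
    (h.smooth.continuous_iteratedFDeriv (mod_cast le_top)).norm
  obtain ⟨C, hC⟩ := ((isCompact_Icc (a := a) (b := b)).prod
    (isCompact_closedBall (0 : V) R)).exists_bound_of_continuousOn hF.continuousOn
  refine ⟨max C 0, le_max_right _ _, fun u hu w => ?_⟩
  by_cases hw : w ∈ Metric.closedBall (0 : V) R
  · have e : Φ u = (fun q => F ((u, 0) + q)) ∘ (ContinuousLinearMap.inr ℝ ℝ V) := by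
      ext w; simp [F]
    have hs : ContDiff ℝ ∞ (fun q => F ((u, 0) + q)) :=
      h.smooth.comp (contDiff_const.add contDiff_id)
    rw [e, ContinuousLinearMap.iteratedFDeriv_comp_right _ hs _ (i := n) (mod_cast le_top)]
    refine (ContinuousMultilinearMap.norm_compContinuousLinearMap_le _ _).trans ?_
    have h1 : ‖ContinuousLinearMap.inr ℝ ℝ V‖ ≤ 1 := ContinuousLinearMap.norm_inr_le_one ℝ ℝ V
    have h2 : ∏ _i : Fin n, ‖ContinuousLinearMap.inr ℝ ℝ V‖ ≤ 1 :=
      Finset.prod_le_one (fun _ _ => ContinuousLinearMap.opNorm_nonneg _) (fun _ _ => h1)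
    rw [iteratedFDeriv_comp_add_left]
    have h3 := hC ((u, 0) + ContinuousLinearMap.inr ℝ ℝ V w) (by simpa using ⟨hu, by simpa using hw⟩)
    rw [norm_norm] at h3
    calc _ ≤ ‖iteratedFDeriv ℝ n F ((u, 0) + ContinuousLinearMap.inr ℝ ℝ V w)‖ * 1 := by gcongr
      _ ≤ _ := by rw [mul_one]; exact h3.trans (le_max_left _ _)
  · have : iteratedFDeriv ℝ n (Φ u) w = 0 := by
      by_contra hc
      exact hw (h.tsupport_subset u (support_iteratedFDeriv_subset n hc))
    simp [this]

variable [MeasurableSpace V] [BorelSpace V]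

/-- Smoothness of the symbol becomes decay of the kernel: the left side is controlled by integrals
of `‖w‖^i ‖D^l Φ‖`, each at most a supremum over the fixed ball times its volume, uniformly for `u`
in a compact interval. -/
lemma exists_decay (h : IsSymbolFamily Φ R) (a b : ℝ) (n k : ℕ) :
    ∃ C : ℝ, 0 ≤ C ∧ ∀ u ∈ Set.Icc a b, ∀ z,
      ‖z‖ ^ n * ‖iteratedFDeriv ℝ k (𝓕⁻ (Φ u)) z‖ ≤ C := by
  have h' := h.comp_neg
  choose D hD0 hD using fun n => h'.exists_norm_iteratedFDeriv_le a b n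
  set vol := (volume (Metric.closedBall (0 : V) R)).toReal
  refine ⟨(2 * π) ^ k * (2 * k + 2) ^ n *
      ∑ p ∈ Finset.range (k + 1) ×ˢ Finset.range (n + 1), |R| ^ p.1 * D p.2 * vol, ?_, ?_⟩
  · have : ∀ p : ℕ × ℕ, 0 ≤ |R| ^ p.1 * D p.2 * vol := fun p =>
      mul_nonneg (mul_nonneg (by positivity) (hD0 _)) ENNReal.toReal_nonneg
    have := Finset.sum_nonneg (s := Finset.range (k + 1) ×ˢ Finset.range (n + 1))
      (fun p _ => this p)
    positivity
  intro u hu z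
  have key : ∀ p : ℕ × ℕ, ∀ w : V,
      ‖‖w‖ ^ p.1 * ‖iteratedFDeriv ℝ p.2 (fun w => Φ u (-w)) w‖‖ ≤
      (Metric.closedBall (0 : V) R).indicator (fun _ => |R| ^ p.1 * D p.2) w := by
    intro p w
    rw [Real.norm_of_nonneg (by positivity)]
    by_cases hw : w ∈ Metric.closedBall (0 : V) R
    · rw [Set.indicator_of_mem hw]
      have hw' : ‖w‖ ≤ |R| := (by simpa using hw : ‖w‖ ≤ R).trans (le_abs_self R)
      gcongr
      exact hD p.2 u hu w
    · have : iteratedFDeriv ℝ p.2 (fun w => Φ u (-w)) w = 0 := by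
        by_contra hc
        exact hw (h'.tsupport_subset u (support_iteratedFDeriv_subset _ hc))
      rw [Set.indicator_of_notMem hw, this]; simp
  have hint : ∀ p : ℕ × ℕ, Integrable
      ((Metric.closedBall (0 : V) R).indicator (fun _ => |R| ^ p.1 * D p.2)) := fun p =>
    (integrable_indicator_iff Metric.isClosed_closedBall.measurableSet).2
      (integrableOn_const (isCompact_closedBall (0 : V) R).measure_lt_top.ne)
  have hint' : ∀ p : ℕ × ℕ, Integrable
      (fun w => ‖w‖ ^ p.1 * ‖iteratedFDeriv ℝ p.2 (fun w => Φ u (-w)) w‖) := fun p =>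
    (hint p).mono' (Continuous.aestronglyMeasurable
      ((continuous_norm.pow _).mul ((h'.contDiff u).continuous_iteratedFDeriv
        (mod_cast le_top)).norm)) (Eventually.of_forall (key p))
  have e : 𝓕⁻ (Φ u) = 𝓕 (fun w => Φ u (-w)) := by
    rw [Real.fourierInv_eq_fourier_comp_neg]
  rw [e]
  refine (pow_mul_norm_iteratedFDeriv_fourier_le (K := ⊤) (N := ⊤) (h'.contDiff u)
    (fun k n _ _ => hint' (k, n)) (mod_cast le_top) (mod_cast le_top) z).trans ?_
  gcongr with p hp
  calc _ ≤ ∫ w, (Metric.closedBall (0 : V) R).indicator (fun _ => |R| ^ p.1 * D p.2) w :=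
        integral_mono (hint' p) (hint p) (fun w => (le_abs_self _).trans (key p w))
    _ = _ := by
        rw [integral_indicator Metric.isClosed_closedBall.measurableSet, setIntegral_const]
        simp [Measure.real, vol, mul_comm]

lemma exists_decay' (h : IsSymbolFamily Φ R) (a b : ℝ) (n k : ℕ) :
    ∃ C : ℝ, 0 ≤ C ∧ ∀ u ∈ Set.Icc a b, ∀ z,
      ‖iteratedFDeriv ℝ k (𝓕⁻ (Φ u)) z‖ ≤ C * (1 + ‖z‖) ^ (-(n : ℤ)) := by
  obtain ⟨C, hC0, hC⟩ := h.exists_decay a b n k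
  obtain ⟨C', hC0', hC'⟩ := h.exists_decay a b 0 k
  refine ⟨2 ^ (n - 1) * (C' + C), by positivity, fun u hu z => ?_⟩
  have hz : 0 < 1 + ‖z‖ := by positivity
  rw [zpow_neg, ← div_eq_mul_inv, le_div_iff₀ (by positivity), zpow_natCast]
  have h1 := add_pow_le zero_le_one (norm_nonneg z) n
  have h2 := hC u hu z
  have h3 := hC' u hu z
  rw [pow_zero, one_mul] at h3
  calc _ ≤ ‖iteratedFDeriv ℝ k (𝓕⁻ (Φ u)) z‖ * (2 ^ (n - 1) * (1 ^ n + ‖z‖ ^ n)) := by gcongr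
    _ = 2 ^ (n - 1) * (‖iteratedFDeriv ℝ k (𝓕⁻ (Φ u)) z‖ +
          ‖z‖ ^ n * ‖iteratedFDeriv ℝ k (𝓕⁻ (Φ u)) z‖) := by ring
    _ ≤ _ := by gcongr

lemma exists_decay_zero (h : IsSymbolFamily Φ R) (a b : ℝ) (n : ℕ) :
    ∃ C : ℝ, 0 ≤ C ∧ ∀ u ∈ Set.Icc a b, ∀ z,
      ‖𝓕⁻ (Φ u) z‖ ≤ C * (1 + ‖z‖) ^ (-(n : ℤ)) := by
  simpa using h.exists_decay' a b n 0

/-- The source of all uniform `L¹` bounds: a degenerate regime is reparametrized so that its limit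
becomes an endpoint of `[a, b]`, up to which the family stays smooth. -/
lemma exists_lintegral_le (h : IsSymbolFamily Φ R) (a b : ℝ) :
    ∃ C : ℝ≥0, ∀ u ∈ Set.Icc a b, ∫⁻ z, ‖𝓕⁻ (Φ u) z‖ₑ ≤ C := by
  -- Decay of order dimension plus one is integrable.
  set n := Module.finrank ℝ V + 1
  obtain ⟨C, hC0, hC⟩ := h.exists_decay_zero a b n
  have hint : Integrable (fun z : V => C * (1 + ‖z‖) ^ (-(n : ℤ))) := by
    have := integrable_one_add_norm (E := V) (μ := volume) (r := n) (by simp [n])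
    refine (this.const_mul C).congr (Eventually.of_forall fun z => ?_)
    simp only
    rw [← Real.rpow_intCast]; simp
  refine ⟨(∫⁻ z : V, ‖C * (1 + ‖z‖) ^ (-(n : ℤ))‖ₑ).toNNReal, fun u hu => ?_⟩
  rw [ENNReal.coe_toNNReal hint.2.ne]
  refine lintegral_mono fun z => enorm_le_iff_norm_le.2 ?_
  rw [Real.norm_of_nonneg (by positivity)]
  exact hC u hu z

lemma fourierInv_eq (u : ℝ) (z : V) :
    𝓕⁻ (Φ u) z = ∫ w, 𝐞 (inner ℝ w z) • Φ u w := Real.fourierInv_eq _ _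

/-- Joint smoothness in `(u, z)` comes from the smoothness of convolutions depending on a parameter:
the kernel is the convolution of the constant `1` with the compactly supported function `g (u, z)`,
evaluated at the point `0`. -/
lemma contDiff_fourierInv (h : IsSymbolFamily Φ R) :
    ContDiff ℝ ∞ (fun q : ℝ × V => 𝓕⁻ (Φ q.1) q.2) := by
  set g : ℝ × V → V → ℂ := fun p w => (𝐞 (inner ℝ (-w) p.2) : ℂ) * Φ p.1 (-w)
  have hg : ContDiff ℝ ∞ (Function.uncurry g) := by
    refine ContDiff.mul ?_ (h.smooth.comp ((contDiff_fst.comp contDiff_fst).prodMk contDiff_snd.neg))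
    have : ∀ x : ℝ, (𝐞 x : ℂ) = Complex.exp (2 * π * x * Complex.I) := fun x => by
      rw [Real.fourierChar_apply]; push_cast; ring_nf
    simp only [this]
    have h1 : ContDiff ℝ ∞ (fun x : (ℝ × V) × V => (inner ℝ (-x.2) x.1.2 : ℝ)) :=
      contDiff_snd.neg.inner ℝ (contDiff_snd.comp contDiff_fst)
    have h2 : ContDiff ℝ ∞ (fun x : (ℝ × V) × V => ((inner ℝ (-x.2) x.1.2 : ℝ) : ℂ)) :=
      Complex.ofRealCLM.contDiff.comp h1
    fun_prop
  have := contDiffOn_convolution_right_with_param (𝕜 := ℝ) (f := fun _ : V => (1 : ℂ)) (n := ⊤)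
    (μ := (volume : Measure V))
    (ContinuousLinearMap.mul ℝ ℂ) (g := g) (s := Set.univ) (k := Metric.closedBall 0 R) isOpen_univ
    (isCompact_closedBall 0 R) (fun p x _ hx => by
      simp only [g]
      rw [h.vanish _ _ (by simpa using hx), mul_zero]) (locallyIntegrable_const _)
    (by exact hg.contDiffOn)
  rw [Set.univ_prod_univ, contDiffOn_univ] at this
  have h2 := this.comp ((contDiff_id (E := ℝ × V)).prodMk (contDiff_const (c := (0 : V))))
  convert h2 using 2 with q
  simp only [Function.comp_def, convolution, fourierInv_eq, g, id]
  simp [Circle.smul_def]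

lemma hasDerivAt_fourierInv {Φ' : ℝ → V → ℂ} (h : IsSymbolFamily Φ R) (h' : IsSymbolFamily Φ' R)
    (hd : ∀ u w, HasDerivAt (fun u => Φ u w) (Φ' u w) u) (u : ℝ) (z : V) :
    HasDerivAt (fun u => 𝓕⁻ (Φ u) z) (𝓕⁻ (Φ' u) z) u := by
  obtain ⟨C, hC0, hC⟩ := h'.exists_norm_iteratedFDeriv_le (u - 1) (u + 1) 0
  have hcont : ∀ {Ψ : ℝ → V → ℂ}, IsSymbolFamily Ψ R → ∀ u,
      Continuous fun w => 𝐞 (inner ℝ w z) • Ψ u w := fun {Ψ} hΨ u => by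
    have h1 : Continuous fun w : V => 𝐞 (inner ℝ w z) :=
      Real.continuous_fourierChar.comp (continuous_id.inner continuous_const)
    exact h1.smul (hΨ.contDiff u).continuous
  simp only [fourierInv_eq]
  refine (hasDerivAt_integral_of_dominated_loc_of_deriv_le (s := Metric.ball u 1)
    (F := fun u w => 𝐞 (inner ℝ w z) • Φ u w) (F' := fun u w => 𝐞 (inner ℝ w z) • Φ' u w)
    (bound := (Metric.closedBall (0 : V) R).indicator fun _ => C) (Metric.ball_mem_nhds _ one_pos)
    ?_ ?_ ?_ ?_ ?_ ?_).2
  · exact Eventually.of_forall fun u => (hcont h u).aestronglyMeasurable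
  · exact (hcont h u).integrable_of_hasCompactSupport (h.hasCompactSupport u).smul_left
  · exact (hcont h' u).aestronglyMeasurable
  · refine Eventually.of_forall fun w u' hu' => ?_
    rw [Circle.norm_smul]
    by_cases hw : w ∈ Metric.closedBall (0 : V) R
    · rw [Set.indicator_of_mem hw]
      rw [Metric.mem_ball, Real.dist_eq, abs_lt] at hu'
      simpa using hC u' ⟨by linarith, by linarith⟩ w
    · rw [Set.indicator_of_notMem hw, h'.vanish _ _ (by simpa using hw)]; simp
  · exact (integrable_indicator_iff Metric.isClosed_closedBall.measurableSet).2
      (integrableOn_const (isCompact_closedBall (0 : V) R).measure_lt_top.ne)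
  · refine Eventually.of_forall fun w u' _ => ?_
    simp only [Circle.smul_def, smul_eq_mul]
    exact (hd u' w).const_mul _

end IsSymbolFamily

end SymbolFamilies

end KineticAveraging

namespace KineticAveraging

open Real FourierTransform Filter Topology

/-! ### Kernels under linear changes of the frequency variable -/

section LinearChange

variable {V : Type*} [NormedAddCommGroup V] [InnerProductSpace ℝ V] [FiniteDimensional ℝ V]
  [MeasurableSpace V] [BorelSpace V]

lemma enorm_fourierInv_smul {r : ℝ} (hr : 0 ≤ r) (f : V → ℂ) (z : V) :
    ‖𝓕⁻ (fun w => r • f w) z‖ₑ = ENNReal.ofReal r * ‖𝓕⁻ f z‖ₑ := by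
  rw [Real.fourierInv_eq, Real.fourierInv_eq]
  simp_rw [smul_comm _ r]
  rw [integral_smul, enorm_smul, Real.enorm_eq_ofReal hr]

lemma map_continuousLinearEquiv_volume (A : V ≃L[ℝ] V) :
    ∃ c : ℝ≥0, Measure.map A (volume : Measure V) = (c : ℝ≥0∞) • volume := by
  have h := Measure.map_linearMap_addHaar_eq_smul_addHaar (volume : Measure V)
    (f := (A.toLinearEquiv : V →ₗ[ℝ] V)) A.toLinearEquiv.isUnit_det'.ne_zero
  exact ⟨Real.toNNReal _, h⟩

lemma lintegral_comp_continuousLinearEquiv (A : V ≃L[ℝ] V) {c : ℝ≥0}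
    (hc : Measure.map A (volume : Measure V) = (c : ℝ≥0∞) • volume) (f : V → ℝ≥0∞) :
    ∫⁻ z, f (A z) = c * ∫⁻ z, f z := by
  have := lintegral_map_equiv (μ := (volume : Measure V)) f A.toHomeomorph.toMeasurableEquiv
  simp only [Homeomorph.toMeasurableEquiv_coe, ContinuousLinearEquiv.coe_toHomeomorph] at this
  rw [← this, hc, lintegral_smul_measure, smul_eq_mul]

lemma fourierInv_comp_symmetric (A : V ≃L[ℝ] V)
    (hA : ∀ x y, (inner ℝ (A x) y : ℝ) = inner ℝ x (A y)) {c : ℝ≥0}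
    (hc : Measure.map A (volume : Measure V) = (c : ℝ≥0∞) • volume) (g : V → ℂ) (z : V) :
    𝓕⁻ (fun w => g (A w)) z = (c : ℝ) • 𝓕⁻ g (A.symm z) := by
  rw [Real.fourierInv_eq, Real.fourierInv_eq]
  have h1 : ∀ w, 𝐞 (inner ℝ w z) • g (A w) =
      (fun w' => 𝐞 (inner ℝ w' (A.symm z)) • g w') (A w) := fun w => by
    simp only
    rw [hA, A.apply_symm_apply]
  simp_rw [h1]
  have h2 := integral_map_equiv (μ := (volume : Measure V)) A.toHomeomorph.toMeasurableEquiv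
    (fun w' => 𝐞 (inner ℝ w' (A.symm z)) • g w')
  simp only [Homeomorph.toMeasurableEquiv_coe, ContinuousLinearEquiv.coe_toHomeomorph] at h2
  rw [← h2, hc, integral_smul_measure]
  simp

/-- The Jacobian produced in the kernel cancels the one from the change of variables, so `L¹` norms
of kernels are invariant under dilations of the symbol. The weight `W` is carried along for the sake
of moments. -/
lemma lintegral_fourierInv_comp_symmetric (A : V ≃L[ℝ] V)
    (hA : ∀ x y, (inner ℝ (A x) y : ℝ) = inner ℝ x (A y)) (g : V → ℂ) (W : V → ℝ≥0∞) :
    ∫⁻ z, ‖𝓕⁻ (fun w => g (A w)) z‖ₑ * W z = ∫⁻ z, ‖𝓕⁻ g z‖ₑ * W (A z) := by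
  obtain ⟨c, hc⟩ := map_continuousLinearEquiv_volume A
  have h := lintegral_comp_continuousLinearEquiv A hc (fun z => ‖𝓕⁻ g (A.symm z)‖ₑ * W z)
  simp only [ContinuousLinearEquiv.symm_apply_apply] at h
  rw [h, ← lintegral_const_mul' _ _ ENNReal.coe_ne_top]
  refine lintegral_congr fun z => ?_
  rw [fourierInv_comp_symmetric A hA hc, enorm_smul, ← mul_assoc]
  congr 2
  simp [enorm_eq_nnnorm]

end LinearChange

/-! ### Anisotropic dilations and `L¹` bounds for resolvent multipliers -/

variable {d : ℕ}

/-- The anisotropic dilation `(t, x) ↦ (α t, β x)` of space-time. -/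
def dilation (α β : ℝ) (hα : α ≠ 0) (hβ : β ≠ 0) : SpaceTime d ≃L[ℝ] SpaceTime d :=
  LinearEquiv.toContinuousLinearEquiv
    { toFun := fun w => pt (α * w.fst) (β • w.snd)
      invFun := fun w => pt (α⁻¹ * w.fst) (β⁻¹ • w.snd)
      map_add' := fun x y => by
        apply WithLp.ofLp_injective; ext <;> simp [mul_add]
      map_smul' := fun r x => by
        apply WithLp.ofLp_injective; ext <;> simp <;> ring
      left_inv := fun x => by
        apply WithLp.ofLp_injective; ext <;> simp [hα, hβ]
      right_inv := fun x => by
        apply WithLp.ofLp_injective; ext <;> simp [hα, hβ] }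

@[simp] lemma dilation_fst (α β : ℝ) (hα : α ≠ 0) (hβ : β ≠ 0) (w : SpaceTime d) :
    (dilation α β hα hβ w).fst = α * w.fst := rfl

@[simp] lemma dilation_snd (α β : ℝ) (hα : α ≠ 0) (hβ : β ≠ 0) (w : SpaceTime d) :
    (dilation α β hα hβ w).snd = β • w.snd := rfl

lemma inner_dilation (α β : ℝ) (hα : α ≠ 0) (hβ : β ≠ 0) (x y : SpaceTime d) :
    (inner ℝ (dilation α β hα hβ x) y : ℝ) = inner ℝ x (dilation α β hα hβ y) := by
  rw [WithLp.prod_inner_apply, WithLp.prod_inner_apply]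
  change inner ℝ (α * x.fst) y.fst + inner ℝ (β • x.snd) y.snd =
    inner ℝ x.fst (α * y.fst) + inner ℝ x.snd (β • y.snd)
  rw [real_inner_smul_left, real_inner_smul_right]
  simp; ring

lemma lintegral_fourierInv_dilation (α β : ℝ) (hα : α ≠ 0) (hβ : β ≠ 0) (g : SpaceTime d → ℂ) :
    ∫⁻ z, ‖𝓕⁻ (fun w => g (dilation α β hα hβ w)) z‖ₑ = ∫⁻ z, ‖𝓕⁻ g z‖ₑ := by
  simpa using lintegral_fourierInv_comp_symmetric (dilation α β hα hβ)
    (inner_dilation α β hα hβ) g 1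

/-- A smooth function of the time frequency supported in `[-2, 2]`. -/
structure IsTimeCutoff (X : ℝ → ℝ) : Prop where
  smooth : ContDiff ℝ ∞ X
  vanish : ∀ τ, 2 < |τ| → X τ = 0

/-- A smooth function of the space frequency supported in a dyadic annulus. -/
structure IsSpaceCutoff (φ : Space d → ℝ) : Prop where
  smooth : ContDiff ℝ ∞ φ
  support : Function.support φ ⊆ {ξ | 1 / 2 ≤ ‖ξ‖ ∧ ‖ξ‖ ≤ 2}

lemma IsTimeCutoff.sub_comp_two_mul {X : ℝ → ℝ} (hX : IsTimeCutoff X) :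
    IsTimeCutoff (fun τ => X τ - X (2 * τ)) where
  smooth := hX.smooth.sub (hX.smooth.comp (contDiff_const.mul contDiff_id))
  vanish τ hτ := by
    rw [hX.vanish τ hτ, hX.vanish (2 * τ) (by rw [abs_mul]; simp; linarith), sub_zero]

/-- The symbol `X(τ) φ(ξ)`. -/
def unitSymbol (X : ℝ → ℝ) (φ : Space d → ℝ) (w : SpaceTime d) : ℂ := ((X w.fst * φ w.snd : ℝ) : ℂ)

/-- The multiplier `(r |ξ|²)ᵏ (i τ + r |ξ|²)⁻ᵏ⁻¹`. -/
def resolventPow (k : ℕ) (r : ℝ) (w : SpaceTime d) : ℂ :=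
  ((r * ‖w.snd‖ ^ 2 : ℝ) : ℂ) ^ k / (Complex.I * w.fst + (r * ‖w.snd‖ ^ 2 : ℝ)) ^ (k + 1)

lemma norm_lt_of_cutoff {X : ℝ → ℝ} {φ : Space d → ℝ} (hX : IsTimeCutoff X) (hφ : IsSpaceCutoff φ)
    {w : SpaceTime d} (hw : 3 < ‖w‖) : unitSymbol X φ w = 0 := by
  have h2 : ‖w‖ ^ 2 = ‖w.fst‖ ^ 2 + ‖w.snd‖ ^ 2 := WithLp.prod_norm_sq_eq_of_L2 w
  by_cases h : 2 < |w.fst|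
  · simp [unitSymbol, hX.vanish _ h]
  · have : φ w.snd = 0 := by
      by_contra hc
      have h3 := (hφ.support hc).2
      rw [Real.norm_eq_abs] at h2
      nlinarith [abs_nonneg w.fst, norm_nonneg w.snd]
    simp [unitSymbol, this]

lemma contDiff_fst_spaceTime : ContDiff ℝ ∞ (fun w : SpaceTime d => w.fst) :=
  (WithLp.fstL 2 ℝ ℝ (Space d)).contDiff

lemma contDiff_snd_spaceTime : ContDiff ℝ ∞ (fun w : SpaceTime d => w.snd) :=
  (WithLp.sndL 2 ℝ ℝ (Space d)).contDiff

lemma contDiff_unitSymbol {X : ℝ → ℝ} {φ : Space d → ℝ} (hX : IsTimeCutoff X)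
    (hφ : IsSpaceCutoff φ) : ContDiff ℝ ∞ (unitSymbol X φ) :=
  Complex.ofRealCLM.contDiff.comp ((hX.smooth.comp contDiff_fst_spaceTime).mul
    (hφ.smooth.comp contDiff_snd_spaceTime))

lemma contDiff_div_of_locally {E : Type*} [NormedAddCommGroup E] [NormedSpace ℝ E]
    {f g : E → ℂ} (hf : ContDiff ℝ ∞ f) (hg : ContDiff ℝ ∞ g)
    (h : ∀ x, g x ≠ 0 ∨ f =ᶠ[𝓝 x] 0) : ContDiff ℝ ∞ (fun x => f x / g x) := by
  rw [contDiff_iff_contDiffAt]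
  intro x
  rcases h x with h | h
  · simp only [div_eq_mul_inv]
    exact hf.contDiffAt.mul (hg.contDiffAt.inv h)
  · refine (contDiffAt_const (c := (0 : ℂ))).congr_of_eventuallyEq ?_
    filter_upwards [h] with y hy
    simp [hy]

lemma unitSymbol_eventually_zero_of_snd (X : ℝ → ℝ) {φ : Space d → ℝ} (hφ : IsSpaceCutoff φ)
    {w : SpaceTime d} (hw : ‖w.snd‖ < 1 / 2) : ∀ᶠ w' in 𝓝 w, unitSymbol X φ w' = 0 := by
  have : ∀ᶠ w' in 𝓝 w, ‖w'.snd‖ < 1 / 2 :=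
    (contDiff_snd_spaceTime.continuous.norm).continuousAt.eventually_lt continuousAt_const hw
  filter_upwards [this] with w' hw'
  have : φ w'.snd = 0 := by
    by_contra hc
    exact absurd (hφ.support hc).1 (not_le.2 hw')
  simp [unitSymbol, this]

lemma unitSymbol_eventually_zero_of_fst {X : ℝ → ℝ} (φ : Space d → ℝ)
    (hX : ∀ τ, |τ| < 1 / 2 → X τ = 0)
    {w : SpaceTime d} (hw : |w.fst| < 1 / 2) : ∀ᶠ w' in 𝓝 w, unitSymbol X φ w' = 0 := by
  have : ∀ᶠ w' in 𝓝 w, |w'.fst| < 1 / 2 :=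
    (contDiff_fst_spaceTime.continuous.abs).continuousAt.eventually_lt continuousAt_const hw
  filter_upwards [this] with w' hw'
  simp [unitSymbol, hX _ hw']

lemma I_mul_add_ne_zero {a b : ℝ} (h : a ≠ 0 ∨ b ≠ 0) : Complex.I * a + (b : ℂ) ≠ 0 := by
  intro h0
  have h1 := congrArg Complex.re h0
  have h2 := congrArg Complex.im h0
  simp at h1 h2
  tauto

lemma contDiff_den {E : Type*} [NormedAddCommGroup E] [NormedSpace ℝ E] {f g : E → ℝ}
    (hf : ContDiff ℝ ∞ f) (hg : ContDiff ℝ ∞ g) :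
    ContDiff ℝ ∞ (fun q => Complex.I * (f q : ℂ) + (g q : ℂ)) :=
  (contDiff_const.mul (Complex.ofRealCLM.contDiff.comp hf)).add (Complex.ofRealCLM.contDiff.comp hg)

/-- Smoothness of `X(τ) φ(ξ) b / (i a + c)^n` for scalar functions `a, b, c` of a parameter
and of the frequency. -/
lemma isSymbolFamily_div {X : ℝ → ℝ} {φ : Space d → ℝ} (hX : IsTimeCutoff X)
    (hφ : IsSpaceCutoff φ) {f g b : ℝ × SpaceTime d → ℝ} (hf : ContDiff ℝ ∞ f)
    (hg : ContDiff ℝ ∞ g) (hb : ContDiff ℝ ∞ b) (n : ℕ)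
    (h : ∀ q, f q ≠ 0 ∨ g q ≠ 0 ∨ ∀ᶠ w in 𝓝 q.2, unitSymbol X φ w = 0) :
    IsSymbolFamily (fun u w => unitSymbol X φ w * b (u, w) /
      (Complex.I * f (u, w) + g (u, w)) ^ n) 3 where
  smooth := by
    refine contDiff_div_of_locally (f := fun q => unitSymbol X φ q.2 * b q)
      (g := fun q => (Complex.I * f q + g q) ^ n)
      (((contDiff_unitSymbol hX hφ).comp contDiff_snd).mul
      (Complex.ofRealCLM.contDiff.comp hb)) ((contDiff_den hf hg).pow n) fun q => ?_
    rcases h q with h | h | h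
    · exact Or.inl (pow_ne_zero _ (I_mul_add_ne_zero (Or.inl h)))
    · exact Or.inl (pow_ne_zero _ (I_mul_add_ne_zero (Or.inr h)))
    · right
      have := continuous_snd.continuousAt.eventually h
      filter_upwards [this] with q' hq'
      simp [hq']
  vanish u w hw := by simp [norm_lt_of_cutoff hX hφ hw]

/-- The `L¹` norm of the kernel with symbol `X(τ) φ(ξ) Q(τ, ξ)`. -/
def kernelNorm (X : ℝ → ℝ) (φ : Space d → ℝ) (Q : SpaceTime d → ℂ) : ℝ≥0∞ :=
  ∫⁻ z, ‖𝓕⁻ (fun w => unitSymbol X φ w * Q w) z‖ₑ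

/-- Homogeneous families of multipliers which are smooth away from `τ = 0` down to `r = 0` and
away from `ξ = 0` up to `r = ∞`. -/
structure IsHomogeneousMultiplier (φ : Space d → ℝ) (Q : ℝ → SpaceTime d → ℂ) : Prop where
  scale : ∀ c (hc : 0 < c) r w, Q r (dilation c 1 hc.ne' one_ne_zero w) = (c⁻¹ : ℝ) * Q (r / c) w
  small : ∀ X, IsTimeCutoff X → (∀ τ, |τ| < 1 / 2 → X τ = 0) →
    ∃ C : ℝ≥0, ∀ r, 0 < r → r ≤ 1 → kernelNorm X φ (Q r) ≤ C
  large : ∀ X, IsTimeCutoff X →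
    ∃ C : ℝ≥0, ∀ r, 1 ≤ r → kernelNorm X φ (Q r) ≤ C * ENNReal.ofReal r⁻¹
  integrable : ∀ X, IsTimeCutoff X → ∀ r, 0 < r → Integrable (fun w => unitSymbol X φ w * Q r w)

lemma mul_pow_div_pow_succ {r : ℂ} (hr : r ≠ 0) (x y : ℂ) (k : ℕ) :
    (r * y) ^ k / x ^ (k + 1) = r⁻¹ * (y ^ k / (r⁻¹ * x) ^ (k + 1)) := by
  rw [mul_pow, mul_pow, inv_pow, pow_succ r]
  by_cases hx : x = 0
  · simp [hx]
  · field_simp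

/-- Where `|τ| ≥ 1/2` the denominator does not vanish, so the family is smooth in `r` down to `r =
0`. For `r ≥ 1` a factor `r⁻¹` is extracted, and what remains is smooth in `u = r⁻¹` down to `u = 0`
because `|ξ| ≥ 1/2` on the support of `φ`. -/
lemma isHomogeneousMultiplier_resolventPow {φ : Space d → ℝ} (hφ : IsSpaceCutoff φ) (k : ℕ) :
    IsHomogeneousMultiplier φ (resolventPow k) := by
  have big : ∀ X, IsTimeCutoff X → IsSymbolFamily (fun u w => unitSymbol X φ w *
      (((‖w.snd‖ ^ 2) ^ k : ℝ) : ℂ) /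
      (Complex.I * (u * w.fst : ℝ) + (‖w.snd‖ ^ 2 : ℝ)) ^ (k + 1)) 3 := fun X hX => by
    refine isSymbolFamily_div (f := fun q => q.1 * q.2.fst) (g := fun q => ‖q.2.snd‖ ^ 2)
      (b := fun q => (‖q.2.snd‖ ^ 2) ^ k) hX hφ
      (contDiff_fst.mul (contDiff_fst_spaceTime.comp contDiff_snd))
      ((contDiff_snd_spaceTime.norm_sq ℝ).comp contDiff_snd)
      (((contDiff_snd_spaceTime.norm_sq ℝ).comp contDiff_snd).pow k) (k + 1) fun q => ?_
    by_cases hq : ‖q.2.snd‖ < 1 / 2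
    · exact Or.inr (Or.inr (unitSymbol_eventually_zero_of_snd X hφ hq))
    · right; left
      have : 0 < ‖q.2.snd‖ := by linarith
      positivity
  have heq : ∀ X : ℝ → ℝ, ∀ r : ℝ, 0 < r →
      (fun w : SpaceTime d => unitSymbol X φ w * resolventPow k r w)
      = fun w => (r⁻¹ : ℝ) • (unitSymbol X φ w * (((‖w.snd‖ ^ 2) ^ k : ℝ) : ℂ) /
      (Complex.I * (r⁻¹ * w.fst : ℝ) + (‖w.snd‖ ^ 2 : ℝ)) ^ (k + 1)) := fun X r hr => by
    ext w
    have hr' : (r : ℂ) ≠ 0 := by exact_mod_cast hr.ne'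
    have : Complex.I * (r⁻¹ * w.fst : ℝ) + (‖w.snd‖ ^ 2 : ℝ) =
      (r : ℂ)⁻¹ * (Complex.I * w.fst + (r * ‖w.snd‖ ^ 2 : ℝ)) := by
        push_cast; field_simp
    rw [this, resolventPow, Complex.real_smul, Complex.ofReal_mul r, mul_pow_div_pow_succ hr']
    push_cast
    ring
  constructor
  · intro c hc r w
    have hc' : (c : ℂ) ≠ 0 := by exact_mod_cast hc.ne'
    simp only [resolventPow, dilation_fst, dilation_snd, one_smul]
    have : Complex.I * ((c * w.fst : ℝ) : ℂ) + (r * ‖w.snd‖ ^ 2 : ℝ) =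
      c * (Complex.I * w.fst + (r / c * ‖w.snd‖ ^ 2 : ℝ)) := by
        push_cast; field_simp
    have h1 : (((r / c * ‖w.snd‖ ^ 2 : ℝ) : ℂ)) = (c : ℂ)⁻¹ * ((r * ‖w.snd‖ ^ 2 : ℝ) : ℂ) := by
      push_cast; ring
    have h2 := mul_pow_div_pow_succ (inv_ne_zero hc')
      (Complex.I * w.fst + (r / c * ‖w.snd‖ ^ 2 : ℝ)) ((r * ‖w.snd‖ ^ 2 : ℝ) : ℂ) k
    rw [← h1, inv_inv] at h2
    rw [this, h2, Complex.ofReal_inv, ← mul_assoc, inv_mul_cancel₀ hc', one_mul]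
  · intro X hX hX0
    have fam := isSymbolFamily_div (f := fun q => q.2.fst) (g := fun q => q.1 * ‖q.2.snd‖ ^ 2)
      (b := fun q => (q.1 * ‖q.2.snd‖ ^ 2) ^ k) hX hφ (contDiff_fst_spaceTime.comp contDiff_snd)
      (contDiff_fst.mul ((contDiff_snd_spaceTime.norm_sq ℝ).comp contDiff_snd))
      ((contDiff_fst.mul ((contDiff_snd_spaceTime.norm_sq ℝ).comp contDiff_snd)).pow k) (k + 1)
      fun q => by
        by_cases hq : |q.2.fst| < 1 / 2
        · exact Or.inr (Or.inr (unitSymbol_eventually_zero_of_fst φ hX0 hq))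
        · left
          intro h; rw [h] at hq; norm_num at hq
    obtain ⟨C, hC⟩ := fam.exists_lintegral_le 0 1
    refine ⟨C, fun r h0 h1 => ?_⟩
    have := hC r ⟨h0.le, h1⟩
    refine le_trans (le_of_eq ?_) this
    rw [kernelNorm]
    refine lintegral_congr fun z => congrArg (fun f : SpaceTime d → ℂ => ‖𝓕⁻ f z‖ₑ) ?_
    funext w
    simp [resolventPow, mul_div_assoc]
  · intro X hX
    obtain ⟨C, hC⟩ := (big X hX).exists_lintegral_le 0 1
    refine ⟨C, fun r hr => ?_⟩
    have hr0 : 0 < r := by linarith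
    rw [kernelNorm, heq X r hr0]
    have := hC r⁻¹ ⟨by positivity, inv_le_one_of_one_le₀ hr⟩
    simp_rw [enorm_fourierInv_smul (inv_nonneg.2 hr0.le)]
    rw [lintegral_const_mul' _ _ ENNReal.ofReal_ne_top, mul_comm]
    gcongr
  · intro X hX r hr
    rw [heq X r hr]
    exact Integrable.smul r⁻¹ (((big X hX).contDiff r⁻¹).continuous.integrable_of_hasCompactSupport
      ((big X hX).hasCompactSupport r⁻¹))

namespace IsHomogeneousMultiplier

variable {φ : Space d → ℝ} {Q : ℝ → SpaceTime d → ℂ} {X : ℝ → ℝ}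

/-- By homogeneity of degree `-1`, narrowing the time cutoff by `2ⁿ` amounts to a factor `2ⁿ` and
the replacement of `r` by `2ⁿ r`. -/
lemma kernelNorm_comp_two_pow (hQ : IsHomogeneousMultiplier φ Q) (X : ℝ → ℝ) (n : ℕ) (r : ℝ) :
    kernelNorm (fun τ => X (2 ^ n * τ)) φ (Q r) =
      ENNReal.ofReal (2 ^ n) * kernelNorm X φ (Q (2 ^ n * r)) := by
  have h2 : (0 : ℝ) < 2 ^ n := by positivity
  have e : (fun w : SpaceTime d => unitSymbol (fun τ => X (2 ^ n * τ)) φ w * Q r w) = fun w =>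
      ((2 : ℝ) ^ n) • ((fun w => unitSymbol X φ w * Q (2 ^ n * r) w)
        (dilation (2 ^ n) 1 h2.ne' one_ne_zero w)) := by
    ext w
    have h3 : ((2 : ℂ) ^ n) ≠ 0 := pow_ne_zero _ two_ne_zero
    simp only
    rw [hQ.scale _ h2, mul_div_cancel_left₀ _ h2.ne']
    simp only [unitSymbol, dilation_fst, dilation_snd, one_smul, Complex.real_smul]
    push_cast
    field_simp
  rw [kernelNorm, e]
  simp_rw [enorm_fourierInv_smul h2.le]
  rw [lintegral_const_mul' _ _ ENNReal.ofReal_ne_top, kernelNorm]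
  congr 1
  exact lintegral_fourierInv_dilation _ _ h2.ne' one_ne_zero
    (fun w => unitSymbol X φ w * Q (2 ^ n * r) w)

lemma kernelNorm_add_le {X Y : ℝ → ℝ} {Q : SpaceTime d → ℂ}
    (hX : Integrable (fun w => unitSymbol X φ w * Q w))
    (hY : Integrable (fun w => unitSymbol Y φ w * Q w)) :
    kernelNorm (fun τ => X τ + Y τ) φ Q ≤ kernelNorm X φ Q + kernelNorm Y φ Q := by
  have hm : ∀ f : SpaceTime d → ℂ, Integrable f → Measurable fun z => ‖𝓕⁻ f z‖ₑ := fun f hf => by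
    have h : Continuous (𝓕⁻ f) := by
      have : 𝓕⁻ f = fun z => 𝓕 f (-z) := funext fun z => Real.fourierInv_eq_fourier_neg f z
      rw [this]
      exact (VectorFourier.fourierIntegral_continuous Real.continuous_fourierChar
        (by exact continuous_inner) hf).comp continuous_neg
    exact h.measurable.enorm
  rw [kernelNorm, kernelNorm, kernelNorm, ← lintegral_add_left (hm _ hX)]
  refine lintegral_mono fun z => ?_
  refine le_trans (le_of_eq ?_) (enorm_add_le _ _)
  congr 1
  rw [Real.fourierInv_eq, Real.fourierInv_eq, Real.fourierInv_eq, ← integral_add]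
  · congr 1; ext w
    simp only [unitSymbol, Circle.smul_def, smul_eq_mul]
    push_cast; ring
  · have := (Real.fourierIntegral_convergent_iff (-z)).2 hX
    simpa using this
  · have := (Real.fourierIntegral_convergent_iff (-z)).2 hY
    simpa using this

/-- For small `r`, write `X` as the sum of `Y(2ᵏ ·)` over `k < n` plus `X(2ⁿ ·)`, where `Y = X - X(2
·)` vanishes near `0`. The `k`-th piece costs a multiple of `2ᵏ` by `small`, and the remainder costs
a multiple of `2ⁿ` by `large` once `2ⁿ r` is of order one. The geometric sum is of order `r⁻¹`. -/
lemma low_frequency (hQ : IsHomogeneousMultiplier φ Q) (hX : IsTimeCutoff X)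
    (hX1 : ∀ τ, |τ| ≤ 1 → X τ = 1) :
    ∃ C : ℝ≥0, ∀ r, 0 < r → kernelNorm X φ (Q r) ≤ C * ENNReal.ofReal r⁻¹ := by
  obtain ⟨C₁, h₁⟩ := hQ.large X hX
  set Y : ℝ → ℝ := fun τ => X τ - X (2 * τ)
  have hY : IsTimeCutoff Y := hX.sub_comp_two_mul
  obtain ⟨C₂, h₂⟩ := hQ.small Y hY fun τ hτ => by
    simp only [Y]
    rw [hX1 τ (by linarith), hX1 (2 * τ) (by rw [abs_mul]; simp; linarith), sub_self]
  have hpow : ∀ {Z : ℝ → ℝ}, IsTimeCutoff Z → ∀ n : ℕ, IsTimeCutoff (fun τ => Z (2 ^ n * τ)) :=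
    fun {Z} hZ n => ⟨hZ.smooth.comp (contDiff_const.mul contDiff_id), fun τ hτ => hZ.vanish _ (by
      rw [abs_mul]
      have : (1 : ℝ) ≤ |2 ^ n| := by rw [abs_of_pos (by positivity)]; exact one_le_pow₀ one_le_two
      nlinarith [abs_nonneg τ])⟩
  -- The accumulated cost is stated as `2ⁿ` instead of `2ⁿ - 1`, so that the induction step is `2ⁿ +
  -- 2ⁿ = 2ⁿ⁺¹`. The bound `2ⁿ⁺¹ r ≤ 2` supplies the `2ⁿ r ≤ 1` that `small` needs for the next
  -- piece.
  have step : ∀ n : ℕ, ∀ r, 0 < r → (2 : ℝ) ^ n * r ≤ 2 → kernelNorm X φ (Q r) ≤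
      kernelNorm (fun τ => X (2 ^ n * τ)) φ (Q r) + C₂ * ENNReal.ofReal (2 ^ n) := by
    intro n
    induction n with
    | zero => intro r hr _; simp
    | succ n ih =>
      intro r hr hn
      have hle : (2 : ℝ) ^ n * r ≤ 1 := by rw [pow_succ] at hn; linarith
      refine (ih r hr (by linarith)).trans ?_
      have e : (fun τ => X (2 ^ n * τ)) =
          fun τ => (fun τ => Y (2 ^ n * τ)) τ + (fun τ => X (2 ^ (n + 1) * τ)) τ := by
        ext τ; simp only [Y]; rw [pow_succ]; ring_nf
      have := kernelNorm_add_le (hQ.integrable _ (hpow hY n) r hr)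
        (hQ.integrable _ (hpow hX (n + 1)) r hr)
      rw [← e, hQ.kernelNorm_comp_two_pow Y] at this
      have h3 := h₂ (2 ^ n * r) (by positivity) hle
      calc _ ≤ ENNReal.ofReal (2 ^ n) * C₂ + kernelNorm (fun τ => X (2 ^ (n + 1) * τ)) φ (Q r)
            + C₂ * ENNReal.ofReal (2 ^ n) := by
            gcongr; exact this.trans (by gcongr)
        _ = kernelNorm (fun τ => X (2 ^ (n + 1) * τ)) φ (Q r) +
            C₂ * (ENNReal.ofReal (2 ^ n) + ENNReal.ofReal (2 ^ n)) := by ring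
        _ = _ := by
            rw [← ENNReal.ofReal_add (by positivity) (by positivity)]
            congr 3; rw [pow_succ]; ring
  refine ⟨C₁ + 2 * C₂, fun r hr => ?_⟩
  by_cases h1 : 1 ≤ r
  · refine (h₁ r h1).trans ?_
    gcongr
    exact le_self_add
  -- With `2ⁿ ≤ r⁻¹ < 2ⁿ⁺¹`, the index `n + 1` satisfies `1 ≤ 2ⁿ⁺¹ r ≤ 2`, so that both the
  -- telescoping and the bound for large parameters apply.
  · obtain ⟨n, hn1, hn2⟩ := exists_nat_pow_near (x := r⁻¹) (y := (2 : ℝ))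
      ((one_le_inv₀ hr).2 (by linarith)) one_lt_two
    have e1 : (2 : ℝ) ^ (n + 1) * r ≤ 2 := by
      rw [pow_succ]
      have : (2 : ℝ) ^ n * r ≤ 1 := by
        calc _ ≤ r⁻¹ * r := by gcongr
          _ = 1 := inv_mul_cancel₀ hr.ne'
      linarith
    have e2 : 1 ≤ (2 : ℝ) ^ (n + 1) * r := by
      calc 1 = r⁻¹ * r := (inv_mul_cancel₀ hr.ne').symm
        _ ≤ _ := by gcongr
    refine (step (n + 1) r hr e1).trans ?_
    rw [hQ.kernelNorm_comp_two_pow]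
    have h3 := h₁ (2 ^ (n + 1) * r) e2
    have h4 : (2 : ℝ) ^ (n + 1) ≤ 2 * r⁻¹ := by rw [pow_succ]; linarith
    calc _ ≤ ENNReal.ofReal (2 ^ (n + 1)) * (C₁ * ENNReal.ofReal (2 ^ (n + 1) * r)⁻¹) +
          C₂ * ENNReal.ofReal (2 * r⁻¹) := by gcongr
      _ = C₁ * ENNReal.ofReal r⁻¹ + 2 * C₂ * ENNReal.ofReal r⁻¹ := by
          congr 1
          · rw [mul_left_comm, ← ENNReal.ofReal_mul (by positivity), mul_inv, ← mul_assoc,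
              mul_inv_cancel₀ (by positivity), one_mul]
          · rw [ENNReal.ofReal_mul zero_le_two]; simp; ring
      _ = _ := by push_cast; ring

end IsHomogeneousMultiplier

/-- The time cutoffs for which the kernel bounds with time regularity `1 - s` hold. -/
def IsAdmissibleCutoff (X : ℝ → ℝ) (s : ℝ) : Prop :=
  IsTimeCutoff X ∧ ((∀ τ, |τ| < 1 / 2 → X τ = 0) ∨ (s = 1 ∧ ∀ τ, |τ| ≤ 1 → X τ = 1))

/-- Away from `τ = 0` the two regimes give `min(1, r⁻¹)` up to a constant, which is at most `r^(-s)`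
for every `s ∈ [0, 1]`. For a cutoff reaching `τ = 0` only the bound `r⁻¹` is at hand, hence `s =
1`. -/
lemma IsAdmissibleCutoff.exists_kernelNorm_le {X : ℝ → ℝ} {s : ℝ} {φ : Space d → ℝ}
    {Q : ℝ → SpaceTime d → ℂ} (hX : IsAdmissibleCutoff X s) (hs₀ : 0 ≤ s) (hs₁ : s ≤ 1)
    (hQ : IsHomogeneousMultiplier φ Q) :
    ∃ C : ℝ≥0, ∀ r, 0 < r → kernelNorm X φ (Q r) ≤ C * ENNReal.ofReal (r ^ (-s)) := by
  rcases hX with ⟨hX, h0 | ⟨rfl, h1⟩⟩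
  · obtain ⟨C₁, h₁⟩ := hQ.small X hX h0
    obtain ⟨C₂, h₂⟩ := hQ.large X hX
    refine ⟨max C₁ C₂, fun r hr => ?_⟩
    rcases le_total r 1 with h | h
    · refine (h₁ r hr h).trans ?_
      calc (C₁ : ℝ≥0∞) = C₁ * ENNReal.ofReal 1 := by simp
        _ ≤ _ := by
          gcongr
          · exact le_max_left _ _
          · exact Real.one_le_rpow_of_pos_of_le_one_of_nonpos hr h (by linarith)
    · refine (h₂ r h).trans ?_
      gcongr
      · exact le_max_right _ _
      · rw [← Real.rpow_neg_one]
        exact Real.rpow_le_rpow_of_exponent_le h (by linarith)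
  · obtain ⟨C, hC⟩ := hQ.low_frequency hX h1
    exact ⟨C, fun r hr => by simpa [Real.rpow_neg_one] using hC r hr⟩

end KineticAveraging

/-! ### The localized fundamental solution of the kinetic operator -/

namespace KineticAveraging

open Real FourierTransform Filter Topology LineDeriv

lemma IsSymbolFamily.comp_equiv {V : Type*} [NormedAddCommGroup V] [InnerProductSpace ℝ V]
    {Φ : ℝ → V → ℂ} {R : ℝ} (h : IsSymbolFamily Φ R) (A : V ≃L[ℝ] V) :
    IsSymbolFamily (fun u w => Φ u (A w)) (‖(A.symm : V →L[ℝ] V)‖ * R) where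
  smooth := h.smooth.comp (contDiff_fst.prodMk (A.contDiff.comp contDiff_snd))
  vanish u w hw := h.vanish u _ (by
    by_contra hc
    have h1 : ‖w‖ ≤ ‖(A.symm : V →L[ℝ] V)‖ * ‖A w‖ := by
      simpa using (A.symm : V →L[ℝ] V).le_opNorm (A w)
    have h2 := mul_le_mul_of_nonneg_left (not_lt.1 hc)
      (ContinuousLinearMap.opNorm_nonneg (A.symm : V →L[ℝ] V))
    linarith)

lemma IsSymbolFamily.const_smul {V : Type*} [NormedAddCommGroup V] [InnerProductSpace ℝ V]
    {Φ : ℝ → V → ℂ} {R : ℝ} (h : IsSymbolFamily Φ R) (c : ℝ) :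
    IsSymbolFamily (fun u w => c • Φ u w) R where
  smooth := h.smooth.const_smul c
  vanish u w hw := by rw [h.vanish u w hw, smul_zero]

variable {d : ℕ}

/-! ### Derivatives of Schwartz functions in time and space -/

/-- The time direction of space-time. -/
def timeDir (d : ℕ) : SpaceTime d := pt 1 0

/-- The `i`-th space direction of space-time. -/
def spaceDir (i : Fin d) : SpaceTime d := pt 0 (EuclideanSpace.basisFun (Fin d) ℝ i)

lemma hasFDerivAt_pt_left (t : ℝ) (x : Space d) :
    HasDerivAt (fun t : ℝ => pt t x) (timeDir d) t := by
  have e : (fun t : ℝ => pt t x) = fun t => t • timeDir d + pt 0 x := by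
    funext t; apply WithLp.ofLp_injective; ext <;> simp [timeDir]
  rw [e]
  simpa using ((hasDerivAt_id t).smul_const (timeDir d)).add_const (pt 0 x)

/-- The embedding of space as the time zero slice. -/
def spaceEmb (d : ℕ) : Space d →L[ℝ] SpaceTime d :=
  ((WithLp.prodContinuousLinearEquiv 2 ℝ ℝ (Space d)).symm : (ℝ × Space d) →L[ℝ] SpaceTime d).comp
    (ContinuousLinearMap.inr ℝ ℝ (Space d))

lemma spaceEmb_apply (x : Space d) : spaceEmb d x = pt 0 x := rfl

lemma norm_spaceEmb_apply (x : Space d) : ‖spaceEmb d x‖ = ‖x‖ := by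
  rw [spaceEmb_apply, ← sq_eq_sq₀ (norm_nonneg _) (norm_nonneg _), WithLp.prod_norm_sq_eq_of_L2]
  simp

lemma pt_eq_spaceEmb_add (t : ℝ) (x : Space d) : pt t x = spaceEmb d x + pt t 0 := by
  rw [spaceEmb_apply]; apply WithLp.ofLp_injective; ext <;> simp

lemma hasFDerivAt_pt_right (t : ℝ) (x : Space d) :
    HasFDerivAt (fun x : Space d => pt t x) (spaceEmb d) x := by
  have e : (fun x : Space d => pt t x) = fun x => spaceEmb d x + pt t 0 :=
    funext (pt_eq_spaceEmb_add t)
  rw [e]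
  exact (spaceEmb d).hasFDerivAt.add_const _

lemma iteratedFDeriv_two_apply_same {E F : Type*} [NormedAddCommGroup E] [NormedSpace ℝ E]
    [NormedAddCommGroup F] [NormedSpace ℝ F] {f : E → F} (hf : ContDiff ℝ ∞ f) (x e : E) :
    iteratedFDeriv ℝ 2 f x ![e, e] = fderiv ℝ (fun y => fderiv ℝ f y e) x e := by
  rw [iteratedFDeriv_two_apply]
  have h : DifferentiableAt ℝ (fderiv ℝ f) x :=
    (contDiff_infty_iff_fderiv.1 hf).2.differentiable (by simp) x
  rw [fderiv_clm_apply h (differentiableAt_const e)]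
  simp

lemma deriv_sub_pt (G : 𝓢(SpaceTime d, ℂ)) (y : SpaceTime d) (t : ℝ) (x : Space d) :
    deriv (fun t => G (y - pt t x)) t = - (∂_{timeDir d} G) (y - pt t x) := by
  have h := (G.differentiableAt (x := y - pt t x)).hasFDerivAt.comp_hasDerivAt t
    ((hasFDerivAt_pt_left t x).const_sub y)
  rw [SchwartzMap.lineDerivOp_apply_eq_fderiv, ← map_neg]
  exact h.deriv

lemma fderiv_sub_pt (G : 𝓢(SpaceTime d, ℂ)) (y : SpaceTime d) (t : ℝ) (x : Space d) (i : Fin d) :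
    fderiv ℝ (fun x => G (y - pt t x)) x (EuclideanSpace.basisFun (Fin d) ℝ i) =
      - (∂_{spaceDir i} G) (y - pt t x) := by
  have h := (G.differentiableAt (x := y - pt t x)).hasFDerivAt.comp x
    ((hasFDerivAt_pt_right t x).const_sub y)
  have h2 := h.fderiv
  rw [SchwartzMap.lineDerivOp_apply_eq_fderiv, ← map_neg]
  simp only [Function.comp_def] at h2
  rw [h2]
  rfl

lemma laplacian_sub_pt (G : 𝓢(SpaceTime d, ℂ)) (y : SpaceTime d) (t : ℝ) (x : Space d) :
    (Δ fun x : Space d => G (y - pt t x)) x =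
      ∑ i : Fin d, (∂_{spaceDir i} (∂_{spaceDir i} G : 𝓢(SpaceTime d, ℂ)) : 𝓢(SpaceTime d, ℂ)) (y - pt t x) := by
  have hs : ContDiff ℝ ∞ fun x : Space d => G (y - pt t x) := by
    have e : (fun x : Space d => G (y - pt t x)) = fun x => G (y - (spaceEmb d x + pt t 0)) :=
      funext fun x => by rw [pt_eq_spaceEmb_add t]
    rw [e]
    exact (G.smooth ⊤).comp (contDiff_const.sub ((spaceEmb d).contDiff.add contDiff_const))
  rw [InnerProductSpace.laplacian_eq_iteratedFDeriv_orthonormalBasis _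
    (EuclideanSpace.basisFun (Fin d) ℝ)]
  refine Finset.sum_congr rfl fun i _ => ?_
  rw [iteratedFDeriv_two_apply_same hs]
  simp_rw [fderiv_sub_pt]
  rw [fderiv_fun_neg, _root_.neg_apply, fderiv_sub_pt, neg_neg]

/-! ### The kernels -/

/-- The dilation which normalizes the angular frequencies `(2π τ, 2π ξ)` at scales `(a, c)`. -/
def freqDilation (a c : ℝ) (ha : 0 < a) (hc : 0 < c) : SpaceTime d ≃L[ℝ] SpaceTime d :=
  dilation (2 * π / a) (2 * π / c) (by positivity) (by positivity)

/-- The symbol localized to angular frequencies `|τ| ∼ a`, `|ξ| ∼ c`. -/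
def blockSymbol (X : ℝ → ℝ) (φ : Space d → ℝ) (a c : ℝ) (w : SpaceTime d) : ℂ :=
  unitSymbol X φ (pt (2 * π / a * w.fst) ((2 * π / c) • w.snd))

/-- The localized symbol of the inverse of the kinetic operator at velocity `|v|^(m-1) = eᵘ` for
`k = 0`, and minus its derivative in `u` for `k = 1`. -/
def kineticSymbol (X : ℝ → ℝ) (φ : Space d → ℝ) (a c : ℝ) (k : ℕ) (u : ℝ) (w : SpaceTime d) : ℂ :=
  a⁻¹ • (unitSymbol X φ (pt (2 * π / a * w.fst) ((2 * π / c) • w.snd)) *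
    resolventPow k (exp u * c ^ 2 / a) (pt (2 * π / a * w.fst) ((2 * π / c) • w.snd)))

section Kernels

variable {X : ℝ → ℝ} {φ : Space d → ℝ}

lemma isSymbolFamily_resolventPow (hX : IsTimeCutoff X) (hφ : IsSpaceCutoff φ) {r : ℝ} (hr : 0 < r)
    (k : ℕ) : IsSymbolFamily (fun u w => unitSymbol X φ w * resolventPow k (exp u * r) w) 3 := by
  have hs : ContDiff ℝ ∞ (fun q : ℝ × SpaceTime d => exp q.1 * r * ‖q.2.snd‖ ^ 2) :=
    ((Real.contDiff_exp.comp contDiff_fst).mul contDiff_const).mul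
      ((contDiff_snd_spaceTime.norm_sq ℝ).comp contDiff_snd)
  have := isSymbolFamily_div (f := fun q => q.2.fst) (g := fun q => exp q.1 * r * ‖q.2.snd‖ ^ 2)
      (b := fun q => (exp q.1 * r * ‖q.2.snd‖ ^ 2) ^ k) hX hφ
      (contDiff_fst_spaceTime.comp contDiff_snd) hs (hs.pow k) (k + 1) fun q => by
    by_cases hq : ‖q.2.snd‖ < 1 / 2
    · exact Or.inr (Or.inr (unitSymbol_eventually_zero_of_snd X hφ hq))
    · right; left
      have : 0 < ‖q.2.snd‖ := by linarith
      positivity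
  convert this using 3 with u w
  simp [resolventPow, mul_div_assoc]

lemma isSymbolFamily_kineticSymbol (hX : IsTimeCutoff X) (hφ : IsSpaceCutoff φ) {a c : ℝ}
    (ha : 0 < a) (hc : 0 < c) : ∃ R, ∀ k, IsSymbolFamily (kineticSymbol X φ a c k) R :=
  ⟨_, fun k => by
    have := ((isSymbolFamily_resolventPow hX hφ (r := c ^ 2 / a) (by positivity) k).comp_equiv
      (freqDilation a c ha hc)).const_smul a⁻¹
    simp_rw [← mul_div_assoc] at this
    exact this⟩

lemma isSymbolFamily_blockSymbol (hX : IsTimeCutoff X) (hφ : IsSpaceCutoff φ) {a c : ℝ}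
    (ha : 0 < a) (hc : 0 < c) : ∃ R, IsSymbolFamily (fun _ => blockSymbol X φ a c) R :=
  ⟨_, IsSymbolFamily.comp_equiv (Φ := fun _ => unitSymbol X φ) (R := 3)
    ⟨(contDiff_unitSymbol hX hφ).comp contDiff_snd, fun _ _ hw => norm_lt_of_cutoff hX hφ hw⟩
    (freqDilation a c ha hc)⟩

/-- In the logarithmic variable `u` the derivative of `(iτ + r|ξ|²)⁻¹` with `r ∼ eᵘ` is `-r|ξ|² (iτ
+ r|ξ|²)⁻²`, which has the same homogeneity. This is why the kernels with `k = 0` and `k = 1`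
satisfy the same bounds. -/
lemma hasDerivAt_kineticSymbol (hφ : IsSpaceCutoff φ) {a c : ℝ}
    (ha : 0 < a) (hc : 0 < c) (u : ℝ) (w : SpaceTime d) :
    HasDerivAt (fun u => kineticSymbol X φ a c 0 u w) (- kineticSymbol X φ a c 1 u w) u := by
  unfold kineticSymbol
  set w' : SpaceTime d := pt (2 * π / a * w.fst) ((2 * π / c) • w.snd)
  by_cases hw : ‖w'.snd‖ < 1 / 2
  · have := (unitSymbol_eventually_zero_of_snd X hφ hw).self_of_nhds
    simp only [this, zero_mul, smul_zero, neg_zero]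
    exact hasDerivAt_const _ _
  rw [← smul_neg, ← mul_neg]
  refine HasDerivAt.const_smul a⁻¹ (HasDerivAt.const_mul _ ?_)
  have hpos : 0 < ‖w'.snd‖ := by linarith
  have h1 : HasDerivAt (fun u => exp u * c ^ 2 / a * ‖w'.snd‖ ^ 2)
      (exp u * c ^ 2 / a * ‖w'.snd‖ ^ 2) u :=
    (((Real.hasDerivAt_exp u).mul_const _).div_const _).mul_const _
  have hne : ∀ u : ℝ, Complex.I * w'.fst + ((exp u * c ^ 2 / a * ‖w'.snd‖ ^ 2 : ℝ) : ℂ) ≠ 0 :=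
    fun u => I_mul_add_ne_zero (Or.inr (by positivity))
  have h2 := (h1.ofReal_comp.const_add (Complex.I * (w'.fst : ℂ))).inv (hne u)
  simp only [resolventPow, pow_zero, zero_add, pow_one, one_div]
  convert! h2 using 1
  rw [neg_div]

lemma symbol_equation (hφ : IsSpaceCutoff φ) {a c : ℝ} (ha : 0 < a) (hc : 0 < c) (u : ℝ)
    (w : SpaceTime d) :
    (2 * π * Complex.I * w.fst + exp u * (2 * π * ‖w.snd‖) ^ 2) * kineticSymbol X φ a c 0 u w =
      blockSymbol X φ a c w := by
  unfold kineticSymbol blockSymbol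
  set w' : SpaceTime d := pt (2 * π / a * w.fst) ((2 * π / c) • w.snd) with hw'
  by_cases hw : ‖w'.snd‖ < 1 / 2
  · simp [(unitSymbol_eventually_zero_of_snd X hφ hw).self_of_nhds]
  have hpos : 0 < ‖w'.snd‖ := by linarith
  have hne : Complex.I * w'.fst + ((exp u * c ^ 2 / a * ‖w'.snd‖ ^ 2 : ℝ) : ℂ) ≠ 0 :=
    I_mul_add_ne_zero (Or.inr (by positivity))
  have hn : ‖w'.snd‖ = 2 * π / c * ‖w.snd‖ := by
    change ‖(2 * π / c) • w.snd‖ = _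
    rw [norm_smul, Real.norm_eq_abs, abs_of_pos (by positivity)]
  have hf : w'.fst = 2 * π / a * w.fst := rfl
  have hac : (a : ℂ) ≠ 0 := by exact_mod_cast ha.ne'
  have hcc : (c : ℂ) ≠ 0 := by exact_mod_cast hc.ne'
  have e : (2 * π * Complex.I * w.fst + exp u * (2 * π * ‖w.snd‖) ^ 2 : ℂ) =
      a * (Complex.I * w'.fst + ((exp u * c ^ 2 / a * ‖w'.snd‖ ^ 2 : ℝ) : ℂ)) := by
    rw [hn, hf]
    push_cast
    field_simp
  rw [e, resolventPow, Complex.real_smul, pow_zero, zero_add, pow_one]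
  set D := Complex.I * (w'.fst : ℂ) + ((exp u * c ^ 2 / a * ‖w'.snd‖ ^ 2 : ℝ) : ℂ)
  push_cast
  field_simp

/-- The localized kernel at time frequency `a` and space frequency `c`. -/
def blockKernel (X : ℝ → ℝ) (φ : Space d → ℝ) (a c : ℝ) : SpaceTime d → ℂ :=
  𝓕⁻ (blockSymbol X φ a c)

/-- The localized fundamental solution of the kinetic operator (`k = 0`) and minus its derivative
in `u` (`k = 1`). -/
def kineticKernel (X : ℝ → ℝ) (φ : Space d → ℝ) (a c : ℝ) (k : ℕ) (u : ℝ) : SpaceTime d → ℂ :=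
  𝓕⁻ (kineticSymbol X φ a c k u)

lemma contDiff_kineticKernel (hX : IsTimeCutoff X) (hφ : IsSpaceCutoff φ) {a c : ℝ}
    (ha : 0 < a) (hc : 0 < c) (k : ℕ) :
    ContDiff ℝ ∞ (fun q : ℝ × SpaceTime d => kineticKernel X φ a c k q.1 q.2) := by
  obtain ⟨R, hR⟩ := isSymbolFamily_kineticSymbol hX hφ ha hc
  exact (hR k).contDiff_fourierInv

lemma hasDerivAt_kineticKernel (hX : IsTimeCutoff X) (hφ : IsSpaceCutoff φ) {a c : ℝ}
    (ha : 0 < a) (hc : 0 < c) (u : ℝ) (z : SpaceTime d) :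
    HasDerivAt (fun u => kineticKernel X φ a c 0 u z) (- kineticKernel X φ a c 1 u z) u := by
  obtain ⟨R, hR⟩ := isSymbolFamily_kineticSymbol hX hφ ha hc
  have h1 : IsSymbolFamily (fun u w => - kineticSymbol X φ a c 1 u w) R :=
    ⟨(hR 1).smooth.neg, fun u w hw => by rw [(hR 1).vanish u w hw, neg_zero]⟩
  have := (hR 0).hasDerivAt_fourierInv h1 (hasDerivAt_kineticSymbol hφ ha hc) u z
  have e : - kineticKernel X φ a c 1 u z = 𝓕⁻ (fun w => - kineticSymbol X φ a c 1 u w) z := by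
    change - (𝓕⁻ (kineticSymbol X φ a c 1 u) z) = _
    rw [Real.fourierInv_eq, Real.fourierInv_eq, ← integral_neg]
    simp only [smul_neg]
  rw [e]
  exact this

lemma kineticKernel_decay (hX : IsTimeCutoff X) (hφ : IsSpaceCutoff φ) {a c : ℝ}
    (ha : 0 < a) (hc : 0 < c) (k : ℕ) (u₀ u₁ : ℝ) (n j : ℕ) : ∃ C : ℝ, 0 ≤ C ∧
      ∀ u ∈ Set.Icc u₀ u₁, ∀ z, ‖iteratedFDeriv ℝ j (kineticKernel X φ a c k u) z‖ ≤
        C * (1 + ‖z‖) ^ (-(n : ℤ)) := by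
  obtain ⟨R, hR⟩ := isSymbolFamily_kineticSymbol hX hφ ha hc
  exact (hR k).exists_decay' u₀ u₁ n j

lemma blockKernel_decay (hX : IsTimeCutoff X) (hφ : IsSpaceCutoff φ) {a c : ℝ}
    (ha : 0 < a) (hc : 0 < c) (n : ℕ) : ∃ C : ℝ, 0 ≤ C ∧
      ∀ z, ‖blockKernel X φ a c z‖ ≤ C * (1 + ‖z‖) ^ (-(n : ℤ)) := by
  obtain ⟨R, hR⟩ := isSymbolFamily_blockSymbol hX hφ ha hc
  obtain ⟨C, h0, h⟩ := hR.exists_decay_zero 0 0 n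
  exact ⟨C, h0, fun z => h 0 (by simp) z⟩

lemma contDiff_blockKernel (hX : IsTimeCutoff X) (hφ : IsSpaceCutoff φ) {a c : ℝ}
    (ha : 0 < a) (hc : 0 < c) : ContDiff ℝ ∞ (blockKernel X φ a c) := by
  obtain ⟨R, hR⟩ := isSymbolFamily_blockSymbol hX hφ ha hc
  have e : blockKernel X φ a c =
      𝓕⁻ ((hR.hasCompactSupport 0).toSchwartzMap (hR.contDiff 0) : 𝓢(SpaceTime d, ℂ)) := by
    rw [SchwartzMap.fourierInv_coe]; rfl
  rw [e]
  exact SchwartzMap.smooth _ ⊤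

/-- Dilation invariance of the `L¹` norm reduces the claim to the normalized symbol at `r = eᵘ c² /
a`, with the prefactor `a⁻¹`; the bound is `a⁻¹ r^(-s)` written out. -/
lemma exists_lintegral_kineticKernel_le {s : ℝ} (hX : IsAdmissibleCutoff X s)
    (hφ : IsSpaceCutoff φ) (hs₀ : 0 ≤ s) (hs₁ : s ≤ 1) (k : ℕ) :
    ∃ C : ℝ≥0, ∀ a c : ℝ, 0 < a → 0 < c → ∀ u, ∫⁻ z, ‖kineticKernel X φ a c k u z‖ₑ ≤
      C * ENNReal.ofReal (a ^ (-(1 - s)) * c ^ (-(2 * s)) * exp (-(s * u))) := by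
  obtain ⟨C, hC⟩ := hX.exists_kernelNorm_le hs₀ hs₁ (isHomogeneousMultiplier_resolventPow hφ k)
  refine ⟨C, fun a c ha hc u => ?_⟩
  have h := hC (exp u * c ^ 2 / a) (by positivity)
  have e : ∫⁻ z, ‖kineticKernel X φ a c k u z‖ₑ =
      ENNReal.ofReal a⁻¹ * kernelNorm X φ (resolventPow k (exp u * c ^ 2 / a)) := by
    have e1 : ∀ z, ‖kineticKernel X φ a c k u z‖ₑ = ENNReal.ofReal a⁻¹ * ‖𝓕⁻ (fun w : SpaceTime d =>
        (fun w => unitSymbol X φ w * resolventPow k (exp u * c ^ 2 / a) w)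
          (freqDilation a c ha hc w)) z‖ₑ := fun z => enorm_fourierInv_smul (by positivity) _ z
    simp_rw [e1]
    rw [lintegral_const_mul' _ _ ENNReal.ofReal_ne_top]
    congr 1
    exact lintegral_fourierInv_dilation _ _ _ _
      (fun w => unitSymbol X φ w * resolventPow k (exp u * c ^ 2 / a) w)
  rw [e]
  calc _ ≤ ENNReal.ofReal a⁻¹ * (C * ENNReal.ofReal ((exp u * c ^ 2 / a) ^ (-s))) := by gcongr
    _ = C * ENNReal.ofReal (a⁻¹ * (exp u * c ^ 2 / a) ^ (-s)) := by
        rw [ENNReal.ofReal_mul (by positivity)]; ring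
    _ = _ := by
        congr 2
        rw [Real.div_rpow (by positivity) ha.le, Real.mul_rpow (by positivity) (by positivity),
          ← Real.exp_mul, ← Real.rpow_natCast c 2, ← Real.rpow_mul hc.le, Real.rpow_neg ha.le s,
          div_inv_eq_mul, ← Real.rpow_neg_one a]
        have : a ^ (-(1 - s)) = a ^ (-1 : ℝ) * a ^ s := by
          rw [← Real.rpow_add ha]; ring_nf
        rw [this]
        push_cast
        ring_nf

lemma exists_lintegral_blockKernel_le (hX : IsTimeCutoff X) (hφ : IsSpaceCutoff φ) :
    ∃ C : ℝ≥0, ∀ a c : ℝ, 0 < a → 0 < c → ∫⁻ z, ‖blockKernel X φ a c z‖ₑ ≤ C := by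
  have hfam : IsSymbolFamily (fun _ : ℝ => unitSymbol X φ) 3 :=
    ⟨(contDiff_unitSymbol hX hφ).comp contDiff_snd, fun _ _ hw => norm_lt_of_cutoff hX hφ hw⟩
  obtain ⟨C, hC⟩ := hfam.exists_lintegral_le 0 0
  refine ⟨C, fun a c ha hc => le_trans (le_of_eq ?_) (hC 0 (by simp))⟩
  exact lintegral_fourierInv_dilation (2 * π / a) (2 * π / c) (by positivity) (by positivity)
    (unitSymbol X φ)

/-- The kernels solve the (adjoint) kinetic equation. -/
lemma kineticKernel_equation (hX : IsTimeCutoff X) (hφ : IsSpaceCutoff φ) {a c : ℝ}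
    (ha : 0 < a) (hc : 0 < c) (u : ℝ) (y : SpaceTime d) (t : ℝ) (x : Space d) :
    - deriv (fun t => kineticKernel X φ a c 0 u (y - pt t x)) t -
      exp u * (Δ fun x : Space d => kineticKernel X φ a c 0 u (y - pt t x)) x =
      blockKernel X φ a c (y - pt t x) := by
  obtain ⟨R, hR⟩ := isSymbolFamily_kineticSymbol hX hφ ha hc
  obtain ⟨R', hR'⟩ := isSymbolFamily_blockSymbol hX hφ ha hc
  set S : 𝓢(SpaceTime d, ℂ) := ((hR 0).hasCompactSupport u).toSchwartzMap ((hR 0).contDiff u)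
  set B : 𝓢(SpaceTime d, ℂ) := (hR'.hasCompactSupport 0).toSchwartzMap (hR'.contDiff 0)
  have hS : ∀ z, kineticKernel X φ a c 0 u z = (𝓕⁻ S) z := fun z => by
    rw [SchwartzMap.fourierInv_coe]; rfl
  have hB : ∀ z, blockKernel X φ a c z = (𝓕⁻ B) z := fun z => by
    rw [SchwartzMap.fourierInv_coe]; rfl
  have htemp : ∀ m : SpaceTime d, (fun w : SpaceTime d => (inner ℝ w m : ℝ)).HasTemperateGrowth :=
    fun m => by fun_prop
  simp_rw [hS, hB]
  rw [deriv_sub_pt, laplacian_sub_pt, neg_neg]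
  -- The frequency side of the equation, with each factor written as multiplication by `2πi⟨w, e⟩`,
  -- the form in which `𝓕⁻` turns it into a directional derivative. The reflection `z ↦ y - z`
  -- changes the sign of `∂_t` and not of `Δ`, so the adjoint operator acts on the kernel as the
  -- forward one.
  have key : B = (2 * π * Complex.I) • SchwartzMap.smulLeftCLM ℂ (inner ℝ · (timeDir d)) S -
      (exp u : ℂ) • ∑ i : Fin d, (2 * π * Complex.I) • SchwartzMap.smulLeftCLM ℂ
        (inner ℝ · (spaceDir i)) ((2 * π * Complex.I) •
          SchwartzMap.smulLeftCLM ℂ (inner ℝ · (spaceDir i)) S) := by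
    ext w
    have h1 := symbol_equation (X := X) hφ ha hc u w
    have hn : (‖w.snd‖ : ℂ) ^ 2 = ∑ i : Fin d, ((w.snd i : ℝ) : ℂ) ^ 2 := by
      have := EuclideanSpace.real_norm_sq_eq w.snd
      exact_mod_cast this
    have ht : (inner ℝ w (timeDir d) : ℝ) = w.fst := by
      rw [WithLp.prod_inner_apply]; simp [timeDir]
    have hx : ∀ i : Fin d, (inner ℝ w (spaceDir i) : ℝ) = w.snd i := fun i => by
      rw [WithLp.prod_inner_apply]; simp [spaceDir, EuclideanSpace.inner_single_right]
    have hBw : B w = blockSymbol X φ a c w := rfl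
    have hSw : S w = kineticSymbol X φ a c 0 u w := rfl
    rw [hBw, ← h1, ← hSw]
    simp only [_root_.sub_apply, _root_.smul_apply, _root_.sum_apply,
      SchwartzMap.smulLeftCLM_apply_apply (htemp _), ht, hx]
    simp only [Complex.real_smul, smul_eq_mul]
    have e : ∀ i : Fin d, (2 * π * Complex.I * ((w.snd i : ℝ) * (2 * π * Complex.I *
        ((w.snd i : ℝ) * (S w : ℂ)))) : ℂ) = -(2 * π) ^ 2 * S w * ((w.snd i : ℝ) : ℂ) ^ 2 := fun i => by
      linear_combination ((2 * π) ^ 2 * S w * ((w.snd i : ℝ) : ℂ) ^ 2 : ℂ) * Complex.I_sq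
    simp_rw [e]
    rw [← Finset.mul_sum, ← hn]
    ring
  rw [key]
  have e2 : ∀ z : SpaceTime d, (𝓕⁻ ((2 * π * Complex.I) •
      SchwartzMap.smulLeftCLM ℂ (inner ℝ · (timeDir d)) S -
      (exp u : ℂ) • ∑ i : Fin d, (2 * π * Complex.I) • SchwartzMap.smulLeftCLM ℂ
        (inner ℝ · (spaceDir i)) ((2 * π * Complex.I) •
          SchwartzMap.smulLeftCLM ℂ (inner ℝ · (spaceDir i)) S)) : 𝓢(SpaceTime d, ℂ)) z =
      (∂_{timeDir d} (𝓕⁻ S)) z - exp u * ∑ i : Fin d, (∂_{spaceDir i} (∂_{spaceDir i} (𝓕⁻ S) : 𝓢(SpaceTime d, ℂ)) : 𝓢(SpaceTime d, ℂ)) z := by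
    intro z
    simp_rw [SchwartzMap.lineDerivOp_fourierInv_eq]
    rw [← fourierInvCLM_apply (R := ℂ), map_sub, map_smul (fourierInvCLM ℂ 𝓢(SpaceTime d, ℂ))
      (exp u : ℂ), map_sum]
    simp [_root_.sum_apply]
  rw [e2]

end Kernels

end KineticAveraging

namespace KineticAveraging

open Real FourierTransform Filter Topology

/-! ### Functions integrable against a polynomial weight, and their convolutions -/

section Tempered

/-- The polynomial weight `(1 + ‖y‖)⁻ᴺ`. -/
def polyWeight {V : Type*} [NormedAddCommGroup V] (N : ℕ) (y : V) : ℝ := (1 + ‖y‖) ^ (-(N : ℤ))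

lemma polyWeight_pos {V : Type*} [NormedAddCommGroup V] (N : ℕ) (y : V) : 0 < polyWeight N y :=
  zpow_pos (by positivity) _

lemma polyWeight_eq {V : Type*} [NormedAddCommGroup V] (N : ℕ) (y : V) :
    polyWeight N y = ((1 + ‖y‖) ^ N)⁻¹ := by rw [polyWeight, zpow_neg, zpow_natCast]

lemma continuous_polyWeight {V : Type*} [NormedAddCommGroup V] (N : ℕ) :
    Continuous (polyWeight N : V → ℝ) := by
  have : (polyWeight N : V → ℝ) = fun y => ((1 + ‖y‖) ^ N)⁻¹ := funext (polyWeight_eq N)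
  rw [this]
  exact (by fun_prop : Continuous fun y : V => (1 + ‖y‖) ^ N).inv₀ (fun y => by positivity)

/-- Peetre's inequality, from `1 + ‖y‖ ≤ (1 + ‖y + a‖)(1 + ‖a‖)`. -/
lemma polyWeight_add_le {V : Type*} [NormedAddCommGroup V] (N : ℕ) (y a : V) :
    polyWeight N (y + a) ≤ (1 + ‖a‖) ^ N * polyWeight N y := by
  rw [polyWeight_eq, polyWeight_eq, ← div_eq_mul_inv, le_div_iff₀ (by positivity),
    inv_mul_le_iff₀ (by positivity), ← mul_pow]
  have h : ‖y‖ ≤ ‖y + a‖ + ‖a‖ := by simpa using norm_sub_le (y + a) a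
  gcongr
  nlinarith [norm_nonneg a, norm_nonneg (y + a)]

lemma polyWeight_le_one {V : Type*} [NormedAddCommGroup V] (N : ℕ) (y : V) :
    polyWeight N y ≤ 1 := by
  rw [polyWeight_eq]
  exact inv_le_one_of_one_le₀ (one_le_pow₀ (by linarith [norm_nonneg y]))

variable {V : Type*} [NormedAddCommGroup V] [InnerProductSpace ℝ V]

lemma schwartz_le_polyWeight (N : ℕ) : ∃ C : ℝ, 0 ≤ C ∧ ∃ s : Finset (ℕ × ℕ), ∀ ζ : 𝓢(V, ℂ), ∀ y,
    ‖ζ y‖ ≤ C * (s.sup (schwartzSeminormFamily ℂ V ℂ) ζ) * polyWeight N y := by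
  refine ⟨2 ^ N, by positivity, Finset.Iic (N, 0), fun ζ y => ?_⟩
  have := SchwartzMap.one_add_le_sup_seminorm_apply (𝕜 := ℂ) (m := (N, 0)) (k := N) (n := 0)
    le_rfl le_rfl ζ y
  rw [norm_iteratedFDeriv_zero] at this
  rw [polyWeight_eq, ← div_eq_mul_inv, le_div_iff₀ (by positivity), mul_comm]
  exact this

lemma schwartz_le_polyWeight' (N : ℕ) (ζ : 𝓢(V, ℂ)) : ∃ C : ℝ, 0 ≤ C ∧ ∀ y,
    ‖ζ y‖ ≤ C * polyWeight N y := by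
  obtain ⟨C, hC, s, h⟩ := schwartz_le_polyWeight (V := V) N
  exact ⟨_, by positivity, h ζ⟩

variable [FiniteDimensional ℝ V] [MeasurableSpace V] [BorelSpace V]

/-- Integrability against a polynomial weight. -/
def IsTemperedFun (N : ℕ) (h : V → ℂ) : Prop := Integrable fun y => polyWeight N y • h y


lemma IsTemperedFun.aestronglyMeasurable {N : ℕ} {h : V → ℂ} (hh : IsTemperedFun N h) :
    AEStronglyMeasurable h volume := by
  have h1 : AEStronglyMeasurable (fun y : V => (polyWeight N y)⁻¹) volume :=
    ((continuous_polyWeight N).inv₀ fun y => (polyWeight_pos N y).ne').aestronglyMeasurable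
  refine (h1.smul (Integrable.aestronglyMeasurable hh)).congr (Eventually.of_forall fun y => ?_)
  change (polyWeight N y)⁻¹ • (polyWeight N y • h y) = h y
  rw [smul_smul, inv_mul_cancel₀ (polyWeight_pos N y).ne', one_smul]

lemma IsTemperedFun.integrable_mul {N : ℕ} {h : V → ℂ} (hh : IsTemperedFun N h) {g : V → ℂ}
    (hg : AEStronglyMeasurable g volume) {C : ℝ} (hC : ∀ y, ‖g y‖ ≤ C * polyWeight N y) :
    Integrable fun y => g y * h y := by
  refine (hh.norm.const_mul C).mono' (hg.mul hh.aestronglyMeasurable)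
    (Eventually.of_forall fun y => ?_)
  rw [norm_mul, norm_smul, Real.norm_of_nonneg (polyWeight_pos N y).le, ← mul_assoc]
  gcongr
  exact hC y

lemma IsTemperedFun.integrable_schwartz_mul {N : ℕ} {h : V → ℂ} (hh : IsTemperedFun N h)
    (ζ : 𝓢(V, ℂ)) : Integrable fun y => ζ y * h y := by
  obtain ⟨C, -, hC⟩ := schwartz_le_polyWeight' N ζ
  exact hh.integrable_mul ζ.continuous.aestronglyMeasurable hC

lemma IsTemperedFun.exists_distribution {N : ℕ} {h : V → ℂ} (hh : IsTemperedFun N h) :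
    ∃ u : 𝓢'(V, ℂ), ∀ ζ : 𝓢(V, ℂ), u ζ = ∫ y, ζ y * h y := by
  obtain ⟨C, hC0, s, hC⟩ := schwartz_le_polyWeight (V := V) N
  set L : 𝓢(V, ℂ) →L[ℂ] ℂ := SchwartzMap.mkCLMtoNormedSpace (𝕜 := ℂ) (𝕜' := ℂ)
    (σ := RingHom.id ℂ) (fun ζ : 𝓢(V, ℂ) => ∫ y, ζ y * h y)
    (fun f g => by
      simp only [_root_.add_apply, add_mul]
      exact integral_add (hh.integrable_schwartz_mul f) (hh.integrable_schwartz_mul g))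
    (fun c f => by
      simp only [_root_.smul_apply, smul_eq_mul, mul_assoc, RingHom.id_apply]
      exact integral_const_mul _ _)
    ⟨s, C * ∫ y, ‖polyWeight N y • h y‖, by positivity, fun f => by
      refine (norm_integral_le_integral_norm _).trans ?_
      have h2 : ∫ y, ‖f y * h y‖ ≤ ∫ y, C * (s.sup (schwartzSeminormFamily ℂ V ℂ) f) *
          ‖polyWeight N y • h y‖ := by
        refine integral_mono (hh.integrable_schwartz_mul f).norm (hh.norm.const_mul _) fun y => ?_
        simp only
        rw [norm_mul, norm_smul, Real.norm_of_nonneg (polyWeight_pos N y).le, ← mul_assoc]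
        gcongr
        exact hC f y
      refine h2.trans (le_of_eq ?_)
      rw [integral_const_mul]; ring⟩
  exact ⟨ContinuousLinearMap.toPointwiseConvergenceCLM _ _ _ _ L, fun ζ => rfl⟩

/-! ### Multipliers with integrable kernels -/

variable {E' : Type*} [MeasurableSpace E'] {ν : Measure E'} [SFinite ν]

/-- The convolution with the image under `ι` of the measure `κ ν`. -/
def kernelConv (ν : Measure E') (κ : E' → ℂ) (ι : E' → V) (h : V → ℂ) (z : V) : ℂ :=
  ∫ x, κ x * h (z - ι x) ∂ν

/-- A kernel all of whose moments are finite. -/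
structure IsMomentKernel (ν : Measure E') (κ : E' → ℂ) (ι : E' → V) : Prop where
  measurable : Measurable ι
  moments : ∀ N : ℕ, Integrable (fun x => (1 + ‖ι x‖) ^ N * ‖κ x‖) ν
  aesm : AEStronglyMeasurable κ ν

variable {κ : E' → ℂ} {ι : E' → V}

lemma measurePreserving_shear (hι : Measurable ι) :
    MeasurePreserving (fun q : E' × V => (q.1, q.2 - ι q.1)) (ν.prod volume) (ν.prod volume) :=
  (MeasurePreserving.id ν).skew_product (g := fun x y => y - ι x)
    (measurable_snd.sub (hι.comp measurable_fst))
    (Eventually.of_forall fun x => (measurePreserving_sub_right volume (ι x)).map_eq)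

/-- After the measure-preserving shear the weight `polyWeight N (y + ι x)` splits by Peetre's
inequality into an `N`-th moment of `κ` and the weight under which `h` is integrable. -/
lemma IsMomentKernel.integrable_prod (hκ : IsMomentKernel ν κ ι) {N : ℕ} {h : V → ℂ}
    (hh : IsTemperedFun N h) {g : V → ℂ} (hg : Continuous g) {C : ℝ}
    (hC : ∀ y, ‖g y‖ ≤ C * polyWeight N y) :
    Integrable (fun q : E' × V => g q.2 * (κ q.1 * h (q.2 - ι q.1))) (ν.prod volume) := by
  have h1 : Integrable (fun q : E' × V => g (q.2 + ι q.1) * (κ q.1 * h q.2)) (ν.prod volume) := by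
    have h2 := ((hκ.moments N).mul_prod hh.norm).const_mul C
    refine h2.mono' ?_ (Eventually.of_forall fun q => ?_)
    · refine AEStronglyMeasurable.mul ?_ (hκ.aesm.comp_fst.mul hh.aestronglyMeasurable.comp_snd)
      exact (hg.measurable.comp (measurable_snd.add
        (hκ.measurable.comp measurable_fst))).aestronglyMeasurable
    · rw [norm_mul, norm_mul, norm_smul, Real.norm_of_nonneg (polyWeight_pos N _).le]
      calc _ ≤ C * polyWeight N (q.2 + ι q.1) * (‖κ q.1‖ * ‖h q.2‖) := by gcongr; exact hC _
        _ ≤ C * ((1 + ‖ι q.1‖) ^ N * polyWeight N q.2) * (‖κ q.1‖ * ‖h q.2‖) := by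
            have hC0 : 0 ≤ C := by
              have := (norm_nonneg _).trans (hC 0)
              exact nonneg_of_mul_nonneg_left this (polyWeight_pos N 0)
            gcongr
            exact polyWeight_add_le N _ _
        _ = _ := by ring
  have h2 := (measurePreserving_shear (ν := ν) hκ.measurable).integrable_comp_of_integrable h1
  refine h2.congr (Eventually.of_forall fun q => ?_)
  simp

lemma IsMomentKernel.isTemperedFun_kernelConv (hκ : IsMomentKernel ν κ ι) {N : ℕ} {h : V → ℂ}
    (hh : IsTemperedFun N h) : IsTemperedFun N (kernelConv ν κ ι h) := by
  have h1 := hκ.integrable_prod hh (g := fun y => (polyWeight N y : ℂ)) (C := 1)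
    (Complex.continuous_ofReal.comp (continuous_polyWeight N)) (fun y => by
      rw [Complex.norm_real, Real.norm_of_nonneg (polyWeight_pos N y).le, one_mul])
  refine h1.swap.integral_prod_left.congr (Eventually.of_forall fun y => ?_)
  simp only [Function.comp_def, Prod.swap_prod_mk]
  rw [integral_const_mul, kernelConv, Complex.real_smul]

lemma IsMomentKernel.integral_mul_kernelConv (hκ : IsMomentKernel ν κ ι) {N : ℕ} {h : V → ℂ}
    (hh : IsTemperedFun N h) (ζ : 𝓢(V, ℂ)) :
    ∫ z, ζ z * kernelConv ν κ ι h z = ∫ y, (∫ x, κ x * ζ (y + ι x) ∂ν) * h y := by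
  obtain ⟨C, -, hC⟩ := schwartz_le_polyWeight' N ζ
  have h1 := hκ.integrable_prod hh (g := ζ) ζ.continuous hC
  have h3 : Integrable (fun q : E' × V => ζ (q.2 + ι q.1) * (κ q.1 * h q.2)) (ν.prod volume) := by
    have mp : MeasurePreserving (fun q : E' × V => (q.1, q.2 + ι q.1)) (ν.prod volume)
        (ν.prod volume) := by
      have := measurePreserving_shear (ν := ν) (V := V) (ι := fun x => - ι x) hκ.measurable.neg
      simpa using this
    have := mp.integrable_comp_of_integrable h1
    simpa [Function.comp_def] using this
  calc ∫ z, ζ z * kernelConv ν κ ι h z = ∫ z, ∫ x, ζ z * (κ x * h (z - ι x)) ∂ν := by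
        simp_rw [integral_const_mul, kernelConv]
    _ = ∫ x, (∫ z, ζ z * (κ x * h (z - ι x))) ∂ν := by
        rw [integral_integral_swap]
        exact h1.swap
    _ = ∫ x, (∫ y, ζ (y + ι x) * (κ x * h y)) ∂ν := by
        refine integral_congr_ae (Eventually.of_forall fun x => ?_)
        simp only
        rw [← integral_add_right_eq_self _ (ι x)]
        simp
    _ = ∫ y, ∫ x, ζ (y + ι x) * (κ x * h y) ∂ν := by
        rw [integral_integral_swap]
        exact h3
    _ = _ := by
        refine integral_congr_ae (Eventually.of_forall fun y => ?_)
        simp only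
        rw [← integral_mul_const]
        refine integral_congr_ae (Eventually.of_forall fun x => ?_)
        simp only; ring

/-- The transpose of the multiplier is an explicit integral operator on Schwartz functions.
Multipliers of tempered distributions are defined by duality, so this and `integral_mul_kernelConv`
identify them with convolutions. -/
lemma IsMomentKernel.fourier_smul_fourierInv (hκ : IsMomentKernel ν κ ι) {m : V → ℂ}
    (hm : ∀ w, m w = ∫ x, 𝐞 (-(inner ℝ (ι x) w)) • κ x ∂ν) (hmt : m.HasTemperateGrowth)
    (ζ : 𝓢(V, ℂ)) (y : V) :
    (𝓕 (SchwartzMap.smulLeftCLM ℂ m (𝓕⁻ ζ)) : 𝓢(V, ℂ)) y = ∫ x, κ x * ζ (y + ι x) ∂ν := by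
  set g : 𝓢(V, ℂ) := 𝓕⁻ ζ
  have hg : ∀ y, ζ y = ∫ w, 𝐞 (-(inner ℝ w y)) • g w := fun y => by
    have h1 : ζ = 𝓕 g := (FourierTransform.fourier_fourierInv_eq ζ).symm
    rw [← Real.fourier_eq, ← SchwartzMap.fourier_coe, ← h1]
  rw [SchwartzMap.fourier_coe, Real.fourier_eq]
  simp_rw [SchwartzMap.smulLeftCLM_apply_apply hmt, hg, hm]
  have hint : Integrable (fun q : E' × V => (𝐞 (-(inner ℝ q.2 (y + ι q.1))) : ℂ) *
      (κ q.1 * g q.2)) (ν.prod volume) := by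
    have hκi : Integrable κ ν := by
      have := hκ.moments 0
      simp only [pow_zero, one_mul] at this
      exact (integrable_norm_iff hκ.aesm).1 this
    refine (hκi.mul_prod g.integrable).bdd_mul (c := 1) ?_ (Eventually.of_forall fun q => (Circle.norm_coe _).le)
    have h1 : Measurable fun q : E' × V => (inner ℝ q.2 (y + ι q.1) : ℝ) :=
      measurable_snd.inner (measurable_const.add (hκ.measurable.comp measurable_fst))
    have hc : Continuous fun x : ℝ => (𝐞 x : ℂ) := by
      simp only [Real.fourierChar_apply]; fun_prop
    exact (hc.measurable.comp h1.neg).aestronglyMeasurable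
  calc _ = ∫ w, ∫ x, (𝐞 (-(inner ℝ w (y + ι x))) : ℂ) * (κ x * g w) ∂ν := by
        refine integral_congr_ae (Eventually.of_forall fun w => ?_)
        simp only [Circle.smul_def, smul_eq_mul]
        rw [← integral_mul_const, ← integral_const_mul]
        refine integral_congr_ae (Eventually.of_forall fun x => ?_)
        simp only
        rw [inner_add_right, neg_add, AddChar.map_add_eq_mul, Circle.coe_mul,
          real_inner_comm w (ι x)]
        ring
    _ = ∫ x, (∫ w : V, (𝐞 (-(inner ℝ w (y + ι x))) : ℂ) * (κ x * g w)) ∂ν := by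
        rw [integral_integral_swap]
        exact hint.swap
    _ = _ := by
        refine integral_congr_ae (Eventually.of_forall fun x => ?_)
        simp only [Circle.smul_def, smul_eq_mul]
        rw [← integral_const_mul]
        refine integral_congr_ae (Eventually.of_forall fun w => ?_)
        simp only; ring

end Tempered

variable {d : ℕ} {E' : Type*} [MeasurableSpace E'] {ν : Measure E'} [SFinite ν] {κ : E' → ℂ}
  {ι : E' → SpaceTime d}

lemma IsTemperedFun.exists_isRepresentedBy {N : ℕ} {h : SpaceTime d → ℂ}
    (hh : IsTemperedFun N h) : ∃ u, IsRepresentedBy u h := by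
  obtain ⟨u, hu⟩ := hh.exists_distribution
  exact ⟨u, hh.aestronglyMeasurable, fun ζ => ⟨hh.integrable_schwartz_mul ζ, hu ζ⟩⟩

/-- The general `ν` and `ι` cover both kinds of blocks: kernels on space-time (`ι = id`), and
kernels carried by the slice `t = 0` (`ι = spaceEmb d`), which belong to multipliers in `ξ` alone.
-/
lemma IsMomentKernel.isRepresentedBy (hκ : IsMomentKernel ν κ ι) {m : SpaceTime d → ℂ}
    (hm : ∀ w, m w = ∫ x, 𝐞 (-(inner ℝ (ι x) w)) • κ x ∂ν) (hmt : m.HasTemperateGrowth)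
    {N : ℕ} {h : SpaceTime d → ℂ} (hh : IsTemperedFun N h) {u : 𝓢'(SpaceTime d, ℂ)}
    (hu : IsRepresentedBy u h) :
    IsRepresentedBy (TemperedDistribution.fourierMultiplierCLM ℂ m u) (kernelConv ν κ ι h) := by
  have hF := hκ.isTemperedFun_kernelConv hh
  refine ⟨hF.aestronglyMeasurable, fun ζ => ⟨hF.integrable_schwartz_mul ζ, ?_⟩⟩
  rw [TemperedDistribution.fourierMultiplierCLM_apply_apply, (hu.2 _).2,
    hκ.integral_mul_kernelConv hh]
  simp_rw [hκ.fourier_smul_fourierInv hm hmt]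

end KineticAveraging

namespace KineticAveraging

open Real Filter Topology

/-! ### Young's inequality for convolution with an integrable kernel -/

section Young

variable {V : Type*} [NormedAddCommGroup V] [InnerProductSpace ℝ V] [FiniteDimensional ℝ V]
  [MeasurableSpace V] [BorelSpace V]

/-- Hölder's inequality with `a = a^(1/r') a^(1/r)`, where `r'` is the conjugate exponent of `r`;
this is Jensen's inequality for the measure `a μ`. -/
lemma lintegral_mul_rpow_le {α : Type*} [MeasurableSpace α] {μ : Measure α} {a b : α → ℝ≥0∞}
    (ha : AEMeasurable a μ) (hb : AEMeasurable b μ) {r : ℝ} (hr : 1 ≤ r) :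
    (∫⁻ x, a x * b x ∂μ) ^ r ≤ (∫⁻ x, a x ∂μ) ^ (r - 1) * ∫⁻ x, a x * b x ^ r ∂μ := by
  rcases hr.eq_or_lt with rfl | hr1
  · simp
  have hr0 : 0 < r := by linarith
  have hconj : (r / (r - 1)).HolderConjugate r := (Real.HolderConjugate.conjExponent hr1).symm
  have hq0 : 0 < r / (r - 1) := hconj.pos
  have h := ENNReal.lintegral_mul_le_Lp_mul_Lq μ hconj (ha.pow_const (1 / (r / (r - 1))))
    ((ha.pow_const (1 / r)).mul hb)
  have e1 : ∀ x, ((fun x => a x ^ (1 / (r / (r - 1)))) * ((fun x => a x ^ (1 / r)) * b)) x =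
      a x * b x := fun x => by
    simp only [Pi.mul_apply]
    rw [← mul_assoc, ← ENNReal.rpow_add_of_nonneg _ _ (by positivity) (by positivity)]
    have : 1 / (r / (r - 1)) + 1 / r = 1 := by
      have := hconj.inv_add_inv_eq_one
      simpa [one_div] using this
    rw [this, ENNReal.rpow_one]
  have e2 : ∀ x, (a x ^ (1 / (r / (r - 1)))) ^ (r / (r - 1)) = a x := fun x => by
    rw [← ENNReal.rpow_mul, one_div_mul_cancel hq0.ne', ENNReal.rpow_one]
  have e3 : ∀ x, ((fun x => a x ^ (1 / r)) * b) x ^ r = a x * b x ^ r := fun x => by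
    simp only [Pi.mul_apply]
    rw [ENNReal.mul_rpow_of_nonneg _ _ hr0.le, ← ENNReal.rpow_mul, one_div_mul_cancel hr0.ne',
      ENNReal.rpow_one]
  simp only [e1, e2, e3] at h
  calc _ ≤ ((∫⁻ x, a x ∂μ) ^ (1 / (r / (r - 1))) * (∫⁻ x, a x * b x ^ r ∂μ) ^ (1 / r)) ^ r := by
        gcongr
    _ = _ := by
        rw [ENNReal.mul_rpow_of_nonneg _ _ hr0.le, ← ENNReal.rpow_mul, ← ENNReal.rpow_mul,
          one_div_mul_cancel hr0.ne', ENNReal.rpow_one]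
        congr 2
        field_simp

lemma lintegral_conv_rpow_le {a b : V → ℝ≥0∞} (ha : AEMeasurable a volume)
    (hb : AEMeasurable b volume) {r : ℝ} (hr : 1 ≤ r) :
    ∫⁻ y, (∫⁻ x, a x * b (y - x)) ^ r ≤ (∫⁻ x, a x) ^ r * ∫⁻ y, b y ^ r := by
  have hbm : ∀ y, AEMeasurable (fun x => b (y - x)) volume := fun y =>
    hb.comp_quasiMeasurePreserving
      (Measure.measurePreserving_sub_left volume y).quasiMeasurePreserving
  have hprod : AEMeasurable (fun q : V × V => a q.2 * b (q.1 - q.2) ^ r)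
      (volume.prod volume) := by
    refine (ha.comp_quasiMeasurePreserving Measure.quasiMeasurePreserving_snd).mul ?_
    exact (hb.comp_quasiMeasurePreserving
      (quasiMeasurePreserving_sub volume volume)).pow_const r
  -- The kernel of infinite mass is treated apart because the right side may then be `∞ * 0 = 0`. In
  -- that case `b` vanishes almost everywhere, and so does the convolution.
  by_cases htop : ∫⁻ x, a x = ⊤
  · by_cases hb0 : ∫⁻ y, b y ^ r = 0
    · have h1 : ∀ᵐ y, b y = 0 := by
        have := (lintegral_eq_zero_iff' (hb.pow_const r)).1 hb0
        filter_upwards [this] with y hy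
        simpa [show 0 < r by linarith, show ¬ r < 0 by linarith] using hy
      have h2 : ∀ y, ∫⁻ x, a x * b (y - x) = 0 := fun y => by
        have h3 : ∀ᵐ x, b (y - x) = 0 :=
          (Measure.measurePreserving_sub_left volume y).quasiMeasurePreserving.ae h1
        rw [lintegral_congr_ae (g := fun _ => 0) (by filter_upwards [h3] with x hx; simp [hx])]
        simp
      simp [h2, show 0 < r by linarith]
    · rw [htop, ENNReal.top_rpow_of_pos (by linarith), ENNReal.top_mul hb0]
      exact le_top
  calc _ ≤ ∫⁻ y, (∫⁻ x, a x) ^ (r - 1) * ∫⁻ x, a x * b (y - x) ^ r :=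
        lintegral_mono fun y => lintegral_mul_rpow_le ha (hbm y) hr
    _ = (∫⁻ x, a x) ^ (r - 1) * ∫⁻ y, ∫⁻ x, a x * b (y - x) ^ r := by
        rw [lintegral_const_mul' _ _ (ENNReal.rpow_ne_top_of_nonneg (by linarith) htop)]
    _ = (∫⁻ x, a x) ^ (r - 1) * ∫⁻ x, ∫⁻ y, a x * b (y - x) ^ r := by
        rw [lintegral_lintegral_swap hprod]
    _ = (∫⁻ x, a x) ^ (r - 1) * ((∫⁻ x, a x) * ∫⁻ y, b y ^ r) := by
        congr 1
        rw [← lintegral_mul_const'' _ ha]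
        refine lintegral_congr fun x => ?_
        rw [← lintegral_sub_right_eq_self (fun y => b y ^ r) x]
        exact lintegral_const_mul'' _ ((hb.comp_quasiMeasurePreserving
          (measurePreserving_sub_right volume x).quasiMeasurePreserving).pow_const r)
    _ = _ := by
        rw [← mul_assoc]
        congr 1
        nth_rewrite 2 [← ENNReal.rpow_one (∫⁻ x, a x)]
        rw [← ENNReal.rpow_add_of_nonneg _ _ (by linarith) zero_le_one]
        ring_nf

/-- **Young's inequality** `‖κ * h‖_r ≤ ‖κ‖₁ ‖h‖_r`. -/
lemma eLpNorm_conv_le {κ h : V → ℂ} (hκ : AEStronglyMeasurable κ volume)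
    (hh : AEStronglyMeasurable h volume) {r : ℝ≥0∞} (hr : 1 ≤ r) :
    eLpNorm (fun y => ∫ x, κ x * h (y - x)) r volume ≤ (∫⁻ x, ‖κ x‖ₑ) * eLpNorm h r volume := by
  have hpt : ∀ y, ‖∫ x, κ x * h (y - x)‖ₑ ≤ ∫⁻ x, ‖κ x‖ₑ * ‖h (y - x)‖ₑ := fun y => by
    refine (enorm_integral_le_lintegral_enorm _).trans (le_of_eq ?_)
    simp_rw [enorm_mul]
  rcases eq_or_ne r ⊤ with rfl | hrt
  · rw [eLpNorm_exponent_top, eLpNorm_exponent_top]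
    refine eLpNormEssSup_le_of_ae_enorm_bound (Eventually.of_forall fun y => (hpt y).trans ?_)
    rw [← lintegral_mul_const'' _ hκ.enorm]
    refine lintegral_mono_ae ?_
    have h1 : ∀ᵐ x, ‖h (y - x)‖ₑ ≤ eLpNormEssSup h volume :=
      (Measure.measurePreserving_sub_left volume y).quasiMeasurePreserving.ae
        (enorm_ae_le_eLpNormEssSup h volume)
    filter_upwards [h1] with x hx
    gcongr
  · have hr1 : 1 ≤ r.toReal := by
      rw [← ENNReal.toReal_one]; exact ENNReal.toReal_mono hrt hr
    have hr0 : r ≠ 0 := (zero_lt_one.trans_le hr).ne'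
    rw [eLpNorm_eq_lintegral_rpow_enorm_toReal hr0 hrt, eLpNorm_eq_lintegral_rpow_enorm_toReal hr0 hrt]
    have h1 := lintegral_conv_rpow_le hκ.enorm hh.enorm hr1
    calc _ ≤ (∫⁻ y, (∫⁻ x, ‖κ x‖ₑ * ‖h (y - x)‖ₑ) ^ r.toReal) ^ (1 / r.toReal) := by
          gcongr with y; exact hpt y
      _ ≤ ((∫⁻ x, ‖κ x‖ₑ) ^ r.toReal * ∫⁻ y, ‖h y‖ₑ ^ r.toReal) ^ (1 / r.toReal) := by gcongr
      _ = _ := by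
          rw [ENNReal.mul_rpow_of_nonneg _ _ (by positivity), ← ENNReal.rpow_mul,
            mul_one_div_cancel (by linarith), ENNReal.rpow_one]

end Young

/-! ### Interpolation between weak `L^p` and `L^r` -/

section Interpolation

variable {α : Type*} [MeasurableSpace α] {μ : Measure α}

lemma lintegral_Ioc_rpow {e t₀ : ℝ} (he : -1 < e) (ht : 0 ≤ t₀) :
    ∫⁻ t in Set.Ioc 0 t₀, ENNReal.ofReal (t ^ e) = ENNReal.ofReal (t₀ ^ (e + 1) / (e + 1)) := by
  rw [← ofReal_integral_eq_lintegral_ofReal]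
  · rw [← intervalIntegral.integral_of_le ht, integral_rpow (Or.inl he),
      Real.zero_rpow (by linarith), sub_zero]
  · exact (intervalIntegrable_iff_integrableOn_Ioc_of_le ht).1
      (intervalIntegral.intervalIntegrable_rpow' he)
  · filter_upwards [ae_restrict_mem measurableSet_Ioc] with t ht
    exact Real.rpow_nonneg ht.1.le _

lemma lintegral_Ioi_rpow {e t₀ : ℝ} (he : e < -1) (ht : 0 < t₀) :
    ∫⁻ t in Set.Ioi t₀, ENNReal.ofReal (t ^ e) = ENNReal.ofReal (- t₀ ^ (e + 1) / (e + 1)) := by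
  rw [← ofReal_integral_eq_lintegral_ofReal]
  · rw [integral_Ioi_rpow_of_lt he ht]
  · exact integrableOn_Ioi_rpow_of_lt he ht
  · filter_upwards [ae_restrict_mem measurableSet_Ioi] with t ht'
    exact Real.rpow_nonneg (ht.trans ht').le _

/-- The part of `∫ f^q` where `f` is small, for `f` in weak `L^p` with `p < q`. -/
lemma lintegral_low_le {f : α → ℝ} (hf0 : ∀ x, 0 ≤ f x) (hf : AEMeasurable f μ) {p q W t₀ : ℝ}
    (hp : 0 < p) (hpq : p < q) (hW : 0 < W) (ht₀ : 0 < t₀)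
    (hweak : ∀ t, 0 < t → μ {x | t < f x} ≤ ENNReal.ofReal ((W / t) ^ p)) :
    ∫⁻ x in {x | f x ≤ t₀}, ENNReal.ofReal (f x ^ q) ∂μ ≤
      ENNReal.ofReal (q / (q - p) * (W ^ p * t₀ ^ (q - p))) := by
  have hq : 0 < q := hp.trans hpq
  rw [lintegral_rpow_eq_lintegral_meas_lt_mul _ (Eventually.of_forall hf0) hf.restrict hq]
  -- In the layer cake formula on `{f ≤ t₀}` the levels above `t₀` contribute nothing, and
  -- `t^(q-1-p)` is integrable at `0` because `p < q`.
  have h1 : ∀ t ∈ Set.Ioi (0 : ℝ), μ.restrict {x | f x ≤ t₀} {x | t < f x} *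
      ENNReal.ofReal (t ^ (q - 1)) ≤ (Set.Ioc 0 t₀).indicator
        (fun t => ENNReal.ofReal (W ^ p) * ENNReal.ofReal (t ^ (q - 1 - p))) t := by
    intro t ht
    have ht' : (0 : ℝ) < t := ht
    by_cases h : t ≤ t₀
    · rw [Set.indicator_of_mem (Set.mem_Ioc.2 ⟨ht', h⟩)]
      calc _ ≤ ENNReal.ofReal ((W / t) ^ p) * ENNReal.ofReal (t ^ (q - 1)) := by
            gcongr
            exact (Measure.restrict_apply_le _ _).trans (hweak t ht')
        _ = _ := by
            rw [← ENNReal.ofReal_mul (by positivity), ← ENNReal.ofReal_mul (by positivity),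
              Real.div_rpow hW.le ht'.le, Real.rpow_sub ht' (q - 1) p]
            congr 1; ring
    · have : μ.restrict {x | f x ≤ t₀} {x | t < f x} = 0 := by
        rw [Measure.restrict_apply₀' (nullMeasurableSet_le hf aemeasurable_const)]
        convert measure_empty (μ := μ)
        ext x
        simp only [Set.mem_inter_iff, Set.mem_ofPred_eq, Set.mem_empty_iff_false, iff_false]
        rintro ⟨h1, h2⟩; linarith
      rw [this, zero_mul]; exact zero_le
  calc _ ≤ ENNReal.ofReal q * ∫⁻ t in Set.Ioi 0, (Set.Ioc 0 t₀).indicator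
        (fun t => ENNReal.ofReal (W ^ p) * ENNReal.ofReal (t ^ (q - 1 - p))) t := by
        exact mul_le_mul_right (setLIntegral_mono' measurableSet_Ioi h1) _
    _ ≤ ENNReal.ofReal q * ∫⁻ t in Set.Ioc 0 t₀,
        ENNReal.ofReal (W ^ p) * ENNReal.ofReal (t ^ (q - 1 - p)) := by
        refine mul_le_mul_right ?_ _
        rw [← lintegral_indicator measurableSet_Ioc]
        exact setLIntegral_le_lintegral _ _
    _ = _ := by
        rw [lintegral_const_mul' _ _ ENNReal.ofReal_ne_top, lintegral_Ioc_rpow (by linarith) ht₀.le,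
          ← ENNReal.ofReal_mul (by positivity), ← ENNReal.ofReal_mul hq.le]
        congr 1
        rw [show q - 1 - p + 1 = q - p by ring]; ring

/-- The part of `∫ f^q` where `f` is large, for `f` in weak `L^p` with `q < p`. -/
lemma lintegral_high_le {f : α → ℝ} (hf0 : ∀ x, 0 ≤ f x) (hf : AEMeasurable f μ) {p q W t₀ : ℝ}
    (hq : 0 < q) (hpq : q < p) (hW : 0 < W) (ht₀ : 0 < t₀)
    (hweak : ∀ t, 0 < t → μ {x | t < f x} ≤ ENNReal.ofReal ((W / t) ^ p)) :
    ∫⁻ x in {x | t₀ < f x}, ENNReal.ofReal (f x ^ q) ∂μ ≤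
      ENNReal.ofReal (p / (p - q) * (W ^ p * t₀ ^ (q - p))) := by
  have hp : 0 < p := hq.trans hpq
  rw [lintegral_rpow_eq_lintegral_meas_lt_mul _ (Eventually.of_forall hf0) hf.restrict hq]
  -- Below the level `t₀` the measure is bounded by that of `{t₀ < f}`. Above it the weak bound is
  -- used at each level, and `t^(q-1-p)` is integrable at infinity because `q < p`.
  have hsplit : Set.Ioi (0 : ℝ) = Set.Ioc 0 t₀ ∪ Set.Ioi t₀ := (Set.Ioc_union_Ioi_eq_Ioi ht₀.le).symm
  have h1 : ∫⁻ t in Set.Ioc 0 t₀, μ.restrict {x | t₀ < f x} {x | t < f x} *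
      ENNReal.ofReal (t ^ (q - 1)) ≤ ENNReal.ofReal ((W / t₀) ^ p * (t₀ ^ q / q)) := by
    calc _ ≤ ∫⁻ t in Set.Ioc 0 t₀, ENNReal.ofReal ((W / t₀) ^ p) * ENNReal.ofReal (t ^ (q - 1)) := by
          refine lintegral_mono fun t => ?_
          dsimp only
          gcongr
          calc _ ≤ μ.restrict {x | t₀ < f x} Set.univ := measure_mono (Set.subset_univ _)
            _ ≤ _ := by rw [Measure.restrict_apply_univ]; exact hweak t₀ ht₀
      _ = _ := by
          rw [lintegral_const_mul' _ _ ENNReal.ofReal_ne_top, lintegral_Ioc_rpow (by linarith) ht₀.le,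
            ← ENNReal.ofReal_mul (by positivity), sub_add_cancel]
  have h2 : ∫⁻ t in Set.Ioi t₀, μ.restrict {x | t₀ < f x} {x | t < f x} *
      ENNReal.ofReal (t ^ (q - 1)) ≤ ENNReal.ofReal (W ^ p * (t₀ ^ (q - p) / (p - q))) := by
    calc _ ≤ ∫⁻ t in Set.Ioi t₀, ENNReal.ofReal (W ^ p) * ENNReal.ofReal (t ^ (q - 1 - p)) := by
          refine setLIntegral_mono' measurableSet_Ioi fun t ht => ?_
          have ht' : 0 < t := ht₀.trans ht
          calc _ ≤ ENNReal.ofReal ((W / t) ^ p) * ENNReal.ofReal (t ^ (q - 1)) := by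
                gcongr
                exact (Measure.restrict_apply_le _ _).trans (hweak t ht')
            _ = _ := by
                rw [← ENNReal.ofReal_mul (by positivity), ← ENNReal.ofReal_mul (by positivity),
                  Real.div_rpow hW.le ht'.le, Real.rpow_sub ht' (q - 1) p]
                congr 1; ring
      _ = _ := by
          rw [lintegral_const_mul' _ _ ENNReal.ofReal_ne_top, lintegral_Ioi_rpow (by linarith) ht₀,
            ← ENNReal.ofReal_mul (by positivity)]
          congr 2
          rw [show q - 1 - p + 1 = q - p by ring, ← neg_sub p q, div_neg, neg_div, neg_neg]
  rw [hsplit]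
  calc _ ≤ ENNReal.ofReal q * (ENNReal.ofReal ((W / t₀) ^ p * (t₀ ^ q / q)) +
        ENNReal.ofReal (W ^ p * (t₀ ^ (q - p) / (p - q)))) := by
        gcongr
        exact (lintegral_union_le _ _ _).trans (add_le_add h1 h2)
    _ = _ := by
        have hpq' : 0 < p - q := by linarith
        rw [← ENNReal.ofReal_add (by positivity) (by positivity), ← ENNReal.ofReal_mul hq.le]
        congr 1
        rw [Real.div_rpow hW.le ht₀.le, Real.rpow_sub ht₀]
        field_simp
        ring

/-- To be used on the half of the space where `f^q ≤ t₀^(q-r) f^r`: large values of `f` when `q <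
r`, small ones when `r < q`. -/
lemma lintegral_strong_le {f : α → ℝ} {q r t₀ B : ℝ} {S : Set α} (hS : NullMeasurableSet S μ)
    (ht₀ : 0 < t₀) (hf : ∀ x ∈ S, 0 ≤ f x ∧ f x ^ q ≤ t₀ ^ (q - r) * f x ^ r)
    (hstrong : ∫⁻ x, ENNReal.ofReal (f x ^ r) ∂μ ≤ ENNReal.ofReal (B ^ r)) :
    ∫⁻ x in S, ENNReal.ofReal (f x ^ q) ∂μ ≤ ENNReal.ofReal (t₀ ^ (q - r) * B ^ r) := by
  calc _ ≤ ∫⁻ x in S, ENNReal.ofReal (t₀ ^ (q - r)) * ENNReal.ofReal (f x ^ r) ∂μ := by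
        refine lintegral_mono_ae ?_
        filter_upwards [ae_restrict_mem₀ hS] with x hx
        rw [← ENNReal.ofReal_mul (by positivity)]
        exact ENNReal.ofReal_le_ofReal (hf x hx).2
    _ ≤ ENNReal.ofReal (t₀ ^ (q - r)) * ∫⁻ x, ENNReal.ofReal (f x ^ r) ∂μ := by
        rw [lintegral_const_mul' _ _ ENNReal.ofReal_ne_top]
        exact mul_le_mul_right (setLIntegral_le_lintegral _ _) _
    _ ≤ _ := by
        rw [ENNReal.ofReal_mul (by positivity)]
        gcongr

lemma lintegral_le_low_add_high (f : α → ℝ) (g : α → ℝ≥0∞) (t₀ : ℝ) :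
    ∫⁻ x, g x ∂μ ≤ ∫⁻ x in {x | f x ≤ t₀}, g x ∂μ + ∫⁻ x in {x | t₀ < f x}, g x ∂μ := by
  have h : (Set.univ : Set α) = {x | f x ≤ t₀} ∪ {x | t₀ < f x} := by
    ext x; simpa using le_or_gt (f x) t₀
  rw [← setLIntegral_univ, h]
  exact lintegral_union_le _ _ _

/-- The base `(B^r W^(-p))^(1/(r-p))` is the level `t₀` at which the weak bound `W^p t₀^(q-p)`
equals the strong bound `t₀^(q-r) B^r`. -/
lemma rpow_balance {W B p q r : ℝ} (hW : 0 < W) (hB : 0 < B) (hrp : r - p ≠ 0) :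
    W ^ p * ((B ^ r * W ^ (-p)) ^ (1 / (r - p))) ^ (q - p) =
        W ^ (p * (r - q) / (r - p)) * B ^ (r * (q - p) / (r - p)) ∧
      ((B ^ r * W ^ (-p)) ^ (1 / (r - p))) ^ (q - r) * B ^ r =
        W ^ (p * (r - q) / (r - p)) * B ^ (r * (q - p) / (r - p)) := by
  have e : ∀ x : ℝ, ((B ^ r * W ^ (-p)) ^ (1 / (r - p))) ^ x =
      B ^ (r * x / (r - p)) * W ^ (-p * x / (r - p)) := fun x => by
    rw [← Real.rpow_mul (by positivity), Real.mul_rpow (by positivity) (by positivity),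
      ← Real.rpow_mul hB.le, ← Real.rpow_mul hW.le]
    congr 2 <;> ring
  rw [e, e]
  constructor
  · rw [mul_left_comm, ← Real.rpow_add hW, mul_comm]
    congr 2; field_simp; ring
  · rw [mul_right_comm, ← Real.rpow_add hB, mul_comm]
    congr 2 <;> field_simp <;> ring

/-- Interpolation between weak `L^p` and `L^r`, in integral form, for `r < ∞`. -/
lemma lintegral_interpolation {f : α → ℝ} (hf0 : ∀ x, 0 ≤ f x) (hf : AEMeasurable f μ)
    {p q r W B : ℝ} (hp : 0 < p) (hr : 0 < r) (hq : (p < q ∧ q < r) ∨ (r < q ∧ q < p)) (hW : 0 < W)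
    (hB : 0 < B) (hweak : ∀ t, 0 < t → μ {x | t < f x} ≤ ENNReal.ofReal ((W / t) ^ p))
    (hstrong : ∫⁻ x, ENNReal.ofReal (f x ^ r) ∂μ ≤ ENNReal.ofReal (B ^ r)) :
    ∫⁻ x, ENNReal.ofReal (f x ^ q) ∂μ ≤ ENNReal.ofReal (((q + p) / |q - p| + 1) *
      (W ^ (p * (r - q) / (r - p)) * B ^ (r * (q - p) / (r - p)))) := by
  -- The balancing level of `rpow_balance`. In the final constant, `(q + p) / |q - p|` dominates
  -- both `q / (q - p)` and `p / (p - q)`, so one form serves either order of the exponents; the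
  -- summand `1` is the strong part.
  set t₀ := (B ^ r * W ^ (-p)) ^ (1 / (r - p)) with ht₀def
  have ht₀ : 0 < t₀ := by rw [ht₀def]; positivity
  have hrp : r - p ≠ 0 := by rcases hq with h | h <;> [skip; skip] <;> intro h0 <;> linarith
  obtain ⟨e1, e2⟩ := rpow_balance (q := q) hW hB hrp
  rw [← ht₀def] at e1 e2
  refine (lintegral_le_low_add_high f _ t₀).trans ?_
  rcases hq with ⟨h1, h2⟩ | ⟨h1, h2⟩
  · have low := lintegral_low_le hf0 hf hp h1 hW ht₀ hweak
    have high := lintegral_strong_le (q := q) (r := r) (S := {x | t₀ < f x}) (t₀ := t₀) (B := B)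
      (nullMeasurableSet_lt aemeasurable_const hf) ht₀ (fun x hx => ⟨hf0 x, by
        have hx' : t₀ < f x := hx
        have hpos : 0 < f x := ht₀.trans hx'
        have : f x ^ q = f x ^ (q - r) * f x ^ r := by rw [← Real.rpow_add hpos]; ring_nf
        rw [this]
        refine mul_le_mul_of_nonneg_right ?_ (by positivity)
        exact Real.rpow_le_rpow_of_nonpos ht₀ hx'.le (by linarith)⟩) hstrong
    refine (add_le_add low high).trans ?_
    have hqp : 0 < q - p := by linarith
    have hq0 : 0 < q := hp.trans h1
    rw [e1, e2, ← ENNReal.ofReal_add (by positivity) (by positivity), abs_of_pos hqp]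
    refine ENNReal.ofReal_le_ofReal ?_
    rw [add_mul, one_mul]
    gcongr
    linarith
  · have hq0 : 0 < q := hr.trans h1
    have high := lintegral_high_le hf0 hf hq0 h2 hW ht₀ hweak
    have low := lintegral_strong_le (q := q) (r := r) (S := {x | f x ≤ t₀}) (t₀ := t₀) (B := B)
      (nullMeasurableSet_le hf aemeasurable_const) ht₀ (fun x hx => ⟨hf0 x, by
        have hx' : f x ≤ t₀ := hx
        rcases (hf0 x).eq_or_lt with h0 | hpos
        · rw [← h0, Real.zero_rpow hq0.ne', Real.zero_rpow hr.ne', mul_zero]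
        have : f x ^ q = f x ^ (q - r) * f x ^ r := by rw [← Real.rpow_add hpos]; ring_nf
        rw [this]
        refine mul_le_mul_of_nonneg_right ?_ (by positivity)
        exact Real.rpow_le_rpow hpos.le hx' (by linarith)⟩) hstrong
    refine (add_le_add low high).trans ?_
    have hqp : 0 < p - q := by linarith
    rw [e1, e2, ← ENNReal.ofReal_add (by positivity) (by positivity), abs_of_neg (by linarith),
      neg_sub, add_comm]
    refine ENNReal.ofReal_le_ofReal ?_
    rw [add_mul, one_mul]
    gcongr
    linarith

/-- Interpolation between weak `L^p` and `L^∞`, in integral form. -/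
lemma lintegral_interpolation_top {f : α → ℝ} (hf0 : ∀ x, 0 ≤ f x) (hf : AEMeasurable f μ)
    {p q W B : ℝ} (hp : 0 < p) (hq : p < q) (hW : 0 < W)
    (hB : 0 < B) (hweak : ∀ t, 0 < t → μ {x | t < f x} ≤ ENNReal.ofReal ((W / t) ^ p))
    (hstrong : ∀ᵐ x ∂μ, f x ≤ B) :
    ∫⁻ x, ENNReal.ofReal (f x ^ q) ∂μ ≤ ENNReal.ofReal (((q + p) / |q - p| + 1) *
      (W ^ p * B ^ (q - p))) := by
  refine (lintegral_le_low_add_high f _ B).trans ?_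
  have h0 : μ {x | B < f x} = 0 := by
    rw [ae_iff] at hstrong
    simpa using hstrong
  rw [Measure.restrict_eq_zero.2 h0, lintegral_zero_measure, add_zero]
  refine (lintegral_low_le hf0 hf hp hq hW hB hweak).trans (ENNReal.ofReal_le_ofReal ?_)
  have hqp : 0 < q - p := by linarith
  rw [abs_of_pos hqp]
  gcongr
  have : (q + p) / (q - p) = q / (q - p) + p / (q - p) := by ring
  rw [this]
  have : 0 < p / (q - p) := by positivity
  linarith

end Interpolation

variable {d : ℕ}

lemma meas_le_of_weakLpNorm_le {p : ℝ} (hp : 0 < p) {F : SpaceTime d → ℂ} {W : ℝ}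
    (h : weakLpNorm p F ≤ ENNReal.ofReal W) {t : ℝ} (ht : 0 < t) :
    volume {y | t < ‖F y‖} ≤ ENNReal.ofReal ((W / t) ^ p) := by
  have h1 := (le_iSup (fun a : ℝ≥0 => (a : ℝ≥0∞) * volume {y | (a : ℝ≥0∞) < ‖F y‖ₑ} ^ (1 / p))
    t.toNNReal).trans h
  have e : {y | ((t.toNNReal : ℝ≥0) : ℝ≥0∞) < ‖F y‖ₑ} = {y | t < ‖F y‖} := by
    ext y
    simp only [Set.mem_ofPred_eq, enorm_eq_nnnorm, ENNReal.coe_lt_coe]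
    rw [← NNReal.coe_lt_coe, Real.coe_toNNReal _ ht.le, coe_nnnorm]
  rw [e] at h1
  have ht' : ((t.toNNReal : ℝ≥0) : ℝ≥0∞) = ENNReal.ofReal t := rfl
  rw [ht', mul_comm, ← ENNReal.le_div_iff_mul_le (Or.inl (by simpa using ht))
    (Or.inl ENNReal.ofReal_ne_top), ← ENNReal.ofReal_div_of_pos ht] at h1
  calc volume {y | t < ‖F y‖} = (volume {y | t < ‖F y‖} ^ (1 / p)) ^ p := by
        rw [← ENNReal.rpow_mul, one_div_mul_cancel hp.ne', ENNReal.rpow_one]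
    _ ≤ (ENNReal.ofReal (W / t)) ^ p := by gcongr
    _ ≤ _ := by
        rcases le_total 0 (W / t) with h2 | h2
        · rw [ENNReal.ofReal_rpow_of_nonneg h2 hp.le]
        · rw [ENNReal.ofReal_of_nonpos h2, ENNReal.zero_rpow_of_pos hp]; exact zero_le

/-- Interpolation between weak `L^p` and `L^r`. -/
lemma exists_eLpNorm_le_of_weakLpNorm {p : ℝ} {r q : ℝ≥0∞} {ϑ : ℝ}
    (h : InterpolationExponents p r q ϑ) (hp : 0 < p) : ∃ C : ℝ, 0 < C ∧
      ∀ F : SpaceTime d → ℂ, AEStronglyMeasurable F volume → ∀ W B : ℝ, 0 < W → 0 < B →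
        weakLpNorm p F ≤ ENNReal.ofReal W → eLpNorm F r volume ≤ ENNReal.ofReal B →
          eLpNorm F q volume ≤ ENNReal.ofReal (C * (W ^ ϑ * B ^ (1 - ϑ))) := by
  have hpt : ENNReal.ofReal p ≠ ⊤ := ENNReal.ofReal_ne_top
  have hqt : q ≠ ⊤ := (h.upper.trans_le le_top).ne
  have hq0 : q ≠ 0 := (zero_le.trans_lt h.lower).ne'
  set q' := q.toReal
  have hq'0 : 0 < q' := ENNReal.toReal_pos hq0 hqt
  have hqq : q = ENNReal.ofReal q' := (ENNReal.ofReal_toReal hqt).symm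
  have heq := h.eq
  rw [ENNReal.toReal_inv] at heq
  refine ⟨((q' + p) / |q' - p| + 1) ^ (1 / q'), by positivity, fun F hF W B hW hB hweak hstrong => ?_⟩
  have hfm : AEMeasurable (fun y => ‖F y‖) volume := hF.norm.aemeasurable
  have hw : ∀ t, 0 < t → volume {y | t < ‖F y‖} ≤ ENNReal.ofReal ((W / t) ^ p) :=
    fun t ht => meas_le_of_weakLpNorm_le hp hweak ht
  suffices hmain : ∫⁻ y, ENNReal.ofReal (‖F y‖ ^ q') ≤
      ENNReal.ofReal (((q' + p) / |q' - p| + 1) * (W ^ ϑ * B ^ (1 - ϑ)) ^ q') by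
    rw [eLpNorm_eq_lintegral_rpow_enorm_toReal hq0 hqt]
    have e : ∀ y, ‖F y‖ₑ ^ q' = ENNReal.ofReal (‖F y‖ ^ q') := fun y => by
      rw [← ENNReal.ofReal_rpow_of_nonneg (norm_nonneg _) hq'0.le, ofReal_norm]
    change (∫⁻ y, ‖F y‖ₑ ^ q') ^ (1 / q') ≤ _
    rw [lintegral_congr e]
    calc _ ≤ (ENNReal.ofReal (((q' + p) / |q' - p| + 1) * (W ^ ϑ * B ^ (1 - ϑ)) ^ q')) ^ (1 / q') := by
          gcongr
      _ = _ := by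
          rw [ENNReal.ofReal_rpow_of_nonneg (by positivity) (by positivity),
            Real.mul_rpow (by positivity) (by positivity), ← Real.rpow_mul (by positivity) q',
            mul_one_div_cancel hq'0.ne', Real.rpow_one]
  rw [Real.mul_rpow (by positivity) (by positivity), ← Real.rpow_mul hW.le, ← Real.rpow_mul hB.le]
  rcases eq_or_ne r ⊤ with rfl | hrt
  · simp only [ENNReal.inv_top, ENNReal.toReal_zero, mul_zero, zero_add] at heq
    have hpq : p < q' := by
      have h1 := h.lower
      rw [min_eq_left le_top] at h1
      exact (ENNReal.ofReal_lt_iff_lt_toReal hp.le hqt).1 h1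
    have h2 : ∀ᵐ y, ‖F y‖ ≤ B := by
      rw [eLpNorm_exponent_top] at hstrong
      filter_upwards [enorm_ae_le_eLpNormEssSup F volume] with y hy
      have := hy.trans hstrong
      rwa [← ofReal_norm, ENNReal.ofReal_le_ofReal_iff hB.le] at this
    have := lintegral_interpolation_top (fun y => norm_nonneg (F y)) hfm hp hpq hW hB hw h2
    have e1 : ϑ * q' = p := by
      have h3 : q'⁻¹ = ϑ / p := heq
      field_simp at h3; linarith
    have e2 : (1 - ϑ) * q' = q' - p := by rw [sub_mul, e1, one_mul]
    rwa [e1, e2]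
  · set r' := r.toReal
    have hr0 : r ≠ 0 := (zero_lt_one.trans_le h.one_le).ne'
    have hr'0 : 0 < r' := ENNReal.toReal_pos hr0 hrt
    have hrr : r = ENNReal.ofReal r' := (ENNReal.ofReal_toReal hrt).symm
    have hcase : (p < q' ∧ q' < r') ∨ (r' < q' ∧ q' < p) := by
      have h1 := h.lower
      have h2 := h.upper
      rw [hqq, hrr] at h1 h2
      rcases lt_or_ge p r' with hpr | hpr
      · left
        rw [min_eq_left (ENNReal.ofReal_le_ofReal hpr.le)] at h1
        rw [max_eq_right (ENNReal.ofReal_le_ofReal hpr.le)] at h2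
        exact ⟨(ENNReal.ofReal_lt_ofReal_iff hq'0).1 h1, (ENNReal.ofReal_lt_ofReal_iff hr'0).1 h2⟩
      · right
        rw [min_eq_right (ENNReal.ofReal_le_ofReal hpr)] at h1
        rw [max_eq_left (ENNReal.ofReal_le_ofReal hpr)] at h2
        exact ⟨(ENNReal.ofReal_lt_ofReal_iff hq'0).1 h1, (ENNReal.ofReal_lt_ofReal_iff hp).1 h2⟩
    have hrp : r' - p ≠ 0 := by
      rcases hcase with h | h <;> intro h0 <;> linarith [h.1, h.2]
    have hst : ∫⁻ y, ENNReal.ofReal (‖F y‖ ^ r') ≤ ENNReal.ofReal (B ^ r') := by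
      rw [eLpNorm_eq_lintegral_rpow_enorm_toReal hr0 hrt] at hstrong
      have e : ∀ y, ‖F y‖ₑ ^ r' = ENNReal.ofReal (‖F y‖ ^ r') := fun y => by
        rw [← ENNReal.ofReal_rpow_of_nonneg (norm_nonneg _) hr'0.le, ofReal_norm]
      change (∫⁻ y, ‖F y‖ₑ ^ r') ^ (1 / r') ≤ _ at hstrong
      rw [lintegral_congr e] at hstrong
      rw [← ENNReal.ofReal_rpow_of_nonneg hB.le hr'0.le]
      calc _ = ((∫⁻ y, ENNReal.ofReal (‖F y‖ ^ r')) ^ (1 / r')) ^ r' := by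
            rw [← ENNReal.rpow_mul, one_div_mul_cancel hr'0.ne', ENNReal.rpow_one]
        _ ≤ _ := by gcongr
    have := lintegral_interpolation (fun y => norm_nonneg (F y)) hfm hp hr'0 hcase hW hB hw hst
    rw [ENNReal.toReal_inv] at heq
    -- The relation `1/q = (1-ϑ)/r + ϑ/p` cleared of denominators. It identifies the exponents
    -- produced by the balancing level with `ϑ q` and `(1-ϑ) q`.
    have e0 : r' * p = (1 - ϑ) * q' * p + ϑ * q' * r' := by
      have h3 : q'⁻¹ = (1 - ϑ) * r'⁻¹ + ϑ / p := heq
      field_simp at h3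
      linarith
    have e1 : ϑ * q' = p * (r' - q') / (r' - p) := by
      rw [eq_div_iff hrp]; linarith
    have e2 : (1 - ϑ) * q' = r' * (q' - p) / (r' - p) := by
      rw [eq_div_iff hrp]; linarith
    rwa [e1, e2]

end KineticAveraging

namespace KineticAveraging

open Real FourierTransform Filter Topology

variable {d : ℕ}

lemma two_le_infty : (2 : WithTop ℕ∞) ≤ (∞ : WithTop ℕ∞) := by
  have h : ∀ n : ℕ, (n : WithTop ℕ∞) ≤ (∞ : WithTop ℕ∞) := fun n => mod_cast le_top
  exact_mod_cast h 2

/-! ### The adjoint kinetic operator -/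

lemma norm_timeDir : ‖timeDir d‖ = 1 := by
  rw [← sq_eq_sq₀ (norm_nonneg _) zero_le_one, WithLp.prod_norm_sq_eq_of_L2]
  simp [timeDir]

lemma norm_spaceDir (i : Fin d) : ‖spaceDir i‖ = 1 := by
  change ‖spaceEmb d (EuclideanSpace.basisFun (Fin d) ℝ i)‖ = 1
  rw [norm_spaceEmb_apply]
  exact (EuclideanSpace.basisFun (Fin d) ℝ).orthonormal.1 i

lemma deriv_pt {G : SpaceTime d → ℂ} (hG : ContDiff ℝ ∞ G) (t : ℝ) (x : Space d) :
    deriv (fun t => G (pt t x)) t = fderiv ℝ G (pt t x) (timeDir d) :=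
  (((hG.differentiable (by simp)) (pt t x)).hasFDerivAt.comp_hasDerivAt t
    (hasFDerivAt_pt_left t x)).deriv

lemma laplacian_pt {G : SpaceTime d → ℂ} (hG : ContDiff ℝ ∞ G) (t : ℝ) (x : Space d) :
    (Δ fun x : Space d => G (pt t x)) x =
      ∑ i, iteratedFDeriv ℝ 2 G (pt t x) ![spaceDir i, spaceDir i] := by
  rw [InnerProductSpace.laplacian_eq_iteratedFDeriv_orthonormalBasis _
    (EuclideanSpace.basisFun (Fin d) ℝ)]
  refine Finset.sum_congr rfl fun i _ => ?_
  have e : (fun x : Space d => G (pt t x)) = (fun w => G (w + pt t 0)) ∘ spaceEmb d := by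
    funext x; simp only [Function.comp_def]; rw [← pt_eq_spaceEmb_add]
  have hs : ContDiff ℝ ∞ (fun w => G (w + pt t 0)) := hG.comp (contDiff_id.add contDiff_const)
  rw [e, ContinuousLinearMap.iteratedFDeriv_comp_right _ hs _ (i := 2) two_le_infty,
    iteratedFDeriv_comp_add_right, ← pt_eq_spaceEmb_add,
    ContinuousMultilinearMap.compContinuousLinearMap_apply]
  congr 1
  funext j
  fin_cases j <;> rfl

/-- The formal adjoint `-∂_t - |v|^(m-1) Δ_x` of the kinetic operator. -/
def adjointOp (m : ℝ) (Ψ : Phase d → ℂ) (z : Phase d) : ℂ :=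
  - deriv (fun t => Ψ (pt t z.1.snd, z.2)) z.1.fst -
    ((|z.2| ^ (m - 1) : ℝ) : ℂ) * (Δ fun x : Space d => Ψ (pt z.1.fst x, z.2)) z.1.snd

lemma contDiff_slice {Ψ : Phase d → ℂ} (hΨ : ContDiff ℝ ∞ Ψ) (v : ℝ) :
    ContDiff ℝ ∞ (fun y => Ψ (y, v)) :=
  hΨ.comp (contDiff_id.prodMk contDiff_const)

lemma adjointOp_eq_slice (m : ℝ) {Ψ : Phase d → ℂ} (hΨ : ∀ v, ContDiff ℝ ∞ fun y => Ψ (y, v))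
    (z : Phase d) : adjointOp m Ψ z = - fderiv ℝ (fun y => Ψ (y, z.2)) z.1 (timeDir d) -
      ((|z.2| ^ (m - 1) : ℝ) : ℂ) *
        ∑ i, iteratedFDeriv ℝ 2 (fun y => Ψ (y, z.2)) z.1 ![spaceDir i, spaceDir i] := by
  have h1 := deriv_pt (hΨ z.2) z.1.fst z.1.snd
  have h2 := laplacian_pt (hΨ z.2) z.1.fst z.1.snd
  rw [adjointOp, h1, h2]
  rfl

lemma norm_adjointOp_le (m : ℝ) {Ψ : Phase d → ℂ} (hΨ : ∀ v, ContDiff ℝ ∞ fun y => Ψ (y, v))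
    {z : Phase d} {D : ℝ} (h1 : ‖iteratedFDeriv ℝ 1 (fun y => Ψ (y, z.2)) z.1‖ ≤ D)
    (h2 : ‖iteratedFDeriv ℝ 2 (fun y => Ψ (y, z.2)) z.1‖ ≤ D) :
    ‖adjointOp m Ψ z‖ ≤ (1 + |z.2| ^ (m - 1) * d) * D := by
  rw [adjointOp_eq_slice m hΨ, add_mul, one_mul]
  refine (norm_sub_le _ _).trans (add_le_add ?_ ?_)
  · rw [norm_neg]
    refine ((fderiv ℝ (fun y => Ψ (y, z.2)) z.1).le_opNorm _).trans ?_
    rw [norm_timeDir, mul_one]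
    have := norm_iteratedFDeriv_one (𝕜 := ℝ) (f := fun y => Ψ (y, z.2)) (x := z.1)
    rw [← this]
    exact h1
  · rw [norm_mul, Complex.norm_real, Real.norm_of_nonneg (by positivity), mul_assoc]
    gcongr
    refine (norm_sum_le _ _).trans ?_
    calc _ ≤ ∑ _i : Fin d, D := by
          refine Finset.sum_le_sum fun i _ => ?_
          refine (ContinuousMultilinearMap.le_opNorm _ _).trans ?_
          simp [Fin.prod_univ_two, norm_spaceDir, h2]
      _ = _ := by simp

lemma continuous_adjointOp {m : ℝ} (hm : 1 < m) {Ψ : Phase d → ℂ} (hΨ : ContDiff ℝ ∞ Ψ) :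
    Continuous (adjointOp m Ψ) := by
  have hsl : ∀ v : ℝ, (fun y => Ψ (y, v)) = (fun w => Ψ (w + (0, v))) ∘
      ContinuousLinearMap.inl ℝ (SpaceTime d) ℝ := fun v => by
    funext y; simp
  have hs : ∀ v : ℝ, ContDiff ℝ ∞ (fun w => Ψ (w + ((0 : SpaceTime d), v))) := fun v =>
    hΨ.comp (contDiff_id.add contDiff_const)
  have e : ∀ (n : ℕ) (z : Phase d), iteratedFDeriv ℝ n (fun y => Ψ (y, z.2)) z.1 =
      (iteratedFDeriv ℝ n Ψ z).compContinuousLinearMap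
        (fun _ => ContinuousLinearMap.inl ℝ (SpaceTime d) ℝ) := fun n z => by
    rw [hsl, ContinuousLinearMap.iteratedFDeriv_comp_right _ (hs z.2) _ (i := n) (mod_cast le_top),
      iteratedFDeriv_comp_add_right]
    simp
  have e1 : ∀ z : Phase d, fderiv ℝ (fun y => Ψ (y, z.2)) z.1 (timeDir d) =
      iteratedFDeriv ℝ 1 Ψ z (fun _ => (timeDir d, 0)) := fun z => by
    have := congrArg (fun L => L (fun _ => timeDir d)) (e 1 z)
    simpa [iteratedFDeriv_one_apply] using this
  have e2 : ∀ (z : Phase d) (i : Fin d), iteratedFDeriv ℝ 2 (fun y => Ψ (y, z.2)) z.1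
      ![spaceDir i, spaceDir i] = iteratedFDeriv ℝ 2 Ψ z (fun _ => (spaceDir i, 0)) :=
    fun z i => by
      rw [e 2 z, ContinuousMultilinearMap.compContinuousLinearMap_apply]
      congr 1; funext j; fin_cases j <;> rfl
  have : adjointOp m Ψ = fun z => - iteratedFDeriv ℝ 1 Ψ z (fun _ => (timeDir d, 0)) -
      ((|z.2| ^ (m - 1) : ℝ) : ℂ) * ∑ i, iteratedFDeriv ℝ 2 Ψ z (fun _ => (spaceDir i, 0)) := by
    funext z
    rw [adjointOp_eq_slice m (contDiff_slice hΨ), e1]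
    simp_rw [e2]
  rw [this]
  have hc : ∀ (n : ℕ) (w : Fin n → Phase d), Continuous fun z => iteratedFDeriv ℝ n Ψ z w :=
    fun n w => (ContinuousMultilinearMap.apply ℝ (fun _ : Fin n => Phase d) ℂ w).continuous.comp
      (hΨ.continuous_iteratedFDeriv (mod_cast le_top))
  have hv : Continuous fun z : Phase d => ((|z.2| ^ (m - 1) : ℝ) : ℂ) :=
    Complex.continuous_ofReal.comp
      ((continuous_snd.abs).rpow_const fun z => Or.inr (by linarith))
  exact (hc 1 _).neg.sub (hv.mul (continuous_finsetSum _ fun i _ => hc 2 _))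

lemma adjointOp_eq_zero (m : ℝ) {Ψ : Phase d → ℂ} (hΨ : ContDiff ℝ ∞ Ψ) {z : Phase d}
    (hz : z ∉ tsupport Ψ) : adjointOp m Ψ z = 0 := by
  have h0 : (fun y => Ψ (y, z.2)) =ᶠ[𝓝 z.1] fun _ => 0 := by
    have h1 := notMem_tsupport_iff_eventuallyEq.1 hz
    have h2 : Continuous fun y : SpaceTime d => (y, z.2) := by fun_prop
    exact (h2.continuousAt (x := z.1)).eventually h1
  rw [adjointOp_eq_slice m (contDiff_slice hΨ), h0.fderiv_eq, (h0.iteratedFDeriv ℝ 2).eq_of_nhds]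
  simp

/-- `∫ Ψ dg` for a complex-valued function. -/
def RadonMeasure.cintegral (g : RadonMeasure d) (Ψ : Phase d → ℂ) : ℂ :=
  ∫ z, Ψ z * g.phase z ∂g.variation

lemma RadonMeasure.integrable_mul_phase (g : RadonMeasure d) {Ψ : Phase d → ℂ}
    (hΨ : Integrable Ψ g.variation) : Integrable (fun z => Ψ z * g.phase z) g.variation :=
  (hΨ.norm).mono' (hΨ.aestronglyMeasurable.mul g.measurable_phase.aestronglyMeasurable)
    (Eventually.of_forall fun z => by rw [norm_mul, g.norm_phase, mul_one])

lemma RadonMeasure.cintegral_eq (g : RadonMeasure d) {Ψ : Phase d → ℂ}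
    (hΨ : Integrable Ψ g.variation) :
    g.cintegral Ψ = g.integral (fun z => (Ψ z).re) + Complex.I * g.integral (fun z => (Ψ z).im) := by
  rw [RadonMeasure.cintegral, RadonMeasure.integral, RadonMeasure.integral, ← integral_const_mul,
    ← integral_add]
  · refine integral_congr_ae (Eventually.of_forall fun z => ?_)
    simp only
    nth_rewrite 1 [← Complex.re_add_im (Ψ z)]
    ring
  · exact g.integrable_mul_phase hΨ.re.ofReal
  · exact (g.integrable_mul_phase hΨ.im.ofReal).const_mul _

/-- The adjoint operator has real coefficients, so it commutes with taking real and imaginary parts,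
and the identity for real test functions is applied to each part. -/
lemma IsKineticSolution.complex {m : ℝ} (hm : 1 < m) {f : Phase d → ℂ} {g₀ g₁ : RadonMeasure d}
    (h : IsKineticSolution m f g₀ g₁) (hf : LocallyIntegrable f volume) {Ψ : Phase d → ℂ}
    (hΨ : ContDiff ℝ ∞ Ψ) (hc : HasCompactSupport Ψ) :
    ∫ z, f z * adjointOp m Ψ z =
      g₀.cintegral Ψ - g₁.cintegral (fun z => deriv (fun v => Ψ (z.1, v)) z.2) := by
  have hfin₀ := g₀.finite_on_compacts
  have hfin₁ := g₁.finite_on_compacts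
  have hA : Continuous (adjointOp m Ψ) := continuous_adjointOp hm hΨ
  have hAc : HasCompactSupport (adjointOp m Ψ) :=
    HasCompactSupport.intro hc fun z hz => adjointOp_eq_zero m hΨ hz
  have key : ∀ (L : ℂ →L[ℝ] ℝ), ∫ z, f z * ((L (adjointOp m Ψ z) : ℝ) : ℂ) =
      g₀.integral (fun z => L (Ψ z)) -
        g₁.integral (fun z => L (deriv (fun v => Ψ (z.1, v)) z.2)) := by
    intro L
    have hL : ContDiff ℝ ∞ fun z => L (Ψ z) := L.contDiff.comp hΨ
    have h1 := h (fun z => L (Ψ z)) hL (hc.comp_left (map_zero L))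
    have e1 : ∀ z : Phase d, deriv (fun v => L (Ψ (z.1, v))) z.2 =
        L (deriv (fun v => Ψ (z.1, v)) z.2) := fun z => by
      have hd : DifferentiableAt ℝ (fun v => Ψ (z.1, v)) z.2 :=
        ((hΨ.comp (contDiff_const.prodMk contDiff_id)).differentiable (by simp)) z.2
      exact (L.hasFDerivAt.comp_hasDerivAt z.2 hd.hasDerivAt).deriv
    simp_rw [e1] at h1
    rw [← h1]
    refine integral_congr_ae (Eventually.of_forall fun z => ?_)
    simp only
    congr 2
    rw [adjointOp, map_sub, map_neg]
    have hsl := contDiff_slice hΨ z.2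
    have hd : DifferentiableAt ℝ (fun t => Ψ (pt t z.1.snd, z.2)) z.1.fst :=
      ((hsl.differentiable (by simp)) _).comp z.1.fst
        (hasFDerivAt_pt_left z.1.fst z.1.snd).differentiableAt
    have e2 : deriv (fun t => L (Ψ (pt t z.1.snd, z.2))) z.1.fst =
        L (deriv (fun t => Ψ (pt t z.1.snd, z.2)) z.1.fst) :=
      (L.hasFDerivAt.comp_hasDerivAt z.1.fst hd.hasDerivAt).deriv
    have hx : ContDiff ℝ ∞ (fun x : Space d => Ψ (pt z.1.fst x, z.2)) := by
      have e : (fun x : Space d => Ψ (pt z.1.fst x, z.2)) =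
          fun x => Ψ (spaceEmb d x + pt z.1.fst 0, z.2) :=
        funext fun x => by rw [pt_eq_spaceEmb_add z.1.fst]
      rw [e]
      exact hsl.comp ((spaceEmb d).contDiff.add contDiff_const)
    have e3 : (Δ fun x : Space d => L (Ψ (pt z.1.fst x, z.2))) z.1.snd =
        L ((Δ fun x : Space d => Ψ (pt z.1.fst x, z.2)) z.1.snd) :=
      ContDiffAt.laplacian_CLM_comp_left (l := L) (hx.contDiffAt.of_le two_le_infty)
    rw [e2, e3, ← Complex.real_smul, map_smul, smul_eq_mul]
  have hint : ∀ L : ℂ →L[ℝ] ℝ, Integrable fun z => f z * ((L (adjointOp m Ψ z) : ℝ) : ℂ) := by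
    intro L
    have h1 : Continuous fun z => ((L (adjointOp m Ψ z) : ℝ) : ℂ) :=
      Complex.continuous_ofReal.comp (L.continuous.comp hA)
    have h2 : HasCompactSupport fun z => ((L (adjointOp m Ψ z) : ℝ) : ℂ) :=
      (hAc.comp_left (map_zero L)).comp_left Complex.ofReal_zero
    have := hf.integrable_smul_right_of_hasCompactSupport h1 h2
    simpa [mul_comm] using this
  have i0 : Integrable Ψ g₀.variation := hΨ.continuous.integrable_of_hasCompactSupport hc
  have i1 : Integrable (fun z : Phase d => deriv (fun v => Ψ (z.1, v)) z.2) g₁.variation := by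
    have e : (fun z : Phase d => deriv (fun v => Ψ (z.1, v)) z.2) =
        fun z => fderiv ℝ Ψ z (0, 1) := by
      funext z
      have h1 : HasDerivAt (fun v : ℝ => (z.1, v)) (0, 1) z.2 :=
        (hasDerivAt_const z.2 z.1).prodMk (hasDerivAt_id z.2)
      exact (((hΨ.differentiable (by simp)) z).hasFDerivAt.comp_hasDerivAt z.2 h1).deriv
    rw [e]
    exact ((hΨ.continuous_fderiv (by simp)).clm_apply continuous_const).integrable_of_hasCompactSupport
      (hc.fderiv_apply ℝ (0, 1))
  have hr : Integrable fun z => f z * ((adjointOp m Ψ z).re : ℂ) := hint Complex.reCLM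
  have hi : Integrable fun z => f z * ((adjointOp m Ψ z).im : ℂ) := hint Complex.imCLM
  have r := key Complex.reCLM
  have i := key Complex.imCLM
  simp only [Complex.reCLM_apply, Complex.imCLM_apply] at r i
  rw [g₀.cintegral_eq i0, g₁.cintegral_eq i1]
  calc _ = ∫ z, (f z * ((adjointOp m Ψ z).re : ℂ) + Complex.I * (f z * ((adjointOp m Ψ z).im : ℂ))) := by
        refine integral_congr_ae (Eventually.of_forall fun z => ?_)
        simp only
        nth_rewrite 1 [← Complex.re_add_im (adjointOp m Ψ z)]
        ring
    _ = _ := by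
        rw [integral_add hr (hi.const_mul _),
          integral_const_mul, r, i]
        ring

end KineticAveraging

namespace KineticAveraging

open Real FourierTransform Filter Topology

variable {d : ℕ}

/-! ### Testing the equation with rapidly decaying functions -/

/-- A smooth cutoff in space-time at scale `n + 1`. -/
def scaleCutoff (b : ContDiffBump (0 : SpaceTime d)) (n : ℕ) (y : SpaceTime d) : ℝ :=
  b (((n : ℝ) + 1)⁻¹ • y)

lemma contDiff_scaleCutoff (b : ContDiffBump (0 : SpaceTime d)) (n : ℕ) :
    ContDiff ℝ ∞ (scaleCutoff b n) :=
  b.contDiff.comp (contDiff_const_smul _)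

lemma scaleCutoff_le_one (b : ContDiffBump (0 : SpaceTime d)) (n : ℕ) (y : SpaceTime d) :
    ‖scaleCutoff b n y‖ ≤ 1 := by
  rw [scaleCutoff, Real.norm_of_nonneg b.nonneg]
  exact b.le_one

lemma scaleCutoff_eventually_one (b : ContDiffBump (0 : SpaceTime d)) (y : SpaceTime d) :
    ∀ᶠ n : ℕ in atTop, ∀ᶠ y' in 𝓝 y, scaleCutoff b n y' = 1 := by
  obtain ⟨n₀, hn₀⟩ := exists_nat_gt ((‖y‖ + 1) / b.rIn)
  filter_upwards [eventually_ge_atTop n₀] with n hn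
  filter_upwards [Metric.ball_mem_nhds y one_pos] with y' hy'
  refine b.one_of_mem_closedBall ?_
  have h0 : (n₀ : ℝ) ≤ n := by exact_mod_cast hn
  have h1 : ‖y'‖ ≤ ‖y‖ + 1 := by
    have := norm_le_norm_add_norm_sub y y'
    have h2 : ‖y - y'‖ < 1 := by rw [← dist_eq_norm, dist_comm]; exact hy'
    linarith
  have hp : (0 : ℝ) < n + 1 := by positivity
  rw [mem_closedBall_zero_iff, norm_smul, norm_inv, Real.norm_of_nonneg hp.le,
    inv_mul_le_iff₀ hp]
  rw [div_lt_iff₀ b.rIn_pos] at hn₀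
  nlinarith [b.rIn_pos]

lemma scaleCutoff_eq_zero (b : ContDiffBump (0 : SpaceTime d)) (n : ℕ) {y : SpaceTime d}
    (hy : ((n : ℝ) + 1) * b.rOut ≤ ‖y‖) : scaleCutoff b n y = 0 := by
  have hp : (0 : ℝ) < n + 1 := by positivity
  refine b.zero_of_le_dist ?_
  rw [dist_zero_right, norm_smul, norm_inv, Real.norm_of_nonneg hp.le, le_inv_mul_iff₀ hp]
  exact hy

lemma exists_norm_iteratedFDeriv_scaleCutoff_le (b : ContDiffBump (0 : SpaceTime d)) (j : ℕ) :
    ∃ B : ℝ, 0 ≤ B ∧ ∀ n y, ‖iteratedFDeriv ℝ j (scaleCutoff b n) y‖ ≤ B := by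
  have hb : ContDiff ℝ ∞ (b : SpaceTime d → ℝ) := b.contDiff
  have hc : HasCompactSupport (iteratedFDeriv ℝ j (b : SpaceTime d → ℝ)) :=
    b.hasCompactSupport.iteratedFDeriv j
  obtain ⟨B, hB⟩ := (hb.continuous_iteratedFDeriv (m := j)
    (mod_cast le_top)).bounded_above_of_compact_support hc
  refine ⟨B, (norm_nonneg _).trans (hB 0), fun n y => ?_⟩
  have hp : (0 : ℝ) < n + 1 := by positivity
  set A : SpaceTime d →L[ℝ] SpaceTime d := ((n : ℝ) + 1)⁻¹ • ContinuousLinearMap.id ℝ _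
  have hA : ‖A‖ ≤ 1 := by
    rw [norm_smul, norm_inv, Real.norm_of_nonneg hp.le]
    refine mul_le_one₀ (inv_le_one_of_one_le₀ (by simp)) (norm_nonneg _)
      ContinuousLinearMap.norm_id_le
  have e : scaleCutoff b n = (b : SpaceTime d → ℝ) ∘ A := rfl
  rw [e, ContinuousLinearMap.iteratedFDeriv_comp_right _ hb _ (i := j) (mod_cast le_top)]
  refine (ContinuousMultilinearMap.norm_compContinuousLinearMap_le _ _).trans ?_
  refine (mul_le_of_le_one_right (norm_nonneg _) ?_).trans (hB _)
  exact Finset.prod_le_one (fun _ _ => norm_nonneg _) fun _ _ => hA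

/-- A smooth function on phase space, supported in `δ ≤ |v| ≤ R` and decaying in space-time. -/
structure IsDecayingTest (Ψ : Phase d → ℂ) (δ R : ℝ) (N : ℕ) : Prop where
  smooth : ContDiff ℝ ∞ Ψ
  vanish : ∀ z : Phase d, (|z.2| < δ ∨ R < |z.2|) → Ψ z = 0
  decay : ∃ C : ℝ, 0 ≤ C ∧ ∀ j ≤ 2, ∀ z : Phase d,
    ‖iteratedFDeriv ℝ j (fun y => Ψ (y, z.2)) z.1‖ ≤ C * polyWeight N z.1
  bounded_deriv : ∃ C : ℝ, 0 ≤ C ∧ ∀ z : Phase d, ‖deriv (fun v => Ψ (z.1, v)) z.2‖ ≤ C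

lemma IsDecayingTest.deriv_eq_zero {Ψ : Phase d → ℂ} {δ R : ℝ} {N : ℕ}
    (h : IsDecayingTest Ψ δ R N) {z : Phase d} (hz : |z.2| < δ ∨ R < |z.2|) :
    deriv (fun v => Ψ (z.1, v)) z.2 = 0 := by
  have : (fun v => Ψ (z.1, v)) =ᶠ[𝓝 z.2] fun _ => 0 := by
    have ho : ∀ᶠ v in 𝓝 z.2, |v| < δ ∨ R < |v| := by
      rcases hz with hz | hz
      · filter_upwards [continuous_abs.continuousAt.eventually_lt continuousAt_const hz] with v hv
        exact Or.inl hv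
      · filter_upwards [continuousAt_const.eventually_lt continuous_abs.continuousAt hz] with v hv
        exact Or.inr hv
    filter_upwards [ho] with v hv using h.vanish (z.1, v) hv
  rw [this.deriv_eq, deriv_const]

/-- The shell is unbounded in space-time, so local finiteness does not suffice. On it the weight
`|v|^a` is bounded below by its value at one of the two ends, according to the sign of `a`, and
Markov's inequality applies. -/
lemma RadonMeasure.variation_lt_top (g : RadonMeasure d) {a δ : ℝ} (R : ℝ) (hδ : 0 < δ)
    (h : g.weightedTV a < ⊤) : g.variation {z | δ ≤ |z.2| ∧ |z.2| ≤ R} < ⊤ := by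
  by_cases hR : R < δ
  · have : {z : Phase d | δ ≤ |z.2| ∧ |z.2| ≤ R} = ∅ := by
      ext z; simp only [Set.mem_ofPred_eq, Set.mem_empty_iff_false, iff_false]; intro hz; linarith [hz.1, hz.2]
    simp [this]
  push Not at hR
  have hR0 : 0 < R := hδ.trans_le hR
  set c : ℝ := min (δ ^ a) (R ^ a)
  have hc : 0 < c := lt_min (rpow_pos_of_pos hδ _) (rpow_pos_of_pos hR0 _)
  have key : ∀ x : ℝ, δ ≤ x → x ≤ R → c ≤ x ^ a := fun x h1 h2 => by
    rcases le_total 0 a with ha | ha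
    · exact (min_le_left _ _).trans (rpow_le_rpow hδ.le h1 ha)
    · exact (min_le_right _ _).trans (rpow_le_rpow_of_nonpos (hδ.trans_le h1) h2 ha)
  have hsub : {z : Phase d | δ ≤ |z.2| ∧ |z.2| ≤ R} ⊆ {z | ENNReal.ofReal c ≤ ‖z.2‖ₑ ^ a} := by
    rintro z ⟨h1, h2⟩
    have hv : 0 < |z.2| := hδ.trans_le h1
    rw [Set.mem_ofPred_eq, ← ofReal_norm, Real.norm_eq_abs,
      ENNReal.ofReal_rpow_of_pos hv]
    exact ENNReal.ofReal_le_ofReal (key _ h1 h2)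
  have hm : Measurable fun z : Phase d => ‖z.2‖ₑ ^ a := measurable_snd.enorm.pow_const a
  have hc' : ENNReal.ofReal c ≠ 0 := by simpa using hc
  refine (measure_mono hsub).trans_lt ?_
  refine (meas_ge_le_lintegral_div hm.aemeasurable hc' ENNReal.ofReal_ne_top).trans_lt ?_
  exact ENNReal.div_lt_top h.ne hc'

lemma measurableSet_velocityShell (δ R : ℝ) :
    MeasurableSet {z : Phase d | δ ≤ |z.2| ∧ |z.2| ≤ R} :=
  (measurableSet_le measurable_const measurable_snd.abs).inter
    (measurableSet_le measurable_snd.abs measurable_const)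

/-- Convergence of `∫ Ψₙ dg` for uniformly bounded functions supported in `δ ≤ |v| ≤ R`. -/
lemma RadonMeasure.tendsto_cintegral (g : RadonMeasure d) {a δ R C : ℝ} (hδ : 0 < δ)
    (h : g.weightedTV a < ⊤) {Ψ : ℕ → Phase d → ℂ} {Ψ' : Phase d → ℂ}
    (hm : ∀ n, Continuous (Ψ n)) (hC : ∀ n z, ‖Ψ n z‖ ≤ C)
    (h0 : ∀ n z, (|z.2| < δ ∨ R < |z.2|) → Ψ n z = 0)
    (hlim : ∀ z, Tendsto (fun n => Ψ n z) atTop (𝓝 (Ψ' z))) :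
    Tendsto (fun n => g.cintegral (Ψ n)) atTop (𝓝 (g.cintegral Ψ')) := by
  have hfin := g.variation_lt_top R hδ h
  refine tendsto_integral_of_dominated_convergence
    ({z : Phase d | δ ≤ |z.2| ∧ |z.2| ≤ R}.indicator fun _ => C)
    (fun n => ((hm n).measurable.mul g.measurable_phase).aestronglyMeasurable) ?_ ?_ ?_
  · exact (integrable_indicator_iff (measurableSet_velocityShell δ R)).2
      (integrableOn_const hfin.ne)
  · refine fun n => Eventually.of_forall fun z => ?_
    rw [norm_mul, g.norm_phase, mul_one]
    by_cases hz : δ ≤ |z.2| ∧ |z.2| ≤ R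
    · rw [Set.indicator_of_mem (by exact hz)]
      exact hC n z
    · rw [Set.indicator_of_notMem (by exact hz), h0 n z, norm_zero]
      by_contra hcon
      push Not at hcon
      exact hz hcon
  · exact Eventually.of_forall fun z => (hlim z).mul_const _

lemma continuous_deriv_velocity {Ψ : Phase d → ℂ} (hΨ : ContDiff ℝ ∞ Ψ) :
    Continuous fun z : Phase d => deriv (fun v => Ψ (z.1, v)) z.2 := by
  have e : (fun z : Phase d => deriv (fun v => Ψ (z.1, v)) z.2) =
      fun z => fderiv ℝ Ψ z (0, 1) := by
    funext z
    have h1 : HasDerivAt (fun v : ℝ => (z.1, v)) (0, 1) z.2 :=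
      (hasDerivAt_const z.2 z.1).prodMk (hasDerivAt_id z.2)
    exact (((hΨ.differentiable (by simp)) z).hasFDerivAt.comp_hasDerivAt z.2 h1).deriv
  rw [e]
  exact (hΨ.continuous_fderiv (by simp)).clm_apply continuous_const

/-- Kernels of frequency blocks are not compactly supported, so the test function is cut off in
space-time at scale `n + 1`. The right side passes to the limit because the measures have finite
mass on the velocity shell, the left side because the decay of the test function matches the weight
under which `|v|^(μ-1) f` is integrable. -/
theorem IsKineticSolution.decaying {m γ μ δ R : ℝ} {N : ℕ} (hm : 1 < m) (hμ : 1 ≤ μ) (hδ : 0 < δ)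
    {f : Phase d → ℂ} {g₀ g₁ : RadonMeasure d}
    (h : IsKineticSolution m f g₀ g₁) (hf : LocallyIntegrable f volume)
    (h₀ : g₀.weightedTV (1 - γ) < ⊤) (h₁ : g₁.weightedTV (-γ) < ⊤)
    (hav : Integrable fun z : Phase d =>
      f z * (((1 + ‖z.1‖) ^ (-(N : ℤ)) * |z.2| ^ (μ - 1) : ℝ) : ℂ))
    {Ψ : Phase d → ℂ} (hΨ : IsDecayingTest Ψ δ R N) :
    ∫ z, f z * adjointOp m Ψ z =
      g₀.cintegral Ψ - g₁.cintegral (fun z => deriv (fun v => Ψ (z.1, v)) z.2) := by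
  obtain ⟨b⟩ : Nonempty (ContDiffBump (0 : SpaceTime d)) := inferInstance
  set χ : ℕ → SpaceTime d → ℝ := scaleCutoff b
  set Ψn : ℕ → Phase d → ℂ := fun n z => χ n z.1 • Ψ z with hΨn
  have hsm : ∀ n, ContDiff ℝ ∞ (Ψn n) := fun n =>
    ((contDiff_scaleCutoff b n).comp contDiff_fst).smul hΨ.smooth
  have hcs : ∀ n, HasCompactSupport (Ψn n) := fun n => by
    refine HasCompactSupport.intro (K := Metric.closedBall 0 (((n : ℝ) + 1) * b.rOut) ×ˢ
      Metric.closedBall 0 R) ((isCompact_closedBall _ _).prod (isCompact_closedBall _ _)) ?_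
    intro z hz
    rw [Set.mem_prod, not_and_or, mem_closedBall_zero_iff, mem_closedBall_zero_iff, not_le,
      not_le] at hz
    rcases hz with hz | hz
    · simp only [hΨn, χ, scaleCutoff_eq_zero b n hz.le, zero_smul]
    · simp only [hΨn, hΨ.vanish z (Or.inr hz), smul_zero]
  have hdv : ∀ n (z : Phase d), deriv (fun v => Ψn n (z.1, v)) z.2 =
      χ n z.1 • deriv (fun v => Ψ (z.1, v)) z.2 := fun n z => by
    have hd : DifferentiableAt ℝ (fun v => Ψ (z.1, v)) z.2 :=
      ((hΨ.smooth.comp (contDiff_const.prodMk contDiff_id)).differentiable (by simp)) z.2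
    exact (hd.hasDerivAt.const_smul (χ n z.1)).deriv
  have hχlim : ∀ y, Tendsto (fun n => χ n y) atTop (𝓝 1) := fun y =>
    tendsto_const_nhds.congr' ((scaleCutoff_eventually_one b y).mono fun n hn =>
      hn.self_of_nhds.symm)
  obtain ⟨C, hC0, hC⟩ := hΨ.decay
  obtain ⟨C', hC'0, hC'⟩ := hΨ.bounded_deriv
  have hsmall : ∀ (n : ℕ) (y : SpaceTime d) (w : ℂ), ‖χ n y • w‖ ≤ ‖w‖ := fun n y w => by
    rw [norm_smul]
    exact mul_le_of_le_one_left (norm_nonneg _) (scaleCutoff_le_one b n y)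
  have lim₀ : Tendsto (fun n => g₀.cintegral (Ψn n)) atTop (𝓝 (g₀.cintegral Ψ)) := by
    refine g₀.tendsto_cintegral (C := C) (R := R) hδ h₀ (fun n => (hsm n).continuous)
      (fun n z => (hsmall n z.1 _).trans ?_) (fun n z hz => ?_) fun z => ?_
    · have := hC 0 (by norm_num) z
      rw [norm_iteratedFDeriv_zero] at this
      exact this.trans (mul_le_of_le_one_right hC0 (polyWeight_le_one _ _))
    · simp only [hΨn, hΨ.vanish z hz, smul_zero]
    · simpa [hΨn] using (hχlim z.1).smul_const (Ψ z)
  have lim₁ : Tendsto (fun n => g₁.cintegral (fun z => deriv (fun v => Ψn n (z.1, v)) z.2)) atTop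
      (𝓝 (g₁.cintegral (fun z => deriv (fun v => Ψ (z.1, v)) z.2))) := by
    refine g₁.tendsto_cintegral (C := C') (R := R) hδ h₁
      (fun n => continuous_deriv_velocity (hsm n))
      (fun n z => ?_) (fun n z hz => ?_) fun z => ?_
    · rw [hdv]; exact (hsmall n z.1 _).trans (hC' z)
    · rw [hdv, hΨ.deriv_eq_zero hz, smul_zero]
    · simp_rw [hdv]
      simpa using (hχlim z.1).smul_const (deriv (fun v => Ψ (z.1, v)) z.2)
  choose B hB0 hB using exists_norm_iteratedFDeriv_scaleCutoff_le b
  set B' := B 0 + B 1 + B 2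
  have hB' : ∀ j ≤ 2, B j ≤ B' := fun j hj => by
    interval_cases j <;> simp only [B'] <;> linarith [hB0 0, hB0 1, hB0 2]
  have hB'0 : 0 ≤ B' := (hB0 0).trans (hB' 0 (by norm_num))
  -- Leibniz' rule; the `4` is the sum `2^j` of the binomial coefficients for `j ≤ 2`.
  have hder : ∀ n, ∀ j ≤ 2, ∀ z : Phase d, ‖iteratedFDeriv ℝ j (fun y => Ψn n (y, z.2)) z.1‖ ≤
      4 * B' * C * polyWeight N z.1 := fun n j hj z => by
    have hsl := contDiff_slice hΨ.smooth z.2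
    have := ContinuousLinearMap.norm_iteratedFDeriv_le_of_bilinear_of_le_one
      (ContinuousLinearMap.lsmul ℝ ℝ : ℝ →L[ℝ] ℂ →L[ℝ] ℂ)
      (contDiff_scaleCutoff b n) hsl z.1 (n := j) (mod_cast le_top)
      ContinuousLinearMap.opNorm_lsmul_le
    refine this.trans ?_
    calc _ ≤ ∑ i ∈ Finset.range (j + 1), (j.choose i : ℝ) * (B' * (C * polyWeight N z.1)) := by
          refine Finset.sum_le_sum fun i hi => ?_
          rw [mul_assoc]
          have hi' : i ≤ j := Nat.lt_succ_iff.1 (Finset.mem_range.1 hi)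
          gcongr
          · exact (hB i n z.1).trans (hB' i (hi'.trans hj))
          · exact hC (j - i) ((Nat.sub_le _ _).trans hj) z
      _ = 2 ^ j * (B' * (C * polyWeight N z.1)) := by
          rw [← Finset.sum_mul]
          congr 1
          exact_mod_cast Nat.sum_range_choose j
      _ ≤ 4 * (B' * (C * polyWeight N z.1)) := by
          have := polyWeight_pos N z.1
          gcongr
          calc (2 : ℝ) ^ j ≤ 2 ^ 2 := pow_le_pow_right₀ (by norm_num) hj
            _ = 4 := by norm_num
      _ = _ := by ring
  have hadj0 : ∀ n (z : Phase d), (|z.2| < δ ∨ R < |z.2|) → adjointOp m (Ψn n) z = 0 :=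
    fun n z hz => by
      have : (fun y => Ψn n (y, z.2)) = fun _ => 0 := by
        funext y; simp only [hΨn, hΨ.vanish (y, z.2) hz, smul_zero]
      rw [adjointOp_eq_slice m (contDiff_slice (hsm n)), this]
      simp
  have hlim : Tendsto (fun n => ∫ z, f z * adjointOp m (Ψn n) z) atTop
      (𝓝 (∫ z, f z * adjointOp m Ψ z)) := by
    -- On the support, `|v| ≥ δ` and `μ ≥ 1` give `1 ≤ δ^(-(μ-1)) |v|^(μ-1)`, and this factor is
    -- inserted to reach the integrable function in `hav`. The factor `|v|^(m-1)` of the operator is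
    -- bounded by `|R|^(m-1)`.
    refine tendsto_integral_of_dominated_convergence
      (fun z => (1 + |R| ^ (m - 1) * d) * (4 * B' * C) * (δ ^ (μ - 1))⁻¹ *
        ‖f z * (((1 + ‖z.1‖) ^ (-(N : ℤ)) * |z.2| ^ (μ - 1) : ℝ) : ℂ)‖)
      (fun n => hf.aestronglyMeasurable.mul (continuous_adjointOp hm (hsm n)).aestronglyMeasurable)
      (hav.norm.const_mul _) (fun n => Eventually.of_forall fun z => ?_)
      (Eventually.of_forall fun z => ?_)
    · by_cases hz : |z.2| < δ ∨ R < |z.2|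
      · rw [hadj0 n z hz, mul_zero, norm_zero]
        positivity
      · push Not at hz
        have hv : 0 < |z.2| := hδ.trans_le hz.1
        have hw := polyWeight_pos N z.1
        have h1 := norm_adjointOp_le m (contDiff_slice (hsm n)) (z := z)
          (hder n 1 (by norm_num) z) (hder n 2 le_rfl z)
        rw [norm_mul, norm_mul, Complex.norm_real, Real.norm_of_nonneg (by positivity)]
        have h2 : 1 ≤ (δ ^ (μ - 1))⁻¹ * |z.2| ^ (μ - 1) := by
          rw [inv_mul_eq_div, one_le_div (rpow_pos_of_pos hδ _)]
          exact rpow_le_rpow hδ.le hz.1 (by linarith)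
        have h3 : |z.2| ^ (m - 1) ≤ |R| ^ (m - 1) :=
          rpow_le_rpow hv.le (hz.2.trans (le_abs_self R)) (by linarith)
        calc ‖f z‖ * ‖adjointOp m (Ψn n) z‖
            ≤ ‖f z‖ * ((1 + |R| ^ (m - 1) * d) * (4 * B' * C * polyWeight N z.1)) := by
              gcongr
              exact h1.trans (by gcongr)
          _ ≤ ‖f z‖ * ((1 + |R| ^ (m - 1) * d) * (4 * B' * C * polyWeight N z.1)) *
              ((δ ^ (μ - 1))⁻¹ * |z.2| ^ (μ - 1)) := le_mul_of_one_le_right (by positivity) h2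
          _ = _ := by rw [polyWeight]; ring
    · refine tendsto_const_nhds.congr' ?_
      filter_upwards [scaleCutoff_eventually_one b z.1] with n hn
      have e : (fun y => Ψn n (y, z.2)) =ᶠ[𝓝 z.1] fun y => Ψ (y, z.2) := by
        filter_upwards [hn] with y hy
        simp only [hΨn, χ, hy, one_smul]
      rw [adjointOp_eq_slice m (contDiff_slice hΨ.smooth),
        adjointOp_eq_slice m (contDiff_slice (hsm n)), e.fderiv_eq,
        (e.iteratedFDeriv ℝ 2).eq_of_nhds]
  refine tendsto_nhds_unique hlim ?_
  simp_rw [fun n => h.complex hm hf (hsm n) (hcs n)]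
  exact lim₀.sub lim₁

end KineticAveraging

namespace KineticAveraging

open Real FourierTransform Filter Topology

variable {d : ℕ}

/-! ### The part of the average away from small velocities -/

/-- A smooth velocity cutoff supported in `δ ≤ |v| ≤ R`. -/
structure IsVelocityCutoff (θ : ℝ → ℝ) (δ R : ℝ) : Prop where
  smooth : ContDiff ℝ ∞ θ
  vanish : ∀ v, (|v| < δ ∨ R < |v|) → θ v = 0

lemma IsVelocityCutoff.eventually_zero {θ : ℝ → ℝ} {δ R : ℝ} (h : IsVelocityCutoff θ δ R) {v : ℝ}
    (hv : |v| < δ ∨ R < |v|) : ∀ᶠ v' in 𝓝 v, θ v' = 0 := by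
  rcases hv with hv | hv
  · filter_upwards [continuous_abs.continuousAt.eventually_lt continuousAt_const hv] with v' hv'
    exact h.vanish _ (Or.inl hv')
  · filter_upwards [continuousAt_const.eventually_lt continuous_abs.continuousAt hv] with v' hv'
    exact h.vanish _ (Or.inr hv')

lemma IsVelocityCutoff.deriv_eq_zero {θ : ℝ → ℝ} {δ R : ℝ} (h : IsVelocityCutoff θ δ R) {v : ℝ}
    (hv : |v| < δ ∨ R < |v|) : deriv θ v = 0 := by
  have : θ =ᶠ[𝓝 v] fun _ => 0 := h.eventually_zero hv
  rw [this.deriv_eq, deriv_const]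

lemma norm_iteratedFDeriv_comp_const_sub {E F : Type*} [NormedAddCommGroup E] [NormedSpace ℝ E]
    [NormedAddCommGroup F] [NormedSpace ℝ F] (G : E → F) (y z : E) (j : ℕ) :
    ‖iteratedFDeriv ℝ j (fun z => G (y - z)) z‖ = ‖iteratedFDeriv ℝ j G (y - z)‖ := by
  have e : (fun z => G (y - z)) = fun z => (G ∘ LinearIsometryEquiv.neg ℝ) (z - y) := by
    funext z; simp
  rw [e, iteratedFDeriv_comp_sub, LinearIsometryEquiv.norm_iteratedFDeriv_comp_right]
  simp

/-- The test function dual to the localized velocity average at the point `y`. -/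
def velocityTest (X : ℝ → ℝ) (φ : Space d → ℝ) (a c m : ℝ) (θ : ℝ → ℝ) (y : SpaceTime d)
    (z : Phase d) : ℂ :=
  (θ z.2 : ℂ) * kineticKernel X φ a c 0 ((m - 1) * log z.2) (y - z.1)

/-- The velocity derivative of `velocityTest`. -/
def velocityTestDeriv (X : ℝ → ℝ) (φ : Space d → ℝ) (a c m : ℝ) (θ : ℝ → ℝ) (y : SpaceTime d)
    (z : Phase d) : ℂ :=
  ((deriv θ z.2 : ℝ) : ℂ) * kineticKernel X φ a c 0 ((m - 1) * log z.2) (y - z.1) -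
    (θ z.2 * ((m - 1) / z.2) : ℝ) * kineticKernel X φ a c 1 ((m - 1) * log z.2) (y - z.1)

variable {X : ℝ → ℝ} {φ : Space d → ℝ} {a c m δ R : ℝ} {θ : ℝ → ℝ}

lemma contDiffAt_kineticKernel_comp {E : Type*} [NormedAddCommGroup E] [NormedSpace ℝ E]
    (hX : IsTimeCutoff X) (hφ : IsSpaceCutoff φ) (ha : 0 < a) (hc : 0 < c) (k : ℕ) {u : E → ℝ}
    {w : E → SpaceTime d} {x : E} (hu : ContDiffAt ℝ ∞ u x) (hw : ContDiffAt ℝ ∞ w x) :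
    ContDiffAt ℝ ∞ (fun x => kineticKernel X φ a c k (u x) (w x)) x :=
  ContDiffAt.comp (g := fun q : ℝ × SpaceTime d => kineticKernel X φ a c k q.1 q.2)
    (f := fun x => (u x, w x)) x (contDiff_kineticKernel hX hφ ha hc k).contDiffAt (hu.prodMk hw)

lemma deriv_velocityTest (hX : IsTimeCutoff X) (hφ : IsSpaceCutoff φ) (ha : 0 < a) (hc : 0 < c)
    (hδ : 0 < δ) (hθ : IsVelocityCutoff θ δ R) (y : SpaceTime d) (z : Phase d) :
    deriv (fun v => velocityTest X φ a c m θ y (z.1, v)) z.2 =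
      velocityTestDeriv X φ a c m θ y z := by
  by_cases hv : z.2 = 0
  · have h0 : |z.2| < δ ∨ R < |z.2| := Or.inl (by simpa [hv] using hδ)
    have : (fun v => velocityTest X φ a c m θ y (z.1, v)) =ᶠ[𝓝 z.2] fun _ => 0 := by
      filter_upwards [hθ.eventually_zero h0] with v hv
      simp [velocityTest, hv]
    rw [this.deriv_eq, deriv_const, velocityTestDeriv, hθ.deriv_eq_zero h0, hθ.vanish _ h0]
    simp
  · have h1 : HasDerivAt (fun v => (θ v : ℂ)) ((deriv θ z.2 : ℝ) : ℂ) z.2 :=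
      ((hθ.smooth.differentiable (by simp)) z.2).hasDerivAt.ofReal_comp
    have h2 : HasDerivAt (fun v => (m - 1) * log v) ((m - 1) * z.2⁻¹) z.2 :=
      (hasDerivAt_log hv).const_mul _
    have h3 := (hasDerivAt_kineticKernel hX hφ ha hc ((m - 1) * log z.2) (y - z.1)).scomp z.2 h2
    have h4 := h1.mul h3
    rw [velocityTestDeriv]
    refine HasDerivAt.deriv (h4.congr_deriv ?_)
    simp only [Function.comp_apply, Complex.real_smul]
    push_cast
    ring

lemma contDiff_velocityTest (hX : IsTimeCutoff X) (hφ : IsSpaceCutoff φ) (ha : 0 < a) (hc : 0 < c)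
    (hδ : 0 < δ) (hθ : IsVelocityCutoff θ δ R) (y : SpaceTime d) :
    ContDiff ℝ ∞ (velocityTest X φ a c m θ y) := by
  rw [contDiff_iff_contDiffAt]
  intro z
  by_cases hv : z.2 = 0
  · have h0 : |z.2| < δ ∨ R < |z.2| := Or.inl (by simpa [hv] using hδ)
    have : velocityTest X φ a c m θ y =ᶠ[𝓝 z] fun _ => 0 := by
      filter_upwards [(continuous_snd.continuousAt (x := z)).eventually
        (hθ.eventually_zero h0)] with w hw
      simp [velocityTest, hw]
    exact contDiffAt_const.congr_of_eventuallyEq this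
  · refine ContDiffAt.mul ?_ ?_
    · exact (Complex.ofRealCLM.contDiff.comp (hθ.smooth.comp contDiff_snd)).contDiffAt
    · exact contDiffAt_kineticKernel_comp hX hφ ha hc 0
        (contDiffAt_const.mul (contDiffAt_snd.log hv)) (contDiffAt_const.sub contDiffAt_fst)

lemma log_mem_Icc {v : ℝ} (hm : 1 < m) (hδ : 0 < δ) (hv : ¬ (|v| < δ ∨ R < |v|)) :
    (m - 1) * log v ∈ Set.Icc ((m - 1) * log δ) ((m - 1) * log R) := by
  push Not at hv
  have h0 : 0 < |v| := hδ.trans_le hv.1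
  rw [← log_abs v]
  exact ⟨mul_le_mul_of_nonneg_left (log_le_log hδ hv.1) (by linarith),
    mul_le_mul_of_nonneg_left (log_le_log h0 hv.2) (by linarith)⟩

lemma IsVelocityCutoff.exists_bound {g : ℝ → ℝ} (hg : Continuous g)
    (h : ∀ v, (|v| < δ ∨ R < |v|) → g v = 0) : ∃ B : ℝ, 0 ≤ B ∧ ∀ v, |g v| ≤ B := by
  have hc : HasCompactSupport g := HasCompactSupport.intro (isCompact_closedBall (0 : ℝ) R)
    fun v hv => h v (Or.inr (by simpa using hv))
  obtain ⟨B, hB⟩ := hg.bounded_above_of_compact_support hc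
  exact ⟨B, (norm_nonneg _).trans (hB 0), hB⟩

lemma isDecayingTest_velocityTest (hX : IsTimeCutoff X) (hφ : IsSpaceCutoff φ) (ha : 0 < a)
    (hc : 0 < c) (hm : 1 < m) (hδ : 0 < δ) (hθ : IsVelocityCutoff θ δ R) (y : SpaceTime d) (N : ℕ) :
    IsDecayingTest (velocityTest X φ a c m θ y) δ R N where
  smooth := contDiff_velocityTest hX hφ ha hc hδ hθ y
  vanish z hz := by simp [velocityTest, hθ.vanish _ hz]
  decay := by
    obtain ⟨B, hB0, hB⟩ := IsVelocityCutoff.exists_bound hθ.smooth.continuous hθ.vanish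
    choose C hC0 hC using fun j => kineticKernel_decay hX hφ ha hc 0 ((m - 1) * log δ)
      ((m - 1) * log R) N j
    set C' := C 0 + C 1 + C 2
    have hC' : ∀ j ≤ 2, C j ≤ C' := fun j hj => by
      interval_cases j <;> simp only [C'] <;> linarith [hC0 0, hC0 1, hC0 2]
    have hC'0 : 0 ≤ C' := (hC0 0).trans (hC' 0 (by norm_num))
    refine ⟨B * (C' * (1 + ‖y‖) ^ N), by positivity, fun j hj z => ?_⟩
    have hpw := polyWeight_pos N z.1
    by_cases hz : |z.2| < δ ∨ R < |z.2|
    · have : (fun y' => velocityTest X φ a c m θ y (y', z.2)) = fun _ => 0 := by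
        funext y'; simp [velocityTest, hθ.vanish _ hz]
      rw [this, iteratedFDeriv_fun_zero, Pi.zero_apply, norm_zero]
      positivity
    · have hK : ContDiff ℝ ∞ (fun z' => kineticKernel X φ a c 0 ((m - 1) * log z.2) (y - z')) :=
        contDiff_iff_contDiffAt.2 fun _ => contDiffAt_kineticKernel_comp hX hφ ha hc 0
          contDiffAt_const (contDiffAt_const.sub contDiffAt_id)
      have e : (fun y' => velocityTest X φ a c m θ y (y', z.2)) =
          fun y' => θ z.2 • kineticKernel X φ a c 0 ((m - 1) * log z.2) (y - y') := by
        funext y'; rw [velocityTest, Complex.real_smul]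
      rw [e, iteratedFDeriv_const_smul_apply' (hK.contDiffAt.of_le (mod_cast le_top)), norm_smul,
        norm_iteratedFDeriv_comp_const_sub, mul_assoc]
      refine mul_le_mul (hB _) ?_ (norm_nonneg _) hB0
      refine (hC j _ (log_mem_Icc hm hδ hz) _).trans ?_
      rw [mul_assoc]
      refine mul_le_mul (hC' j hj) ?_ (zpow_nonneg (by positivity) _) hC'0
      have h2 := polyWeight_add_le N z.1 (-y)
      rw [← sub_eq_add_neg, norm_neg] at h2
      rw [polyWeight, ← norm_neg, neg_sub] at h2
      exact h2
  bounded_deriv := by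
    obtain ⟨B, hB0, hB⟩ := IsVelocityCutoff.exists_bound
      (hθ.smooth.continuous_deriv (by simp)) (fun v hv => hθ.deriv_eq_zero hv)
    obtain ⟨B', hB'0, hB'⟩ := IsVelocityCutoff.exists_bound hθ.smooth.continuous hθ.vanish
    choose C hC0 hC using fun k => kineticKernel_decay hX hφ ha hc k ((m - 1) * log δ)
      ((m - 1) * log R) 0 0
    refine ⟨B * C 0 + B' * ((m - 1) / δ) * C 1, by
      have := hC0 0; have := hC0 1; have : 0 ≤ m - 1 := by linarith
      positivity, fun z => ?_⟩
    rw [deriv_velocityTest hX hφ ha hc hδ hθ]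
    have hp : 0 ≤ m - 1 := by linarith
    by_cases hz : |z.2| < δ ∨ R < |z.2|
    · rw [velocityTestDeriv, hθ.deriv_eq_zero hz, hθ.vanish _ hz]
      simp only [Complex.ofReal_zero, zero_mul, sub_zero, norm_zero]
      have := hC0 0; have := hC0 1
      positivity
    · have hK := fun k => hC k _ (log_mem_Icc hm hδ hz) (y - z.1)
      simp only [norm_iteratedFDeriv_zero, Nat.cast_zero, neg_zero, zpow_zero, mul_one] at hK
      push Not at hz
      refine (norm_sub_le _ _).trans (add_le_add ?_ ?_)
      · rw [norm_mul, Complex.norm_real]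
        exact mul_le_mul (hB _) (hK 0) (norm_nonneg _) hB0
      · rw [norm_mul, Complex.norm_real, norm_mul, norm_div, Real.norm_of_nonneg hp]
        refine mul_le_mul (mul_le_mul (hB' _) ?_ (by positivity) hB'0) (hK 1) (norm_nonneg _)
          (by positivity)
        exact div_le_div_of_nonneg_left hp hδ hz.1

lemma adjointOp_velocityTest (hX : IsTimeCutoff X) (hφ : IsSpaceCutoff φ) (ha : 0 < a) (hc : 0 < c)
    (hδ : 0 < δ) (hθ : IsVelocityCutoff θ δ R) (y : SpaceTime d) (z : Phase d) :
    adjointOp m (velocityTest X φ a c m θ y) z = (θ z.2 : ℂ) * blockKernel X φ a c (y - z.1) := by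
  by_cases hv : z.2 = 0
  · have h0 : |z.2| < δ ∨ R < |z.2| := Or.inl (by simpa [hv] using hδ)
    have e : (fun y' => velocityTest X φ a c m θ y (y', z.2)) = fun _ => 0 := by
      funext y'; simp [velocityTest, hθ.vanish _ h0]
    rw [adjointOp_eq_slice m (contDiff_slice (contDiff_velocityTest hX hφ ha hc hδ hθ y)), e,
      hθ.vanish _ h0]
    simp
  -- `Real.log` is even, so `(m - 1) * log v` is the right parameter for velocities of both signs.
  · have hexp : |z.2| ^ (m - 1) = exp ((m - 1) * log z.2) := by
      rw [rpow_def_of_pos (abs_pos.2 hv), log_abs, mul_comm]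
    have hK := kineticKernel_equation hX hφ ha hc ((m - 1) * log z.2) y z.1.fst z.1.snd
    have hyz : y - pt z.1.fst z.1.snd = y - z.1 := rfl
    rw [hyz] at hK
    rw [← hK, adjointOp, hexp]
    have hx : ContDiff ℝ ∞ (fun x : Space d =>
        kineticKernel X φ a c 0 ((m - 1) * log z.2) (y - pt z.1.fst x)) := by
      have e : (fun x : Space d => pt z.1.fst x) = fun x => spaceEmb d x + pt z.1.fst 0 :=
        funext (pt_eq_spaceEmb_add z.1.fst)
      have : ContDiff ℝ ∞ (fun x : Space d => pt z.1.fst x) := by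
        rw [e]; exact (spaceEmb d).contDiff.add contDiff_const
      exact contDiff_iff_contDiffAt.2 fun _ => contDiffAt_kineticKernel_comp hX hφ ha hc 0
        contDiffAt_const (contDiffAt_const.sub this.contDiffAt)
    have e1 : deriv (fun t => velocityTest X φ a c m θ y (pt t z.1.snd, z.2)) z.1.fst =
        (θ z.2 : ℂ) * deriv (fun t =>
          kineticKernel X φ a c 0 ((m - 1) * log z.2) (y - pt t z.1.snd)) z.1.fst := by
      simp only [velocityTest]
      exact deriv_const_mul_field _
    have e2 : (Δ fun x : Space d => velocityTest X φ a c m θ y (pt z.1.fst x, z.2)) z.1.snd =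
        (θ z.2 : ℂ) * (Δ fun x : Space d =>
          kineticKernel X φ a c 0 ((m - 1) * log z.2) (y - pt z.1.fst x)) z.1.snd := by
      have := InnerProductSpace.laplacian_smul (𝕜 := ℝ) (θ z.2)
        (hx.contDiffAt.of_le two_le_infty : ContDiffAt ℝ 2 _ z.1.snd)
      rw [Complex.real_smul] at this
      rw [← this]
      rfl
    rw [e1, e2]
    push_cast
    ring

/-- The representation on which the proof rests: the adjoint operator applied to `velocityTest`
gives the block kernel times `θ`, so a frequency block of the truncated average is expressed by `g₀`
and `g₁` alone. -/
theorem kinetic_identity (hX : IsTimeCutoff X) (hφ : IsSpaceCutoff φ) (ha : 0 < a) (hc : 0 < c)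
    {γ μ : ℝ} {N : ℕ} (hm : 1 < m) (hμ : 1 ≤ μ) (hδ : 0 < δ) (hθ : IsVelocityCutoff θ δ R)
    {f : Phase d → ℂ} {g₀ g₁ : RadonMeasure d}
    (h : IsKineticSolution m f g₀ g₁) (hf : LocallyIntegrable f volume)
    (h₀ : g₀.weightedTV (1 - γ) < ⊤) (h₁ : g₁.weightedTV (-γ) < ⊤)
    (hav : Integrable fun z : Phase d =>
      f z * (((1 + ‖z.1‖) ^ (-(N : ℤ)) * |z.2| ^ (μ - 1) : ℝ) : ℂ)) (y : SpaceTime d) :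
    ∫ z : Phase d, f z * ((θ z.2 : ℂ) * blockKernel X φ a c (y - z.1)) =
      g₀.cintegral (velocityTest X φ a c m θ y) -
        g₁.cintegral (velocityTestDeriv X φ a c m θ y) := by
  have := h.decaying hm hμ hδ hf h₀ h₁ hav
    (isDecayingTest_velocityTest hX hφ ha hc hm hδ hθ y N)
  simp_rw [adjointOp_velocityTest hX hφ ha hc hδ hθ, deriv_velocityTest hX hφ ha hc hδ hθ] at this
  exact this

lemma measurable_kineticKernel_phase (hX : IsTimeCutoff X) (hφ : IsSpaceCutoff φ) (ha : 0 < a)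
    (hc : 0 < c) (m : ℝ) (k : ℕ) : Measurable fun q : SpaceTime d × Phase d =>
      kineticKernel X φ a c k ((m - 1) * log q.2.2) (q.1 - q.2.1) := by
  have hu : Measurable fun q : SpaceTime d × Phase d => (m - 1) * log q.2.2 := by fun_prop
  have hw : Measurable fun q : SpaceTime d × Phase d => q.1 - q.2.1 := by fun_prop
  have h1 : Measurable fun q : SpaceTime d × Phase d => ((m - 1) * log q.2.2, q.1 - q.2.1) :=
    hu.prodMk hw
  have h2 : Continuous fun q : ℝ × SpaceTime d => kineticKernel X φ a c k q.1 q.2 :=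
    (contDiff_kineticKernel hX hφ ha hc k).continuous
  generalize kineticKernel X φ a c k = K at h2
  exact h2.measurable.comp h1

lemma RadonMeasure.lintegral_cintegral_le (g : RadonMeasure d) {Θ : SpaceTime d → Phase d → ℂ}
    (hΘ : Measurable fun q : SpaceTime d × Phase d => Θ q.1 q.2) {D : ℝ≥0∞} {e : ℝ}
    (h : ∀ z, ∫⁻ y, ‖Θ y z‖ₑ ≤ D * ‖z.2‖ₑ ^ e) :
    ∫⁻ y, ‖g.cintegral (Θ y)‖ₑ ≤ D * g.weightedTV e := by
  have := g.finite_on_compacts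
  calc ∫⁻ y, ‖g.cintegral (Θ y)‖ₑ ≤ ∫⁻ y, ∫⁻ z, ‖Θ y z‖ₑ ∂g.variation := by
        refine lintegral_mono fun y => ?_
        refine (enorm_integral_le_lintegral_enorm _).trans (lintegral_mono fun z => ?_)
        have : ‖g.phase z‖ₑ = 1 := by rw [← ofReal_norm, g.norm_phase, ENNReal.ofReal_one]
        rw [enorm_mul, this, mul_one]
    _ = ∫⁻ z, (∫⁻ y, ‖Θ y z‖ₑ) ∂g.variation := lintegral_lintegral_swap hΘ.enorm.aemeasurable
    _ ≤ ∫⁻ z, D * ‖z.2‖ₑ ^ e ∂g.variation := lintegral_mono h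
    _ = _ := lintegral_const_mul _ (measurable_snd.enorm.pow_const e)

/-- The exponent count: `|v|^(μ - s(m-1)) = |v|^(-a₁) |v|^e`, where the first factor is at most
`δ^(-a₁)` and the second is the weight carried by the measure. -/
lemma exp_log_mul_le {s μ e B x δ v a₁ : ℝ} (hB : 0 ≤ B) (hδ : 0 < δ) (hv : δ ≤ |v|) (ha₁ : 0 ≤ a₁)
    (he : e = a₁ + μ - s * (m - 1)) (hx : |x| ≤ B * |v| ^ μ) :
    |x| * exp (-(s * ((m - 1) * log v))) ≤ B * δ ^ (-a₁) * |v| ^ e := by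
  have h0 : 0 < |v| := hδ.trans_le hv
  have h1 : exp (-(s * ((m - 1) * log v))) = |v| ^ (-(s * (m - 1))) := by
    rw [rpow_def_of_pos h0, log_abs]; congr 1; ring
  rw [h1]
  calc _ ≤ B * |v| ^ μ * |v| ^ (-(s * (m - 1))) := by gcongr
    _ = B * |v| ^ (-a₁) * |v| ^ e := by
        rw [mul_assoc, mul_assoc, ← rpow_add h0, ← rpow_add h0, he]; congr 2; ring
    _ ≤ _ := by
        gcongr 1
        gcongr 1
        exact rpow_le_rpow_of_nonpos hδ hv (by linarith)

/-- The `L¹` bound for the part of the average away from small velocities. -/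
theorem exists_lintegral_cutoffAverage_le {s γ μ : ℝ} (hX : IsAdmissibleCutoff X s)
    (hφ : IsSpaceCutoff φ) (hm : 1 < m) (hμ : 1 ≤ μ) (hs₀ : 0 ≤ s) (hs₁ : s ≤ 1)
    (ha₁ : 0 ≤ s * (m - 1) + 2 - γ - μ) {B : ℝ} (hB : 0 ≤ B) :
    ∃ C : ℝ≥0, ∀ (a c δ R : ℝ) (θ : ℝ → ℝ), 0 < a → 0 < c → 0 < δ → IsVelocityCutoff θ δ R →
      (∀ v, |θ v| ≤ B * |v| ^ (μ - 1)) → (∀ v, |deriv θ v| ≤ B * |v| ^ (μ - 2)) →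
      ∀ (f : Phase d → ℂ) (g₀ g₁ : RadonMeasure d), IsKineticSolution m f g₀ g₁ →
      LocallyIntegrable f volume → g₀.weightedTV (1 - γ) < ⊤ → g₁.weightedTV (-γ) < ⊤ →
      HasVelocityAverage μ f →
      ∫⁻ y, ‖∫ z : Phase d, f z * ((θ z.2 : ℂ) * blockKernel X φ a c (y - z.1))‖ₑ ≤
        C * ENNReal.ofReal (a ^ (-(1 - s)) * c ^ (-(2 * s)) *
          δ ^ (-(s * (m - 1) + 2 - γ - μ))) *
          (g₀.weightedTV (1 - γ) + g₁.weightedTV (-γ)) := by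
  choose C hC using fun k => exists_lintegral_kineticKernel_le hX hφ hs₀ hs₁ k
  have hm0 : 0 < m - 1 := by linarith
  set a₁ := s * (m - 1) + 2 - γ - μ with ha₁def
  refine ⟨(C 0 + C 1) * ((1 + (m - 1)) * B).toNNReal, fun a c δ R θ ha hc hδ hθ hθ0 hθ1 f g₀ g₁ h
    hf h₀ h₁ hav => ?_⟩
  obtain ⟨N, hav⟩ := hav
  simp_rw [kinetic_identity hX.1 hφ ha hc hm hμ hδ hθ h hf h₀ h₁ hav]
  set M := a ^ (-(1 - s)) * c ^ (-(2 * s))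
  have hM : 0 < M := by positivity
  have hmeasθ : Measurable fun q : SpaceTime d × Phase d => (θ q.2.2 : ℂ) :=
    Complex.measurable_ofReal.comp
      (hθ.smooth.continuous.measurable.comp (measurable_snd.comp measurable_snd))
  have hmeasθ' : Measurable fun q : SpaceTime d × Phase d => ((deriv θ q.2.2 : ℝ) : ℂ) :=
    Complex.measurable_ofReal.comp
      ((measurable_deriv θ).comp (measurable_snd.comp measurable_snd))
  have hmeasθ'' : Measurable fun q : SpaceTime d × Phase d =>
      ((θ q.2.2 * ((m - 1) / q.2.2) : ℝ) : ℂ) := by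
    refine Complex.measurable_ofReal.comp (Measurable.mul ?_ ?_)
    · exact hθ.smooth.continuous.measurable.comp (measurable_snd.comp measurable_snd)
    · exact measurable_const.div (measurable_snd.comp measurable_snd)
  have hmK := measurable_kineticKernel_phase hX.1 hφ ha hc m
  -- One estimate for all three terms: the `g₀` term has `μ' = μ - 1` and `e = 1 - γ`, both `g₁`
  -- terms have `μ' = μ - 2` and `e = -γ`, and the same `a₁` results each time.
  have base : ∀ (k : ℕ) (x : ℝ) (e μ' B' : ℝ) (z : Phase d), 0 ≤ B' → δ ≤ |z.2| →
      e = a₁ + μ' - s * (m - 1) → |x| ≤ B' * |z.2| ^ μ' →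
      ∫⁻ y, ‖(x : ℂ) * kineticKernel X φ a c k ((m - 1) * log z.2) (y - z.1)‖ₑ ≤
        C k * ENNReal.ofReal (B' * (M * δ ^ (-a₁))) * ‖z.2‖ₑ ^ e := by
    intro k x e μ' B' z hB' hz he hx
    have hv : 0 < |z.2| := hδ.trans_le hz
    have h1 := exp_log_mul_le (s := s) (m := m) hB' hδ hz ha₁ he hx
    have h2 : ‖z.2‖ₑ ^ e = ENNReal.ofReal (|z.2| ^ e) := by
      rw [← ofReal_norm, Real.norm_eq_abs, ENNReal.ofReal_rpow_of_pos hv]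
    have h3 : ∫⁻ y, ‖kineticKernel X φ a c k ((m - 1) * log z.2) (y - z.1)‖ₑ =
        ∫⁻ y, ‖kineticKernel X φ a c k ((m - 1) * log z.2) y‖ₑ :=
      lintegral_sub_right_eq_self (fun y => ‖kineticKernel X φ a c k ((m - 1) * log z.2) y‖ₑ) z.1
    simp_rw [enorm_mul]
    rw [lintegral_const_mul' _ _ enorm_ne_top, h3, h2]
    have h4 : ‖(x : ℂ)‖ₑ = ENNReal.ofReal |x| := by
      rw [← ofReal_norm, Complex.norm_real, Real.norm_eq_abs]
    rw [h4]
    calc _ ≤ ENNReal.ofReal |x| * (C k * ENNReal.ofReal (M * exp (-(s * ((m - 1) * log z.2))))) := by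
          gcongr
          exact hC k a c ha hc _
      _ = C k * ENNReal.ofReal (M * (|x| * exp (-(s * ((m - 1) * log z.2))))) := by
          rw [mul_left_comm, ← ENNReal.ofReal_mul (abs_nonneg _)]
          congr 2; ring
      _ ≤ C k * ENNReal.ofReal (B' * (M * δ ^ (-a₁)) * |z.2| ^ e) := by
          gcongr 2
          calc _ ≤ M * (B' * δ ^ (-a₁) * |z.2| ^ e) := by gcongr
            _ = _ := by ring
      _ = _ := by rw [mul_assoc (C k : ℝ≥0∞), ← ENNReal.ofReal_mul (by positivity)]
  -- `1 + (m - 1)` is a common bound for the coefficient `1` and for the coefficient `m - 1`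
  -- produced by differentiating `(m - 1) log v`.
  have hD : ∀ x : ℝ, 0 ≤ x → x ≤ 1 + (m - 1) →
      ENNReal.ofReal (x * B * (M * δ ^ (-a₁))) ≤
        (((1 + (m - 1)) * B).toNNReal : ℝ≥0∞) * ENNReal.ofReal (M * δ ^ (-a₁)) := fun x h0 hx => by
    rw [ENNReal.ofReal_mul (by positivity)]
    gcongr
    exact ENNReal.ofReal_le_ofReal (by gcongr)
  set D : ℝ≥0∞ := (((1 + (m - 1)) * B).toNNReal : ℝ≥0∞) * ENNReal.ofReal (M * δ ^ (-a₁)) with hDdef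
  have b0 : ∫⁻ y, ‖g₀.cintegral (velocityTest X φ a c m θ y)‖ₑ ≤
      (C 0 + C 1) * D * g₀.weightedTV (1 - γ) := by
    refine g₀.lintegral_cintegral_le (hmeasθ.mul (hmK 0)) fun z => ?_
    by_cases hz : |z.2| < δ
    · simp [velocityTest, hθ.vanish _ (Or.inl hz)]
    · refine (base 0 (θ z.2) (1 - γ) (μ - 1) B z hB (not_lt.1 hz) (by rw [ha₁def]; ring)
        (hθ0 _)).trans ?_
      gcongr
      · exact le_self_add
      · have := hD 1 zero_le_one (by linarith)
        rwa [one_mul] at this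
  have b1 : ∫⁻ y, ‖g₁.cintegral (velocityTestDeriv X φ a c m θ y)‖ₑ ≤
      (C 0 + C 1) * D * g₁.weightedTV (-γ) := by
    refine g₁.lintegral_cintegral_le
      ((hmeasθ'.mul (hmK 0)).sub (hmeasθ''.mul (hmK 1))) fun z => ?_
    by_cases hz : |z.2| < δ
    · simp [velocityTestDeriv, hθ.vanish _ (Or.inl hz), hθ.deriv_eq_zero (Or.inl hz)]
    · rw [not_lt] at hz
      have hv : 0 < |z.2| := hδ.trans_le hz
      have t0 := base 0 (deriv θ z.2) (-γ) (μ - 2) B z hB hz (by rw [ha₁def]; ring) (hθ1 _)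
      have t1 := base 1 (θ z.2 * ((m - 1) / z.2)) (-γ) (μ - 2) ((m - 1) * B) z (by positivity) hz
        (by rw [ha₁def]; ring) (by
          rw [abs_mul, abs_div, abs_of_pos hm0]
          calc _ ≤ B * |z.2| ^ (μ - 1) * ((m - 1) / |z.2|) := by gcongr; exact hθ0 _
            _ = _ := by
              rw [show μ - 1 = (μ - 2) + 1 by ring, rpow_add hv, rpow_one]
              field_simp)
      calc _ ≤ ∫⁻ y, (‖((deriv θ z.2 : ℝ) : ℂ) *
              kineticKernel X φ a c 0 ((m - 1) * log z.2) (y - z.1)‖ₑ +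
            ‖((θ z.2 * ((m - 1) / z.2) : ℝ) : ℂ) *
              kineticKernel X φ a c 1 ((m - 1) * log z.2) (y - z.1)‖ₑ) :=
            lintegral_mono fun y => enorm_sub_le
        _ = _ := lintegral_add_left (by
            exact (((hmeasθ'.mul (hmK 0)).comp (measurable_prodMk_right (y := z))).enorm)) _
        _ ≤ C 0 * D * ‖z.2‖ₑ ^ (-γ) + C 1 * D * ‖z.2‖ₑ ^ (-γ) := by
            refine add_le_add (t0.trans ?_) (t1.trans ?_)
            · gcongr
              have := hD 1 zero_le_one (by linarith)
              rwa [one_mul] at this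
            · gcongr
              exact hD (m - 1) hm0.le (by linarith)
        _ = _ := by ring
  calc _ ≤ ∫⁻ y, (‖g₀.cintegral (velocityTest X φ a c m θ y)‖ₑ +
          ‖g₁.cintegral (velocityTestDeriv X φ a c m θ y)‖ₑ) :=
        lintegral_mono fun y => enorm_sub_le
    _ = _ := lintegral_add_left' (by
        have := g₀.finite_on_compacts
        have h1 : StronglyMeasurable fun q : SpaceTime d × Phase d =>
            velocityTest X φ a c m θ q.1 q.2 * g₀.phase q.2 :=
          ((hmeasθ.mul (hmK 0)).mul
            (g₀.measurable_phase.comp measurable_snd)).stronglyMeasurable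
        exact h1.integral_prod_right'.measurable.enorm.aemeasurable) _
    _ ≤ _ := add_le_add b0 b1
    _ = _ := by
        rw [hDdef]
        push_cast
        ring

end KineticAveraging

namespace KineticAveraging

open Real FourierTransform Filter Topology

variable {d : ℕ}

/-! ### Velocity cutoffs -/

/-- The standard bump function in velocity. -/
def vBump : ContDiffBump (0 : ℝ) := ⟨1, 2, one_pos, one_lt_two⟩

lemma vBump_eq_one {v : ℝ} (hv : |v| ≤ 1) : vBump v = 1 :=
  vBump.one_of_mem_closedBall (by simpa [vBump] using hv)

lemma vBump_eq_zero {v : ℝ} (hv : 2 ≤ |v|) : vBump v = 0 :=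
  vBump.zero_of_le_dist (by simpa [vBump] using hv)

lemma contDiff_vBump : ContDiff ℝ ∞ (vBump : ℝ → ℝ) := vBump.contDiff

/-- The weight `|v|^(μ-1)` restricted to `|v| ≲ δ`. -/
def lowWeight (μ δ v : ℝ) : ℝ := |v| ^ (μ - 1) * vBump (v / δ)

/-- The weight `|v|^(μ-1)` restricted to `|v| ≳ δ`. -/
def highWeight (μ δ v : ℝ) : ℝ := |v| ^ (μ - 1) * (1 - vBump (v / δ))

/-- The weight `|v|^(μ-1)` restricted to `δ ≲ |v| ≲ R`. -/
def midWeight (μ δ R v : ℝ) : ℝ := highWeight μ δ v * vBump (v / R)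

lemma abs_highWeight_le (μ δ v : ℝ) : |highWeight μ δ v| ≤ |v| ^ (μ - 1) := by
  have h0 := vBump.nonneg (x := v / δ)
  have h1 := vBump.le_one (x := v / δ)
  rw [highWeight, abs_mul, abs_of_nonneg (by positivity)]
  exact mul_le_of_le_one_right (by positivity) (abs_le.2 ⟨by linarith, by linarith⟩)

lemma abs_lowWeight_le (μ δ v : ℝ) : |lowWeight μ δ v| ≤ |v| ^ (μ - 1) := by
  have h0 := vBump.nonneg (x := v / δ)
  have h1 := vBump.le_one (x := v / δ)
  rw [lowWeight, abs_mul, abs_of_nonneg (by positivity)]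
  exact mul_le_of_le_one_right (by positivity) (abs_le.2 ⟨by linarith, by linarith⟩)

lemma abs_midWeight_le (μ δ R v : ℝ) : |midWeight μ δ R v| ≤ |v| ^ (μ - 1) := by
  have h0 := vBump.nonneg (x := v / R)
  have h1 := vBump.le_one (x := v / R)
  rw [midWeight, abs_mul]
  exact (mul_le_of_le_one_right (by positivity) (abs_le.2 ⟨by linarith, by linarith⟩)).trans
    (abs_highWeight_le _ _ _)

lemma highWeight_eq_zero (μ : ℝ) {δ v : ℝ} (hδ : 0 < δ) (hv : |v| ≤ δ) : highWeight μ δ v = 0 := by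
  rw [highWeight, vBump_eq_one, sub_self, mul_zero]
  rw [abs_div, abs_of_pos hδ]
  exact div_le_one_of_le₀ hv hδ.le

lemma lowWeight_eq_zero (μ : ℝ) {δ v : ℝ} (hδ : 0 < δ) (hv : 2 * δ ≤ |v|) :
    lowWeight μ δ v = 0 := by
  rw [lowWeight, vBump_eq_zero, mul_zero]
  rwa [abs_div, abs_of_pos hδ, le_div_iff₀ hδ]

lemma measurable_vBump_div (δ : ℝ) : Measurable fun v => vBump (v / δ) :=
  contDiff_vBump.continuous.measurable.comp (measurable_id.div_const δ)

lemma measurable_lowWeight (μ δ : ℝ) : Measurable (lowWeight μ δ) :=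
  (measurable_id.abs.pow_const _).mul (measurable_vBump_div δ)

lemma measurable_highWeight (μ δ : ℝ) : Measurable (highWeight μ δ) :=
  (measurable_id.abs.pow_const _).mul (measurable_const.sub (measurable_vBump_div δ))

lemma measurable_midWeight (μ δ R : ℝ) : Measurable (midWeight μ δ R) :=
  (measurable_highWeight μ δ).mul (measurable_vBump_div R)

lemma isVelocityCutoff_midWeight (μ : ℝ) {δ R : ℝ} (hδ : 0 < δ) (hR : 0 < R) :
    IsVelocityCutoff (midWeight μ δ R) δ (2 * R) where
  smooth := by
    have hb : ∀ r : ℝ, ContDiff ℝ ∞ fun v => vBump (v / r) := fun r =>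
      contDiff_vBump.comp (contDiff_id.div_const r)
    rw [contDiff_iff_contDiffAt]
    intro v
    by_cases hv : v = 0
    · have : midWeight μ δ R =ᶠ[𝓝 v] fun _ => 0 := by
        have : ∀ᶠ v' in 𝓝 v, |v'| < δ :=
          continuous_abs.continuousAt.eventually_lt continuousAt_const (by simpa [hv] using hδ)
        filter_upwards [this] with v' hv'
        rw [midWeight, highWeight_eq_zero μ hδ hv'.le, zero_mul]
      exact contDiffAt_const.congr_of_eventuallyEq this
    · exact (((contDiffAt_abs hv).rpow_const_of_ne (abs_ne_zero.2 hv)).mul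
        (contDiffAt_const.sub (hb δ).contDiffAt)).mul (hb R).contDiffAt
  vanish v hv := by
    rcases hv with hv | hv
    · rw [midWeight, highWeight_eq_zero μ hδ hv.le, zero_mul]
    · rw [midWeight, vBump_eq_zero, mul_zero]
      rw [abs_div, abs_of_pos hR, le_div_iff₀ hR]
      exact hv.le

/-- The function `x ↦ x b'(x)` is bounded for the bump `b`, so differentiating a cutoff at any scale
costs `|v|⁻¹` with the same constant. -/
lemma exists_deriv_vBump_div_le : ∃ B : ℝ, 0 ≤ B ∧ ∀ r v : ℝ, 0 < r → v ≠ 0 →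
    ∃ D, HasDerivAt (fun v => vBump (v / r)) D v ∧ |D| ≤ B / |v| := by
  have hc : Continuous fun x => x * deriv (vBump : ℝ → ℝ) x :=
    continuous_id.mul (contDiff_vBump.continuous_deriv (by simp))
  obtain ⟨B, hB⟩ := hc.bounded_above_of_compact_support
    (vBump.hasCompactSupport.deriv.mul_left (f := fun x => x))
  refine ⟨B, (norm_nonneg _).trans (hB 0), fun r v hr hv => ?_⟩
  refine ⟨deriv vBump (v / r) * (1 / r), ?_, ?_⟩
  · exact HasDerivAt.comp (h₂ := (vBump : ℝ → ℝ)) v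
      ((contDiff_vBump.differentiable (by simp)) (v / r)).hasDerivAt ((hasDerivAt_id v).div_const r)
  · have := hB (v / r)
    rw [le_div_iff₀ (abs_pos.2 hv), ← abs_mul]
    calc _ = ‖v / r * deriv vBump (v / r)‖ := by rw [Real.norm_eq_abs]; congr 1; ring
      _ ≤ B := this

/-- The power contributes `μ - 1` and each of the two bumps `B`. Independence of `R` allows `R → ∞`
later; the constant is enlarged to be at least `1` because it must also bound the weight itself. -/
lemma exists_deriv_midWeight_le {μ : ℝ} (hμ : 1 ≤ μ) : ∃ B : ℝ, 1 ≤ B ∧ ∀ δ R v : ℝ, 0 < δ → 0 < R →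
    |deriv (midWeight μ δ R) v| ≤ B * |v| ^ (μ - 2) := by
  obtain ⟨B, hB0, hB⟩ := exists_deriv_vBump_div_le
  refine ⟨μ + 2 * B, by linarith, fun δ R v hδ hR => ?_⟩
  by_cases hv : v = 0
  · rw [(isVelocityCutoff_midWeight μ hδ hR).deriv_eq_zero (Or.inl (by simpa [hv] using hδ)),
      abs_zero]
    positivity
  have hv' : 0 < |v| := abs_pos.2 hv
  obtain ⟨D₁, hD₁, hb₁⟩ := hB δ v hδ hv
  obtain ⟨D₂, hD₂, hb₂⟩ := hB R v hR hv
  have hp := (hasDerivAt_abs hv).rpow_const (p := μ - 1) (Or.inl hv'.ne')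
  have h := (hp.mul (hD₁.const_sub 1)).mul hD₂
  have e : deriv (midWeight μ δ R) v = _ := h.deriv
  rw [e]
  have hs : |((SignType.sign v : SignType) : ℝ)| = 1 := by
    rcases lt_or_gt_of_ne hv with h | h <;> simp [h, sign_pos]
  set b₁ := vBump (v / δ)
  set b₂ := vBump (v / R)
  have h1 : |1 - b₁| ≤ 1 := by
    have h0 := vBump.nonneg (x := v / δ)
    have h1 := vBump.le_one (x := v / δ)
    exact abs_le.2 ⟨by linarith, by linarith⟩
  have h2 : |b₂| ≤ 1 := by
    have h0 := vBump.nonneg (x := v / R)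
    have h1 := vBump.le_one (x := v / R)
    exact abs_le.2 ⟨by linarith, by linarith⟩
  have e1 : |v| ^ (μ - 1 - 1) = |v| ^ (μ - 2) := by congr 1; ring
  have e2 : |v| ^ (μ - 1) * (B / |v|) = B * |v| ^ (μ - 2) := by
    rw [show μ - 1 = (μ - 2) + 1 by ring, rpow_add hv', rpow_one]; field_simp
  have hw : 0 ≤ |v| ^ (μ - 1) := by positivity
  have hw2 : 0 ≤ |v| ^ (μ - 2) := by positivity
  refine (abs_add_le _ _).trans ?_
  rw [Pi.mul_apply, abs_mul, abs_mul, abs_mul]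
  calc _ ≤ (|(SignType.sign v : ℝ) * (μ - 1) * |v| ^ (μ - 1 - 1) * (1 - b₁)| +
        abs (|v| ^ (μ - 1) * -D₁)) * 1 + |v| ^ (μ - 1) * 1 * (B / |v|) := by
        gcongr
        · exact abs_add_le _ _
        · rw [abs_of_nonneg hw]
    _ ≤ ((μ - 1) * |v| ^ (μ - 2) * 1 + |v| ^ (μ - 1) * (B / |v|)) * 1 +
        |v| ^ (μ - 1) * 1 * (B / |v|) := by
        gcongr
        · rw [abs_mul, abs_mul, abs_mul, hs, one_mul, abs_of_nonneg (by linarith : 0 ≤ μ - 1), e1,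
            abs_of_nonneg hw2]
          gcongr
        · rw [abs_mul, abs_neg, abs_of_nonneg hw]
          gcongr
    _ = (μ - 1 + 2 * B) * |v| ^ (μ - 2) := by rw [mul_one, mul_one, mul_one, e2]; ring
    _ ≤ _ := by gcongr; linarith

/-! ### Weighted velocity averages -/

/-- The velocity average with weight `w`. -/
def weightedAverage (w : ℝ → ℝ) (f : Phase d → ℂ) (y : SpaceTime d) : ℂ :=
  ∫ v : ℝ, f (y, v) * (w v : ℂ)

lemma velocityAverage_eq (μ : ℝ) (f : Phase d → ℂ) :
    velocityAverage μ f = weightedAverage (fun v => |v| ^ (μ - 1)) f := rfl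

section Weighted

variable {μ : ℝ} {N : ℕ} {f : Phase d → ℂ} {w : ℝ → ℝ} {k : SpaceTime d → ℂ} {C : ℝ}

lemma integrable_weighted (hav : Integrable fun z : Phase d =>
      f z * (((1 + ‖z.1‖) ^ (-(N : ℤ)) * |z.2| ^ (μ - 1) : ℝ) : ℂ))
    (hf : AEStronglyMeasurable f volume) (hw : Measurable w) (hwb : ∀ v, |w v| ≤ |v| ^ (μ - 1))
    (hk : Continuous k) (hkb : ∀ y, ‖k y‖ ≤ C * polyWeight N y) (y : SpaceTime d) :
    Integrable fun z : Phase d => f z * ((w z.2 : ℂ) * k (y - z.1)) := by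
  have hC0 : 0 ≤ C := by
    have := (norm_nonneg _).trans (hkb 0)
    exact nonneg_of_mul_nonneg_left this (polyWeight_pos N 0)
  refine (hav.norm.const_mul (C * (1 + ‖y‖) ^ N)).mono' ?_ (Eventually.of_forall fun z => ?_)
  · refine hf.mul (Measurable.aestronglyMeasurable ?_)
    exact (Complex.measurable_ofReal.comp (hw.comp measurable_snd)).mul
      (hk.measurable.comp (measurable_const.sub measurable_fst))
  · have h2 := polyWeight_add_le N z.1 (-y)
    rw [← sub_eq_add_neg, norm_neg] at h2
    have h3 : polyWeight N (y - z.1) = polyWeight N (z.1 - y) := by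
      rw [polyWeight, polyWeight, norm_sub_rev]
    have hpw := polyWeight_pos N z.1
    rw [norm_mul, norm_mul, norm_mul, Complex.norm_real, Complex.norm_real, Real.norm_eq_abs,
      Real.norm_of_nonneg (by positivity)]
    calc _ ≤ ‖f z‖ * (|z.2| ^ (μ - 1) * (C * ((1 + ‖y‖) ^ N * polyWeight N z.1))) := by
          gcongr
          · exact hwb _
          · refine (hkb _).trans ?_
            rw [h3]
            gcongr
      _ = _ := by rw [polyWeight]; ring

lemma isTemperedFun_weightedAverage (hav : Integrable fun z : Phase d =>
      f z * (((1 + ‖z.1‖) ^ (-(N : ℤ)) * |z.2| ^ (μ - 1) : ℝ) : ℂ))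
    (hf : AEStronglyMeasurable f volume) (hw : Measurable w) (hwb : ∀ v, |w v| ≤ |v| ^ (μ - 1)) :
    IsTemperedFun N (weightedAverage w f) := by
  have h := integrable_weighted (k := fun y => (polyWeight N y : ℂ)) (C := 1) hav hf hw hwb
    (Complex.continuous_ofReal.comp (continuous_polyWeight N)) (fun y => by
      rw [Complex.norm_real, Real.norm_of_nonneg (polyWeight_pos N y).le, one_mul]) 0
  refine (h.integral_prod_left).congr (Eventually.of_forall fun y => ?_)
  simp only [zero_sub]
  rw [weightedAverage, ← integral_smul]
  refine integral_congr_ae (Eventually.of_forall fun v => ?_)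
  simp only [Complex.real_smul, polyWeight, norm_neg]
  ring

/-- Fubini's theorem brings the block of an average into the form of `f` integrated over phase
space, which is the form in which the equation can be tested. -/
lemma kernelConv_weightedAverage (hav : Integrable fun z : Phase d =>
      f z * (((1 + ‖z.1‖) ^ (-(N : ℤ)) * |z.2| ^ (μ - 1) : ℝ) : ℂ))
    (hf : AEStronglyMeasurable f volume) (hw : Measurable w) (hwb : ∀ v, |w v| ≤ |v| ^ (μ - 1))
    (hk : Continuous k) (hkb : ∀ y, ‖k y‖ ≤ C * polyWeight N y) (y : SpaceTime d) :
    kernelConv volume k id (weightedAverage w f) y =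
      ∫ z : Phase d, f z * ((w z.2 : ℂ) * k (y - z.1)) := by
  have h := integrable_weighted hav hf hw hwb hk hkb y
  rw [Measure.volume_eq_prod, integral_prod _ (by rwa [← Measure.volume_eq_prod]), kernelConv]
  rw [← integral_sub_left_eq_self (fun x => k x * weightedAverage w f (y - id x)) volume y]
  refine integral_congr_ae (Eventually.of_forall fun x => ?_)
  simp only [id, sub_sub_cancel]
  rw [weightedAverage, ← integral_const_mul]
  refine integral_congr_ae (Eventually.of_forall fun v => ?_)
  simp only
  ring

/-- The contribution of small velocities is controlled through Hölder's inequality in `v`. -/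
lemma eLpNorm_lowAverage_le {ρ β δ : ℝ} (hμ : 1 ≤ μ) (hρ : 0 < ρ) (hβ : β.HolderConjugate (1 / ρ))
    (hδ : 0 < δ) (hf : AEStronglyMeasurable f volume) :
    eLpNorm (weightedAverage (lowWeight μ δ) f) (ENNReal.ofReal β) volume ≤
      ENNReal.ofReal (2 ^ (μ - 1) * 4 ^ ρ * δ ^ (μ - 1 + ρ)) *
        eLpNorm f (ENNReal.ofReal β) volume := by
  set K := 2 ^ (μ - 1) * 4 ^ ρ * δ ^ (μ - 1 + ρ) with hK
  have hβ0 : 0 < β := hβ.pos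
  have hβ1 : ENNReal.ofReal β ≠ 0 := by simpa using hβ0
  have hw : ∀ v, ‖(lowWeight μ δ v : ℂ)‖ₑ ≤
      (Metric.closedBall (0 : ℝ) (2 * δ)).indicator
        (fun _ => ENNReal.ofReal ((2 * δ) ^ (μ - 1))) v := fun v => by
    by_cases hv : v ∈ Metric.closedBall (0 : ℝ) (2 * δ)
    · rw [Set.indicator_of_mem hv, ← ofReal_norm, Complex.norm_real]
      refine ENNReal.ofReal_le_ofReal ((abs_lowWeight_le μ δ v).trans ?_)
      exact rpow_le_rpow (abs_nonneg _) (by simpa using hv) (by linarith)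
    · rw [Set.indicator_of_notMem hv, lowWeight_eq_zero μ hδ]
      · simp
      · have : 2 * δ < |v| := by simpa using hv
        exact this.le
  -- The weight is at most `(2δ)^(μ-1)` on an interval of length `4δ`, so its norm with the
  -- conjugate exponent `1/ρ` is at most `(2δ)^(μ-1) (4δ)^ρ`.
  have hW : (∫⁻ v, ‖(lowWeight μ δ v : ℂ)‖ₑ ^ (1 / ρ)) ^ (1 / (1 / ρ)) ≤ ENNReal.ofReal K := by
    rw [one_div_one_div]
    calc _ ≤ (∫⁻ v, (Metric.closedBall (0 : ℝ) (2 * δ)).indicator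
          (fun _ => ENNReal.ofReal ((2 * δ) ^ (μ - 1)) ^ (1 / ρ)) v) ^ ρ := by
          gcongr with v
          refine (ENNReal.rpow_le_rpow (hw v) (by positivity)).trans (le_of_eq ?_)
          by_cases hv : v ∈ Metric.closedBall (0 : ℝ) (2 * δ)
          · rw [Set.indicator_of_mem hv, Set.indicator_of_mem hv]
          · rw [Set.indicator_of_notMem hv, Set.indicator_of_notMem hv,
              ENNReal.zero_rpow_of_pos (by positivity)]
      _ = (ENNReal.ofReal ((2 * δ) ^ (μ - 1)) ^ (1 / ρ) * ENNReal.ofReal (4 * δ)) ^ ρ := by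
          rw [lintegral_indicator_const measurableSet_closedBall, Real.volume_closedBall]
          congr 3; ring
      _ = ENNReal.ofReal ((2 * δ) ^ (μ - 1)) * ENNReal.ofReal ((4 * δ) ^ ρ) := by
          rw [ENNReal.mul_rpow_of_nonneg _ _ hρ.le, ← ENNReal.rpow_mul,
            one_div_mul_cancel hρ.ne', ENNReal.rpow_one, ENNReal.ofReal_rpow_of_pos (by positivity)]
      _ = ENNReal.ofReal K := by
          rw [← ENNReal.ofReal_mul (by positivity), hK, mul_rpow (by norm_num) hδ.le,
            mul_rpow (by norm_num) hδ.le, rpow_add hδ]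
          congr 1; ring
      _ ≤ _ := le_rfl
  rw [eLpNorm_eq_lintegral_rpow_enorm_toReal hβ1 ENNReal.ofReal_ne_top,
    eLpNorm_eq_lintegral_rpow_enorm_toReal hβ1 ENNReal.ofReal_ne_top, ENNReal.toReal_ofReal hβ0.le]
  have hslice : ∀ᵐ y : SpaceTime d, AEStronglyMeasurable (fun v => f (y, v)) volume := by
    have : AEStronglyMeasurable f ((volume : Measure (SpaceTime d)).prod volume) := hf
    exact this.prodMk_left
  calc _ ≤ (∫⁻ y, ENNReal.ofReal K ^ β * ∫⁻ v, ‖f (y, v)‖ₑ ^ β) ^ (1 / β) := by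
        refine ENNReal.rpow_le_rpow (lintegral_mono_ae ?_) (by positivity)
        filter_upwards [hslice] with y hy
        have h1 : ‖weightedAverage (lowWeight μ δ) f y‖ₑ ≤
            (∫⁻ v, ‖f (y, v)‖ₑ ^ β) ^ (1 / β) * ENNReal.ofReal K := by
          refine (enorm_integral_le_lintegral_enorm _).trans ?_
          simp_rw [enorm_mul]
          refine (ENNReal.lintegral_mul_le_Lp_mul_Lq volume hβ hy.enorm
            (Complex.measurable_ofReal.comp
              (measurable_lowWeight μ δ)).enorm.aemeasurable).trans ?_
          exact mul_le_mul_right hW _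
        calc _ ≤ ((∫⁻ v, ‖f (y, v)‖ₑ ^ β) ^ (1 / β) * ENNReal.ofReal K) ^ β := by gcongr
          _ = _ := by
            rw [ENNReal.mul_rpow_of_nonneg _ _ hβ0.le, ← ENNReal.rpow_mul,
              one_div_mul_cancel hβ0.ne', ENNReal.rpow_one, mul_comm]
    _ = (ENNReal.ofReal K ^ β * ∫⁻ y, ∫⁻ v, ‖f (y, v)‖ₑ ^ β) ^ (1 / β) := by
        rw [lintegral_const_mul' _ _ (ENNReal.rpow_ne_top_of_nonneg hβ0.le ENNReal.ofReal_ne_top)]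
    _ = (ENNReal.ofReal K ^ β * ∫⁻ z, ‖f z‖ₑ ^ β) ^ (1 / β) := by
        rw [Measure.volume_eq_prod (SpaceTime d) ℝ,
          lintegral_prod (fun z : Phase d => ‖f z‖ₑ ^ β) (hf.enorm.pow_const β)]
    _ = _ := by
        rw [ENNReal.mul_rpow_of_nonneg _ _ (by positivity), ← ENNReal.rpow_mul,
          mul_one_div_cancel hβ0.ne', ENNReal.rpow_one]

end Weighted

lemma aestronglyMeasurable_phaseIntegral {f : Phase d → ℂ} (hf : AEStronglyMeasurable f volume)
    {w : ℝ → ℝ} (hw : Measurable w) {k : SpaceTime d → ℂ} (hk : Continuous k) :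
    AEStronglyMeasurable (fun y => ∫ z : Phase d, f z * ((w z.2 : ℂ) * k (y - z.1))) volume := by
  have h1 : AEStronglyMeasurable (fun q : SpaceTime d × Phase d =>
      f q.2 * ((w q.2.2 : ℂ) * k (q.1 - q.2.1))) (volume.prod volume) := by
    refine hf.comp_snd.mul (Measurable.aestronglyMeasurable ?_)
    refine Measurable.mul ?_ ?_
    · exact Complex.measurable_ofReal.comp (hw.comp (measurable_snd.comp measurable_snd))
    · have : Measurable fun q : SpaceTime d × Phase d => q.1 - q.2.1 := by fun_prop
      exact hk.measurable.comp this
  exact h1.integral_prod_right'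

variable {X : ℝ → ℝ} {φ : Space d → ℝ} {m : ℝ}

/-- The `L¹` bound for the contribution of large velocities. -/
theorem exists_lintegral_highAverage_le {s γ μ : ℝ} (hX : IsAdmissibleCutoff X s)
    (hφ : IsSpaceCutoff φ) (hm : 1 < m) (hμ : 1 ≤ μ) (hs₀ : 0 ≤ s) (hs₁ : s ≤ 1)
    (ha₁ : 0 ≤ s * (m - 1) + 2 - γ - μ) :
    ∃ C : ℝ≥0, ∀ (a c δ : ℝ), 0 < a → 0 < c → 0 < δ →
      ∀ (f : Phase d → ℂ) (g₀ g₁ : RadonMeasure d), IsKineticSolution m f g₀ g₁ →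
      LocallyIntegrable f volume → g₀.weightedTV (1 - γ) < ⊤ → g₁.weightedTV (-γ) < ⊤ →
      HasVelocityAverage μ f →
      ∫⁻ y, ‖kernelConv volume (blockKernel X φ a c) id
          (weightedAverage (highWeight μ δ) f) y‖ₑ ≤
        C * ENNReal.ofReal (a ^ (-(1 - s)) * c ^ (-(2 * s)) *
          δ ^ (-(s * (m - 1) + 2 - γ - μ))) *
          (g₀.weightedTV (1 - γ) + g₁.weightedTV (-γ)) := by
  obtain ⟨B, hB1, hB⟩ := exists_deriv_midWeight_le hμ
  obtain ⟨C, hC⟩ := exists_lintegral_cutoffAverage_le hX hφ hm hμ hs₀ hs₁ ha₁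
    (zero_le_one.trans hB1)
  refine ⟨C, fun a c δ ha hc hδ f g₀ g₁ h hf h₀ h₁ hav => ?_⟩
  have hfm := hf.aestronglyMeasurable
  obtain ⟨N, hav'⟩ := hav
  obtain ⟨D, hD0, hD⟩ := blockKernel_decay hX.1 hφ ha hc N
  have hk : Continuous (blockKernel X φ a c) := (contDiff_blockKernel hX.1 hφ ha hc).continuous
  simp_rw [fun y => kernelConv_weightedAverage hav' hfm (measurable_highWeight μ δ)
    (abs_highWeight_le μ δ) hk hD y]
  -- The additional cutoff at `|v| ∼ n + 1` makes the velocity support compact, as testing the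
  -- equation requires. The bounds do not depend on `n`, and Fatou's lemma removes it.
  set F : ℕ → SpaceTime d → ℂ := fun n y => ∫ z : Phase d, f z *
    ((midWeight μ δ (n + 1) z.2 : ℂ) * blockKernel X φ a c (y - z.1)) with hF
  have hlim : ∀ y, Tendsto (fun n => F n y) atTop (𝓝 (∫ z : Phase d, f z *
      ((highWeight μ δ z.2 : ℂ) * blockKernel X φ a c (y - z.1)))) := fun y => by
    have hdom := integrable_weighted hav' hfm (w := fun v => |v| ^ (μ - 1))
      (measurable_id.abs.pow_const _) (fun v => by rw [abs_of_nonneg (by positivity)]) hk hD y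
    refine tendsto_integral_of_dominated_convergence _ (fun n => ?_) hdom.norm
      (fun n => Eventually.of_forall fun z => ?_) (Eventually.of_forall fun z => ?_)
    · exact (integrable_weighted hav' hfm (measurable_midWeight μ δ (n + 1))
        (abs_midWeight_le μ δ (n + 1)) hk hD y).aestronglyMeasurable
    · rw [norm_mul, norm_mul, norm_mul, norm_mul, Complex.norm_real, Complex.norm_real,
        Real.norm_eq_abs, Real.norm_of_nonneg (by positivity)]
      gcongr
      exact abs_midWeight_le _ _ _ _
    · refine tendsto_const_nhds.congr' ?_
      obtain ⟨n₀, hn₀⟩ := exists_nat_gt |z.2|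
      filter_upwards [eventually_ge_atTop n₀] with n hn
      have hn' : (n₀ : ℝ) ≤ n := by exact_mod_cast hn
      rw [midWeight, vBump_eq_one, mul_one]
      rw [abs_div, abs_of_pos (by positivity : (0 : ℝ) < n + 1)]
      exact div_le_one_of_le₀ (by linarith) (by positivity)
  calc _ = ∫⁻ y, liminf (fun n => ‖F n y‖ₑ) atTop :=
        lintegral_congr fun y => ((hlim y).enorm.liminf_eq).symm
    _ ≤ liminf (fun n => ∫⁻ y, ‖F n y‖ₑ) atTop :=
        lintegral_liminf_le' fun n => (aestronglyMeasurable_phaseIntegral hfm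
          (measurable_midWeight μ δ (n + 1)) hk).enorm
    _ ≤ _ := by
        refine liminf_le_of_le (by isBoundedDefault) fun b hb => ?_
        obtain ⟨n, hn⟩ := hb.exists
        refine hn.trans (hC a c δ _ _ ha hc hδ (isVelocityCutoff_midWeight μ hδ
          (by positivity : (0 : ℝ) < n + 1)) (fun v => ?_) (fun v => hB _ _ _ hδ (by positivity))
          f g₀ g₁ h hf h₀ h₁ ⟨N, hav'⟩)
        exact (abs_midWeight_le _ _ _ _).trans (le_mul_of_one_le_left (by positivity) hB1)

end KineticAveraging

namespace KineticAveraging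

open Real FourierTransform Filter Topology

variable {d : ℕ}

/-- The exponents of the averaging lemma. -/
structure AveragingParameters (m γ μ ρ β s p κt κx : ℝ) : Prop where
  hm : 1 < m
  hμ₁ : 1 ≤ μ
  hρ₀ : 0 < ρ
  hβ : β.HolderConjugate (1 / ρ)
  hs : (μ - 2 + γ) / (m - 1) < s
  hs₀ : 0 ≤ s
  hs₁ : s ≤ 1
  hp : p = (s * (m - 1) + 1 - γ + ρ) / (ρ * μ + (1 - ρ) * (s * (m - 1) + 1 - γ))
  hκt : κt = (1 - s) * (μ - 1 + ρ) / (s * (m - 1) + 1 - γ + ρ)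
  hκx : κx = 2 * s * (μ - 1 + ρ) / (s * (m - 1) + 1 - γ + ρ)

/-! ### The weak-type estimate -/

/-- The choice of the velocity threshold balancing the two contributions. -/
lemma velocity_balance {a₀ a₁ β M X c₀ c₁ : ℝ} (ha₀ : 0 < a₀) (ha₁ : 0 < a₁) (hβ : 0 < β)
    (hM : 0 < M) (hX : 0 < X) (hc₀ : 0 ≤ c₀) : ∃ δ : ℝ, 0 < δ ∧
      (c₀ * δ ^ a₀ * X) ^ β + c₁ * (M * δ ^ (-a₁)) * X =
        (c₀ ^ β + c₁) * (X * M ^ (a₀ / (a₀ + a₁))) ^ (β * (a₀ + a₁) / (a₀ * β + a₁)) := by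
  set E := a₀ * β + a₁
  have hE : 0 < E := by positivity
  have hD : 0 < a₀ + a₁ := by positivity
  -- The solution of `δ^(a₀ β) X^β = M δ^(-a₁) X`, the equality of the two contributions up to
  -- constants.
  refine ⟨(M * X ^ (1 - β)) ^ (1 / E), by positivity, ?_⟩
  have hδ : ∀ x : ℝ, ((M * X ^ (1 - β)) ^ (1 / E)) ^ x = M ^ (x / E) * X ^ ((1 - β) * x / E) :=
    fun x => by
      rw [← rpow_mul (by positivity), mul_rpow hM.le (by positivity), ← rpow_mul hX.le]
      congr 2 <;> ring
  have e1 : (c₀ * ((M * X ^ (1 - β)) ^ (1 / E)) ^ a₀ * X) ^ β =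
      c₀ ^ β * (M ^ (a₀ * β / E) * X ^ (β * (a₀ + a₁) / E)) := by
    rw [hδ, mul_rpow (by positivity) hX.le, mul_rpow hc₀ (by positivity),
      mul_rpow (by positivity) (by positivity), ← rpow_mul hM.le, ← rpow_mul hX.le, mul_assoc,
      mul_assoc, ← rpow_add hX]
    congr 3
    · ring
    · field_simp; simp only [E]; ring
  have e2 : c₁ * (M * ((M * X ^ (1 - β)) ^ (1 / E)) ^ (-a₁)) * X =
      c₁ * (M ^ (a₀ * β / E) * X ^ (β * (a₀ + a₁) / E)) := by
    rw [hδ]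
    have m1 : M ^ (a₀ * β / E) = M * M ^ (-a₁ / E) := by
      rw [← rpow_one_add' hM.le]
      · congr 1; field_simp; simp only [E]; ring
      · have : 1 + -a₁ / E = a₀ * β / E := by field_simp; simp only [E]; ring
        rw [this]; positivity
    have x1 : X ^ (β * (a₀ + a₁) / E) = X ^ ((1 - β) * -a₁ / E) * X := by
      rw [← rpow_add_one hX.ne']
      congr 1; field_simp; simp only [E]; ring
    rw [m1, x1]; ring
  have e3 : (X * M ^ (a₀ / (a₀ + a₁))) ^ (β * (a₀ + a₁) / E) =
      M ^ (a₀ * β / E) * X ^ (β * (a₀ + a₁) / E) := by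
    rw [mul_rpow hX.le (by positivity), ← rpow_mul hM.le, mul_comm]
    congr 2
    field_simp
  rw [e1, e2, e3]; ring

lemma weakLpNorm_le_of_meas_le {p W : ℝ} (hp : 0 < p) {F : SpaceTime d → ℂ}
    (h : ∀ t : ℝ, 0 < t → volume {y | ENNReal.ofReal t < ‖F y‖ₑ} ≤ ENNReal.ofReal ((W / t) ^ p))
    (hW : 0 ≤ W) : weakLpNorm p F ≤ ENNReal.ofReal W := by
  refine iSup_le fun t => ?_
  rcases eq_or_ne t 0 with rfl | ht
  · simp
  have ht0 : 0 < (t : ℝ) := by positivity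
  have h1 := h t ht0
  rw [ENNReal.ofReal_coe_nnreal] at h1
  calc _ ≤ (t : ℝ≥0∞) * ENNReal.ofReal ((W / t) ^ p) ^ (1 / p) := by gcongr
    _ = ENNReal.ofReal W := by
        rw [← ENNReal.ofReal_rpow_of_nonneg (by positivity) hp.le, ← ENNReal.rpow_mul,
          mul_one_div_cancel hp.ne', ENNReal.rpow_one, ← ENNReal.ofReal_coe_nnreal,
          ← ENNReal.ofReal_mul ht0.le]
        congr 1
        field_simp

lemma kernelConv_low_add_high {μ δ : ℝ} {N : ℕ} {f : Phase d → ℂ} {k : SpaceTime d → ℂ} {C : ℝ}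
    (hav : Integrable fun z : Phase d =>
      f z * (((1 + ‖z.1‖) ^ (-(N : ℤ)) * |z.2| ^ (μ - 1) : ℝ) : ℂ))
    (hf : AEStronglyMeasurable f volume) (hk : Continuous k)
    (hkb : ∀ y, ‖k y‖ ≤ C * polyWeight N y) (y : SpaceTime d) :
    kernelConv volume k id (velocityAverage μ f) y =
      kernelConv volume k id (weightedAverage (lowWeight μ δ) f) y +
        kernelConv volume k id (weightedAverage (highWeight μ δ) f) y := by
  rw [velocityAverage_eq, kernelConv_weightedAverage (w := fun v => |v| ^ (μ - 1)) hav hf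
      (measurable_id.abs.pow_const _) (fun v => by rw [abs_of_nonneg (by positivity)]) hk hkb,
    kernelConv_weightedAverage hav hf (measurable_lowWeight μ δ) (abs_lowWeight_le μ δ) hk hkb,
    kernelConv_weightedAverage hav hf (measurable_highWeight μ δ) (abs_highWeight_le μ δ) hk hkb,
    ← integral_add
      (integrable_weighted hav hf (measurable_lowWeight μ δ) (abs_lowWeight_le μ δ) hk hkb y)
      (integrable_weighted hav hf (measurable_highWeight μ δ) (abs_highWeight_le μ δ) hk hkb y)]
  refine integral_congr_ae (Eventually.of_forall fun z => ?_)
  simp only [lowWeight, highWeight]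
  push_cast
  ring

namespace AveragingParameters

variable {m γ μ ρ β s p κt κx : ℝ}

/-- The lower bound on `s`, rewritten: it makes the large-velocity bound a negative power of `δ`. -/
lemma a₁_pos (h : AveragingParameters m γ μ ρ β s p κt κx) : 0 < s * (m - 1) + 2 - γ - μ := by
  have hm := h.hm
  have := h.hs
  rw [div_lt_iff₀ (by linarith)] at this
  linarith

lemma a₀_pos (h : AveragingParameters m γ μ ρ β s p κt κx) : 0 < μ - 1 + ρ := by
  linarith [h.hμ₁, h.hρ₀]

lemma inv_β (h : AveragingParameters m γ μ ρ β s p κt κx) : β * (1 - ρ) = 1 := by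
  have h1 := h.hβ.inv_add_inv_eq_one
  rw [one_div, inv_inv] at h1
  have : β⁻¹ = 1 - ρ := by linarith
  rw [← this, mul_inv_cancel₀ h.hβ.pos.ne']

/-- With `a₀`, `a₁` the exponents of the two bounds in `δ`, this reads `1/p = (a₀ + a₁/β) / (a₀ +
a₁)`: interpolation between `L¹` and `L^β`, and the exponent that `velocity_balance` produces. It
uses `β (1 - ρ) = 1`. -/
lemma p_eq (h : AveragingParameters m γ μ ρ β s p κt κx) :
    p = β * ((μ - 1 + ρ) + (s * (m - 1) + 2 - γ - μ)) /
      ((μ - 1 + ρ) * β + (s * (m - 1) + 2 - γ - μ)) := by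
  have hβ := h.inv_β
  have hβ0 := h.hβ.pos
  have h0 := h.a₀_pos
  have h1 := h.a₁_pos
  have e : (μ - 1 + ρ) * β + (s * (m - 1) + 2 - γ - μ) =
      β * (ρ * μ + (1 - ρ) * (s * (m - 1) + 1 - γ)) := by linear_combination (-(s * (m - 1) + 2 - γ - μ)) * hβ
  rw [e, mul_div_mul_left _ _ hβ0.ne', h.hp]
  congr 1; ring

lemma p_pos (h : AveragingParameters m γ μ ρ β s p κt κx) : 0 < p := by
  have hβ0 := h.hβ.pos
  have h0 := h.a₀_pos
  have h1 := h.a₁_pos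
  rw [h.p_eq]
  positivity

/-- The origin of `κt` and `κx`: they are the powers of `a` and `c` in the kernel bound, multiplied
by the interpolation parameter `a₀ / (a₀ + a₁)`. -/
lemma rpow_scale (h : AveragingParameters m γ μ ρ β s p κt κx) {a c : ℝ} (ha : 0 < a)
    (hc : 0 < c) : (a ^ (-(1 - s)) * c ^ (-(2 * s))) ^
      ((μ - 1 + ρ) / ((μ - 1 + ρ) + (s * (m - 1) + 2 - γ - μ))) = a ^ (-κt) * c ^ (-κx) := by
  have e : (μ - 1 + ρ) + (s * (m - 1) + 2 - γ - μ) = s * (m - 1) + 1 - γ + ρ := by ring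
  rw [mul_rpow (by positivity) (by positivity), ← rpow_mul ha.le, ← rpow_mul hc.le, e, h.hκt, h.hκx]
  congr 2 <;> ring

end AveragingParameters

variable {m γ μ ρ β s p κt κx : ℝ} {X : ℝ → ℝ} {φ : Space d → ℝ}

/-- The weak-type estimate for a frequency block of the velocity average. -/
theorem AveragingParameters.exists_weakLpNorm_le (h : AveragingParameters m γ μ ρ β s p κt κx)
    (hX : IsAdmissibleCutoff X s) (hφ : IsSpaceCutoff φ) :
    ∃ C : ℝ, 0 < C ∧ ∀ (a c : ℝ), 0 < a → 0 < c → ∀ (f : Phase d → ℂ) (g₀ g₁ : RadonMeasure d),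
      AveragingData m γ μ β f g₀ g₁ → ∀ A : ℝ, 0 < A → dataNorm γ β f g₀ g₁ ≤ ENNReal.ofReal A →
      weakLpNorm p (kernelConv volume (blockKernel X φ a c) id (velocityAverage μ f)) ≤
        ENNReal.ofReal (C * (A * (a ^ (-κt) * c ^ (-κx)))) := by
  obtain ⟨C₁, hC₁⟩ := exists_lintegral_highAverage_le (γ := γ) hX hφ h.hm h.hμ₁ h.hs₀ h.hs₁
    h.a₁_pos.le
  obtain ⟨C₀, hC₀⟩ := exists_lintegral_blockKernel_le hX.1 hφ
  have hp := h.p_pos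
  -- The constants of Young's and Hölder's inequalities; the `2` comes from the level `t / 2` given
  -- to each piece. The summand `1` in `K` only ensures positivity.
  set K₀ : ℝ := 2 * (C₀ * (2 ^ (μ - 1) * 4 ^ ρ)) with hK₀
  set K : ℝ := K₀ ^ β + 2 * C₁ + 1 with hK
  have hK0 : 0 < K := by positivity
  refine ⟨K ^ (1 / p), by positivity, fun a c ha hc f g₀ g₁ hd A hA hdA => ?_⟩
  have hβ0 := h.hβ.pos
  have hβ1 : ENNReal.ofReal β ≠ 0 := by simpa using hβ0
  have hβ2 : 1 ≤ ENNReal.ofReal β := by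
    rw [← ENNReal.ofReal_one]; exact ENNReal.ofReal_le_ofReal h.hβ.lt.le
  have hfm := hd.memLp.1
  have hloc := hd.memLp.locallyIntegrable hβ2
  obtain ⟨N, hav⟩ := hd.average
  obtain ⟨D, hD0, hD⟩ := blockKernel_decay hX.1 hφ ha hc N
  have hk : Continuous (blockKernel X φ a c) := (contDiff_blockKernel hX.1 hφ ha hc).continuous
  have hfA : eLpNorm f (ENNReal.ofReal β) volume ≤ ENNReal.ofReal A :=
    le_add_self.trans hdA
  have hgA : g₀.weightedTV (1 - γ) + g₁.weightedTV (-γ) ≤ ENNReal.ofReal A :=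
    le_self_add.trans hdA
  set M := a ^ (-(1 - s)) * c ^ (-(2 * s)) with hM
  have hM0 : 0 < M := by positivity
  refine weakLpNorm_le_of_meas_le hp (fun t ht => ?_) (by positivity)
  -- The threshold depends on the level `t` through `A / t`; the splitting changes from level to
  -- level, and the conclusion is a weak-type bound.
  obtain ⟨δ, hδ, hbal⟩ := velocity_balance (c₁ := 2 * C₁) h.a₀_pos h.a₁_pos hβ0 hM0 (div_pos hA ht)
    (by positivity : 0 ≤ K₀)
  set F₀ := kernelConv volume (blockKernel X φ a c) id (weightedAverage (lowWeight μ δ) f)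
  set F₁ := kernelConv volume (blockKernel X φ a c) id (weightedAverage (highWeight μ δ) f)
  have hF₀m : AEStronglyMeasurable F₀ volume :=
    (aestronglyMeasurable_phaseIntegral hfm (measurable_lowWeight μ δ) hk).congr
      (Eventually.of_forall fun y => (kernelConv_weightedAverage hav hfm
        (measurable_lowWeight μ δ) (abs_lowWeight_le μ δ) hk hD y).symm)
  have hF₁m : AEStronglyMeasurable F₁ volume :=
    (aestronglyMeasurable_phaseIntegral hfm (measurable_highWeight μ δ) hk).congr
      (Eventually.of_forall fun y => (kernelConv_weightedAverage hav hfm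
        (measurable_highWeight μ δ) (abs_highWeight_le μ δ) hk hD y).symm)
  have hF₀ : eLpNorm F₀ (ENNReal.ofReal β) volume ≤
      ENNReal.ofReal (C₀ * (2 ^ (μ - 1) * 4 ^ ρ) * δ ^ (μ - 1 + ρ) * A) := by
    refine (eLpNorm_conv_le hk.aestronglyMeasurable
      (isTemperedFun_weightedAverage hav hfm (measurable_lowWeight μ δ)
        (abs_lowWeight_le μ δ)).aestronglyMeasurable hβ2).trans ?_
    calc _ ≤ (C₀ : ℝ≥0∞) * (ENNReal.ofReal (2 ^ (μ - 1) * 4 ^ ρ * δ ^ (μ - 1 + ρ)) *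
          ENNReal.ofReal A) := by
          gcongr
          · exact hC₀ a c ha hc
          · exact (eLpNorm_lowAverage_le h.hμ₁ h.hρ₀ h.hβ hδ hfm).trans (by gcongr)
      _ = _ := by
          rw [← ENNReal.ofReal_coe_nnreal, ← ENNReal.ofReal_mul (by positivity),
            ← ENNReal.ofReal_mul (by positivity)]
          congr 1; ring
  have hF₁ : ∫⁻ y, ‖F₁ y‖ₑ ≤
      ENNReal.ofReal (C₁ * (M * δ ^ (-(s * (m - 1) + 2 - γ - μ))) * A) := by
    refine (hC₁ a c δ ha hc hδ f g₀ g₁ hd.solution hloc hd.finite_g₀ hd.finite_g₁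
      hd.average).trans ?_
    calc _ ≤ (C₁ : ℝ≥0∞) * ENNReal.ofReal (M * δ ^ (-(s * (m - 1) + 2 - γ - μ))) *
          ENNReal.ofReal A := by gcongr
      _ = _ := by
          rw [← ENNReal.ofReal_coe_nnreal, ← ENNReal.ofReal_mul (by positivity),
            ← ENNReal.ofReal_mul (by positivity)]
  have ht2 : 0 < t / 2 := by positivity
  have ht2' : ENNReal.ofReal (t / 2) ≠ 0 := by simpa using ht
  -- One of the two pieces must reach `t / 2`. Chebyshev's inequality is then used in `L^β` for the
  -- small velocities and in `L¹` for the large ones.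
  have hsub : {y | ENNReal.ofReal t <
      ‖kernelConv volume (blockKernel X φ a c) id (velocityAverage μ f) y‖ₑ} ⊆
      {y | ENNReal.ofReal (t / 2) ≤ ‖F₀ y‖ₑ} ∪ {y | ENNReal.ofReal (t / 2) ≤ ‖F₁ y‖ₑ} := by
    intro y hy
    by_contra hcon
    simp only [Set.mem_union, Set.mem_ofPred_eq, not_or, not_le] at hcon hy
    rw [kernelConv_low_add_high (δ := δ) hav hfm hk hD] at hy
    have h1 := (hy.trans_le (enorm_add_le _ _)).trans (ENNReal.add_lt_add hcon.1 hcon.2)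
    rw [← ENNReal.ofReal_add ht2.le ht2.le, add_halves] at h1
    exact lt_irrefl _ h1
  have m₀ : volume {y | ENNReal.ofReal (t / 2) ≤ ‖F₀ y‖ₑ} ≤
      ENNReal.ofReal ((K₀ * δ ^ (μ - 1 + ρ) * (A / t)) ^ β) := by
    refine (meas_ge_le_mul_pow_eLpNorm_enorm volume hβ1 ENNReal.ofReal_ne_top hF₀m ht2'
      (fun h => absurd h ENNReal.ofReal_ne_top)).trans ?_
    rw [ENNReal.toReal_ofReal hβ0.le, ← ENNReal.mul_rpow_of_nonneg _ _ hβ0.le]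
    calc _ ≤ ((ENNReal.ofReal (t / 2))⁻¹ *
          ENNReal.ofReal (C₀ * (2 ^ (μ - 1) * 4 ^ ρ) * δ ^ (μ - 1 + ρ) * A)) ^ β := by gcongr
      _ = _ := by
          rw [← ENNReal.ofReal_inv_of_pos ht2, ← ENNReal.ofReal_mul (by positivity),
            ENNReal.ofReal_rpow_of_nonneg (by positivity) hβ0.le]
          congr 2
          rw [hK₀]; field_simp
  have m₁ : volume {y | ENNReal.ofReal (t / 2) ≤ ‖F₁ y‖ₑ} ≤
      ENNReal.ofReal (2 * C₁ * (M * δ ^ (-(s * (m - 1) + 2 - γ - μ))) * (A / t)) := by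
    refine (meas_ge_le_lintegral_div hF₁m.enorm ht2' ENNReal.ofReal_ne_top).trans ?_
    calc _ ≤ ENNReal.ofReal (C₁ * (M * δ ^ (-(s * (m - 1) + 2 - γ - μ))) * A) /
          ENNReal.ofReal (t / 2) := by gcongr
      _ = _ := by
          rw [← ENNReal.ofReal_div_of_pos ht2]
          congr 1; field_simp
  calc _ ≤ ENNReal.ofReal ((K₀ * δ ^ (μ - 1 + ρ) * (A / t)) ^ β) +
        ENNReal.ofReal (2 * C₁ * (M * δ ^ (-(s * (m - 1) + 2 - γ - μ))) * (A / t)) :=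
        (measure_mono hsub).trans ((measure_union_le _ _).trans (add_le_add m₀ m₁))
    _ = ENNReal.ofReal ((K₀ ^ β + 2 * C₁) * (A / t * (a ^ (-κt) * c ^ (-κx))) ^ p) := by
        rw [← ENNReal.ofReal_add (by positivity) (by positivity), hbal, ← h.p_eq,
          h.rpow_scale ha hc]
    _ ≤ ENNReal.ofReal (K * (A / t * (a ^ (-κt) * c ^ (-κx))) ^ p) := by
        gcongr
        linarith
    _ = _ := by
        congr 1
        rw [show K ^ (1 / p) * (A * (a ^ (-κt) * c ^ (-κx))) / t =
          K ^ (1 / p) * (A / t * (a ^ (-κt) * c ^ (-κx))) by ring,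
          mul_rpow (x := K ^ (1 / p)) (by positivity) (by positivity), ← rpow_mul hK0.le, one_div_mul_cancel hp.ne', rpow_one]

end KineticAveraging

namespace KineticAveraging

open Real FourierTransform Filter Topology

variable {d : ℕ}

/-! ### Frequency blocks as convolutions -/

lemma isMomentKernel_schwartz {E V : Type*} [NormedAddCommGroup E] [InnerProductSpace ℝ E]
    [FiniteDimensional ℝ E] [MeasurableSpace E] [BorelSpace E] [NormedAddCommGroup V]
    [MeasurableSpace V] (κ : 𝓢(E, ℂ)) {ι : E → V} (hι : Measurable ι) (hn : ∀ x, ‖ι x‖ = ‖x‖) :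
    IsMomentKernel volume κ ι where
  measurable := hι
  aesm := κ.continuous.aestronglyMeasurable
  moments N := by
    simp_rw [hn]
    have h1 := (κ.integrable_pow_mul volume N).add (κ.integrable_pow_mul volume 0)
    have h2 := h1.const_mul (2 ^ (N - 1))
    refine h2.mono' ?_ (Eventually.of_forall fun x => ?_)
    · exact ((continuous_const.add continuous_norm).pow N).aestronglyMeasurable.mul
        κ.continuous.norm.aestronglyMeasurable
    · rw [Real.norm_of_nonneg (by positivity), Pi.add_apply, ← add_mul, ← mul_assoc]
      gcongr
      have := add_pow_le (zero_le_one' ℝ) (norm_nonneg x) N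
      rw [one_pow] at this
      rw [pow_zero, add_comm (‖x‖ ^ N)]
      exact this

section Block

variable {X : ℝ → ℝ} {φ : Space d → ℝ} {a c : ℝ}

lemma exists_schwartz_blockKernel (hX : IsTimeCutoff X) (hφ : IsSpaceCutoff φ) (ha : 0 < a)
    (hc : 0 < c) : ∃ κ : 𝓢(SpaceTime d, ℂ), blockKernel X φ a c = κ ∧
      blockSymbol X φ a c = (𝓕 κ : 𝓢(SpaceTime d, ℂ)) := by
  obtain ⟨R, hR⟩ := isSymbolFamily_blockSymbol hX hφ ha hc
  set m : 𝓢(SpaceTime d, ℂ) := (hR.hasCompactSupport 0).toSchwartzMap (hR.contDiff 0)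
  refine ⟨𝓕⁻ m, ?_, ?_⟩
  · rw [SchwartzMap.fourierInv_coe]; rfl
  · rw [FourierTransform.fourier_fourierInv_eq]; rfl

lemma isMomentKernel_blockKernel (hX : IsTimeCutoff X) (hφ : IsSpaceCutoff φ) (ha : 0 < a)
    (hc : 0 < c) : IsMomentKernel volume (blockKernel X φ a c) id := by
  obtain ⟨κ, h, -⟩ := exists_schwartz_blockKernel hX hφ ha hc
  rw [h]
  exact isMomentKernel_schwartz κ measurable_id fun _ => rfl

lemma blockSymbol_eq_integral (hX : IsTimeCutoff X) (hφ : IsSpaceCutoff φ) (ha : 0 < a)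
    (hc : 0 < c) (w : SpaceTime d) :
    blockSymbol X φ a c w = ∫ x, 𝐞 (-(inner ℝ (id x) w)) • blockKernel X φ a c x := by
  obtain ⟨κ, h, h'⟩ := exists_schwartz_blockKernel hX hφ ha hc
  rw [h, h', SchwartzMap.fourier_coe, Real.fourier_eq]
  rfl

lemma hasTemperateGrowth_blockSymbol (hX : IsTimeCutoff X) (hφ : IsSpaceCutoff φ) (ha : 0 < a)
    (hc : 0 < c) : (blockSymbol X φ a c).HasTemperateGrowth := by
  obtain ⟨κ, -, h⟩ := exists_schwartz_blockKernel hX hφ ha hc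
  rw [h]
  exact SchwartzMap.hasTemperateGrowth _

end Block

lemma DyadicPartition.isSpaceCutoff (P : DyadicPartition d) : IsSpaceCutoff P.φ :=
  ⟨P.smooth_φ, P.support_φ⟩

lemma DyadicPartition.isTimeCutoff (P : DyadicPartition d) : IsTimeCutoff P.η where
  smooth := P.smooth_η
  vanish τ hτ := by
    by_contra h
    exact absurd (P.support_η h).2 (not_le.2 hτ)

lemma DyadicPartition.isAdmissibleCutoff (P : DyadicPartition d) (s : ℝ) :
    IsAdmissibleCutoff P.η s := by
  refine ⟨P.isTimeCutoff, Or.inl fun τ hτ => ?_⟩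
  by_contra h
  exact absurd (P.support_η h).1 (not_le.2 hτ)

lemma DyadicPartition.block_eq (P : DyadicPartition d) (l j : ℤ) (u : 𝓢'(SpaceTime d, ℂ)) :
    P.block l j u = TemperedDistribution.fourierMultiplierCLM ℂ
      (blockSymbol P.η P.φ (2 ^ l) (2 ^ j)) u := by
  rw [DyadicPartition.block]
  congr 2
  funext w
  have e1 : (2 : ℝ) ^ (-l) * (2 * π * w.fst) = 2 * π / 2 ^ l * w.fst := by rw [zpow_neg]; ring
  have e2 : (2 : ℝ) ^ (-j) • ((2 * π) • w.snd) = (2 * π / 2 ^ j) • w.snd := by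
    rw [smul_smul, zpow_neg]; congr 1; ring
  rw [e1, e2]
  rfl

lemma DyadicPartition.isRepresentedBy_block (P : DyadicPartition d) (l j : ℤ) {N : ℕ}
    {h : SpaceTime d → ℂ} (hh : IsTemperedFun N h) {u : 𝓢'(SpaceTime d, ℂ)}
    (hu : IsRepresentedBy u h) : IsRepresentedBy (P.block l j u)
      (kernelConv volume (blockKernel P.η P.φ (2 ^ l) (2 ^ j)) id h) := by
  have hl : (0 : ℝ) < 2 ^ l := by positivity
  have hj : (0 : ℝ) < 2 ^ j := by positivity
  rw [P.block_eq]
  exact (isMomentKernel_blockKernel P.isTimeCutoff P.isSpaceCutoff hl hj).isRepresentedBy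
    (blockSymbol_eq_integral P.isTimeCutoff P.isSpaceCutoff hl hj)
    (hasTemperateGrowth_blockSymbol P.isTimeCutoff P.isSpaceCutoff hl hj) hh hu

/-! ### The estimates in spaces with dominating mixed derivatives -/

lemma isTemperedFun_velocityAverage {m γ μ β : ℝ} {f : Phase d → ℂ} {g₀ g₁ : RadonMeasure d}
    (hd : AveragingData m γ μ β f g₀ g₁) : ∃ N, IsTemperedFun N (velocityAverage μ f) := by
  obtain ⟨N, hav⟩ := hd.average
  exact ⟨N, isTemperedFun_weightedAverage hav hd.memLp.1
    (w := fun v => |v| ^ (μ - 1)) (measurable_id.abs.pow_const _)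
    (fun v => by rw [abs_of_nonneg (by positivity)])⟩

lemma dataNorm_lt_top {m γ μ β : ℝ} {f : Phase d → ℂ} {g₀ g₁ : RadonMeasure d}
    (hd : AveragingData m γ μ β f g₀ g₁) : dataNorm γ β f g₀ g₁ < ⊤ :=
  ENNReal.add_lt_top.2 ⟨ENNReal.add_lt_top.2 ⟨hd.finite_g₀, hd.finite_g₁⟩, hd.memLp.2⟩

/-- The weak and interpolated bounds are stated with a positive real `A`, whereas the norm of the
data may be `0`. Letting `A` decrease to the norm recovers the linear estimate. -/
lemma le_mul_of_forall_real_bound {S D : ℝ≥0∞} {C : ℝ} (hC : 0 < C) (hD : D < ⊤)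
    (h : ∀ A : ℝ, 0 < A → D ≤ ENNReal.ofReal A → S ≤ ENNReal.ofReal (C * A)) :
    S ≤ C.toNNReal * D := by
  refine ENNReal.le_of_forall_pos_le_add fun ε hε _ => ?_
  have hε' : 0 < (ε : ℝ) := hε
  have hA : 0 < D.toReal + ε / C := add_pos_of_nonneg_of_pos ENNReal.toReal_nonneg (by positivity)
  refine (h _ hA ?_).trans (le_of_eq ?_)
  · rw [← ENNReal.ofReal_toReal hD.ne]
    refine ENNReal.ofReal_le_ofReal ?_
    rw [ENNReal.toReal_ofReal ENNReal.toReal_nonneg]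
    linarith [div_pos hε' hC]
  · rw [mul_add, mul_div_cancel₀ _ hC.ne', ENNReal.ofReal_add (by positivity) hε'.le,
      ENNReal.ofReal_mul hC.le, ENNReal.ofReal_toReal hD.ne, ENNReal.ofReal_coe_nnreal]
    rfl

lemma two_rpow_mul_scale {σ C : ℝ} (l : ℤ) :
    (2 : ℝ≥0∞) ^ (σ * l) * ENNReal.ofReal (C * ((2 : ℝ) ^ l) ^ (-σ)) = ENNReal.ofReal C := by
  have h2 : (2 : ℝ≥0∞) ^ (σ * l) = ENNReal.ofReal ((2 : ℝ) ^ (σ * l)) := by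
    rw [← ENNReal.ofReal_rpow_of_pos two_pos, ENNReal.ofReal_ofNat]
  have h3 : ((2 : ℝ) ^ l) ^ (-σ) = ((2 : ℝ) ^ (σ * l))⁻¹ := by
    rw [← rpow_intCast, ← rpow_mul two_pos.le, ← rpow_neg two_pos.le]
    congr 1; ring
  rw [h2, h3, ← ENNReal.ofReal_mul (by positivity)]
  congr 1
  field_simp

lemma scaled_le {σt σx C : ℝ} {S : ℝ≥0∞} (l j : ℤ)
    (h : S ≤ ENNReal.ofReal (C * (((2 : ℝ) ^ l) ^ (-σt) * ((2 : ℝ) ^ j) ^ (-σx)))) :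
    (2 : ℝ≥0∞) ^ (σt * l) * (2 : ℝ≥0∞) ^ (σx * j) * S ≤ ENNReal.ofReal C := by
  calc _ ≤ (2 : ℝ≥0∞) ^ (σt * l) * ((2 : ℝ≥0∞) ^ (σx * j) *
        ENNReal.ofReal (C * (((2 : ℝ) ^ l) ^ (-σt) * ((2 : ℝ) ^ j) ^ (-σx)))) := by
        rw [mul_assoc]; gcongr
    _ = _ := by rw [← mul_assoc C, two_rpow_mul_scale, two_rpow_mul_scale]

variable {m γ μ ρ β s p κt κx : ℝ}

theorem AveragingParameters.exists_weakBesovNorm_le (h : AveragingParameters m γ μ ρ β s p κt κx)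
    (P : DyadicPartition d) : ∃ C : ℝ≥0, ∀ (f : Phase d → ℂ) (g₀ g₁ : RadonMeasure d),
      AveragingData m γ μ β f g₀ g₁ →
        P.weakBesovNorm κt κx p (velocityAverage μ f) ≤ C * dataNorm γ β f g₀ g₁ := by
  obtain ⟨C, hC0, hC⟩ := h.exists_weakLpNorm_le (P.isAdmissibleCutoff s) P.isSpaceCutoff
  refine ⟨C.toNNReal, fun f g₀ g₁ hd => ?_⟩
  obtain ⟨N, hN⟩ := isTemperedFun_velocityAverage hd
  obtain ⟨u, hu⟩ := hN.exists_isRepresentedBy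
  refine le_mul_of_forall_real_bound hC0 (dataNorm_lt_top hd) fun A hA hdA => ?_
  refine (iInf₂_le u hu).trans (iSup₂_le fun l j => scaled_le l j ?_)
  refine (iInf₂_le _ (P.isRepresentedBy_block l j hN hu)).trans ?_
  rw [mul_assoc]
  exact hC (2 ^ l) (2 ^ j) (by positivity) (by positivity) f g₀ g₁ hd A hA hdA

lemma InterpolationExponents.one_lt {r q : ℝ≥0∞} {ϑ : ℝ} (hp : 1 ≤ p)
    (h : InterpolationExponents p r q ϑ) : 1 < q := by
  refine lt_of_le_of_lt (le_min ?_ h.one_le) h.lower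
  rw [← ENNReal.ofReal_one]
  exact ENNReal.ofReal_le_ofReal hp

/-- `p` lies between `1` and `β`. Together with `r ≥ 1` this gives `q > 1`, so Young's inequality is
available in `L^q`. -/
lemma AveragingParameters.one_le_p (h : AveragingParameters m γ μ ρ β s p κt κx) : 1 ≤ p := by
  have hβ := h.hβ.lt
  have h0 := h.a₀_pos
  have h1 := h.a₁_pos
  have hβ0 := h.hβ.pos
  rw [h.p_eq, one_le_div (by positivity)]
  nlinarith

/-- The strong-type estimate for a frequency block of the velocity average. -/
theorem AveragingParameters.exists_eLpNorm_le (h : AveragingParameters m γ μ ρ β s p κt κx)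
    {X : ℝ → ℝ} {φ : Space d → ℝ} (hX : IsAdmissibleCutoff X s) (hφ : IsSpaceCutoff φ)
    {r q : ℝ≥0∞} {ϑ : ℝ} (hi : InterpolationExponents p r q ϑ) :
    ∃ C : ℝ, 0 < C ∧ ∀ (a c : ℝ), 0 < a → 0 < c → ∀ (f : Phase d → ℂ) (g₀ g₁ : RadonMeasure d),
      AveragingData m γ μ β f g₀ g₁ → ∀ A : ℝ, 0 < A →
      dataNorm γ β f g₀ g₁ + eLpNorm (velocityAverage μ f) r volume ≤ ENNReal.ofReal A →
      eLpNorm (kernelConv volume (blockKernel X φ a c) id (velocityAverage μ f)) q volume ≤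
        ENNReal.ofReal (C * A * (a ^ (-(ϑ * κt)) * c ^ (-(ϑ * κx)))) := by
  obtain ⟨C₁, hC₁0, hC₁⟩ := h.exists_weakLpNorm_le hX hφ
  obtain ⟨C₂, hC₂0, hC₂⟩ := exists_eLpNorm_le_of_weakLpNorm (d := d) hi h.p_pos
  obtain ⟨C₀, hC₀⟩ := exists_lintegral_blockKernel_le hX.1 hφ
  refine ⟨C₂ * (C₁ ^ ϑ * (C₀ + 1 : ℝ) ^ (1 - ϑ)), by positivity,
    fun a c ha hc f g₀ g₁ hd A hA hdA => ?_⟩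
  obtain ⟨N, hN⟩ := isTemperedFun_velocityAverage hd
  have hk : Continuous (blockKernel X φ a c) := (contDiff_blockKernel hX.1 hφ ha hc).continuous
  have hFm := ((isMomentKernel_blockKernel hX.1 hφ ha hc).isTemperedFun_kernelConv
    hN).aestronglyMeasurable
  have hW := hC₁ a c ha hc f g₀ g₁ hd A hA (le_self_add.trans hdA)
  -- Blocks are bounded on `L^r` uniformly in `a` and `c`, by Young's inequality; adding `1` to `C₀`
  -- keeps the constant positive for the interpolation.
  have hB : eLpNorm (kernelConv volume (blockKernel X φ a c) id (velocityAverage μ f)) r volume ≤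
      ENNReal.ofReal ((C₀ + 1 : ℝ) * A) := by
    refine (eLpNorm_conv_le hk.aestronglyMeasurable hN.aestronglyMeasurable hi.one_le).trans ?_
    rw [ENNReal.ofReal_mul (by positivity)]
    gcongr
    · refine (hC₀ a c ha hc).trans ?_
      rw [← ENNReal.ofReal_coe_nnreal]
      exact ENNReal.ofReal_le_ofReal (by linarith)
    · exact le_add_self.trans hdA
  refine (hC₂ _ hFm _ _ (by positivity) (by positivity) hW hB).trans (le_of_eq ?_)
  congr 1
  have hϑ := hi.lt_one
  rw [mul_rpow hC₁0.le (by positivity), mul_rpow hA.le (by positivity),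
    mul_rpow (by positivity) (by positivity), mul_rpow (by positivity) hA.le,
    ← rpow_mul ha.le, ← rpow_mul hc.le]
  have hAA : A ^ ϑ * A ^ (1 - ϑ) = A := by rw [← rpow_add hA]; simp
  calc _ = C₂ * (C₁ ^ ϑ * (C₀ + 1 : ℝ) ^ (1 - ϑ)) * (A ^ ϑ * A ^ (1 - ϑ)) *
        (a ^ (-κt * ϑ) * c ^ (-κx * ϑ)) := by ring
    _ = _ := by rw [hAA, neg_mul, neg_mul, mul_comm κt, mul_comm κx]

theorem AveragingParameters.exists_besovNorm_le (h : AveragingParameters m γ μ ρ β s p κt κx)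
    (P : DyadicPartition d) {r q : ℝ≥0∞} {ϑ : ℝ} (hi : InterpolationExponents p r q ϑ) :
    ∃ C : ℝ≥0, ∀ (f : Phase d → ℂ) (g₀ g₁ : RadonMeasure d),
      AveragingData m γ μ β f g₀ g₁ → MemLp (velocityAverage μ f) r volume →
        P.besovNorm (ϑ * κt) (ϑ * κx) q (velocityAverage μ f) ≤
          C * (dataNorm γ β f g₀ g₁ + eLpNorm (velocityAverage μ f) r volume) := by
  obtain ⟨C, hC0, hC⟩ := h.exists_eLpNorm_le (P.isAdmissibleCutoff s) P.isSpaceCutoff hi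
  refine ⟨C.toNNReal, fun f g₀ g₁ hd hr => ?_⟩
  obtain ⟨N, hN⟩ := isTemperedFun_velocityAverage hd
  obtain ⟨u, hu⟩ := hN.exists_isRepresentedBy
  refine le_mul_of_forall_real_bound hC0
    (ENNReal.add_lt_top.2 ⟨dataNorm_lt_top hd, hr.2⟩) fun A hA hdA => ?_
  refine (iInf₂_le u hu).trans (iSup₂_le fun l j => scaled_le l j ?_)
  refine (iInf₂_le _ (P.isRepresentedBy_block l j hN hu)).trans ?_
  exact hC (2 ^ l) (2 ^ j) (by positivity) (by positivity) f g₀ g₁ hd A hA hdA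

end KineticAveraging

namespace KineticAveraging

open Real FourierTransform Filter Topology

/-! ### Limits of Fourier multipliers -/

section Limit

variable {V : Type*} [NormedAddCommGroup V] [InnerProductSpace ℝ V] [FiniteDimensional ℝ V]
  [MeasurableSpace V] [BorelSpace V] {E' : Type*} [MeasurableSpace E'] {ν : Measure E'} [SFinite ν]
  {κ : E' → ℂ} {ι : E' → V} {m : V → ℂ} {κn : ℕ → V → ℂ} {mn : ℕ → V → ℂ} {N : ℕ} {h : V → ℂ}

/-- A sequence of convolution operators whose symbols converge boundedly. -/
structure IsMultiplierLimit (κn : ℕ → V → ℂ) (mn : ℕ → V → ℂ) (ν : Measure E') (κ : E' → ℂ)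
    (ι : E' → V) (m : V → ℂ) : Prop where
  kernel_n : ∀ n, IsMomentKernel volume (κn n) id
  symbol_n : ∀ n w, mn n w = ∫ x, 𝐞 (-(inner ℝ (id x) w)) • κn n x
  growth_n : ∀ n, (mn n).HasTemperateGrowth
  kernel : IsMomentKernel ν κ ι
  symbol : ∀ w, m w = ∫ x, 𝐞 (-(inner ℝ (ι x) w)) • κ x ∂ν
  growth : m.HasTemperateGrowth
  tendsto : ∀ w, Tendsto (fun n => mn n w) atTop (𝓝 (m w))
  bounded : ∃ B : ℝ, ∀ n w, ‖mn n w‖ ≤ B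
  moments : ∀ N : ℕ, ∃ C : ℝ, ∀ n, ∫ x, (1 + ‖x‖) ^ N * ‖κn n x‖ ≤ C

lemma smulLeftCLM_integrand {m : V → ℂ} (hm : m.HasTemperateGrowth) (ζ : 𝓢(V, ℂ)) (y : V) :
    (𝓕 (SchwartzMap.smulLeftCLM ℂ m (𝓕⁻ ζ)) : 𝓢(V, ℂ)) y =
      ∫ w, 𝐞 (-(inner ℝ w y)) • (m w * (𝓕⁻ ζ : 𝓢(V, ℂ)) w) := by
  rw [SchwartzMap.fourier_coe, Real.fourier_eq]
  refine integral_congr_ae (Eventually.of_forall fun w => ?_)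
  simp only
  rw [SchwartzMap.smulLeftCLM_apply_apply hm, smul_eq_mul]

/-- The convolutions are moved onto the test function. There the bounded convergence of the symbols
gives pointwise convergence on the frequency side, and the uniform moments give a majorant
comparable to `polyWeight N`, under which `h` is integrable. -/
lemma IsMultiplierLimit.tendsto_pairing (H : IsMultiplierLimit κn mn ν κ ι m)
    (hh : IsTemperedFun N h) (ζ : 𝓢(V, ℂ)) :
    Tendsto (fun n => ∫ z, ζ z * kernelConv volume (κn n) id h z) atTop
      (𝓝 (∫ z, ζ z * kernelConv ν κ ι h z)) := by
  obtain ⟨B, hB⟩ := H.bounded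
  obtain ⟨C, hC⟩ := H.moments N
  obtain ⟨D, hD0, hD⟩ := schwartz_le_polyWeight' N ζ
  have e : ∀ n y, ∫ x, κn n x * ζ (y + id x) =
      (𝓕 (SchwartzMap.smulLeftCLM ℂ (mn n) (𝓕⁻ ζ)) : 𝓢(V, ℂ)) y := fun n y =>
    ((H.kernel_n n).fourier_smul_fourierInv (H.symbol_n n) (H.growth_n n) ζ y).symm
  rw [H.kernel.integral_mul_kernelConv hh]
  simp_rw [fun n => (H.kernel_n n).integral_mul_kernelConv hh ζ]
  refine tendsto_integral_of_dominated_convergence (fun y => D * C * ‖polyWeight N y • h y‖)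
    (fun n => ?_) (hh.norm.const_mul _) (fun n => Eventually.of_forall fun y => ?_)
    (Eventually.of_forall fun y => ?_)
  · simp_rw [e]
    exact (SchwartzMap.continuous _).aestronglyMeasurable.mul hh.aestronglyMeasurable
  · rw [norm_mul, norm_smul, Real.norm_of_nonneg (polyWeight_pos N y).le, ← mul_assoc]
    gcongr
    calc ‖∫ x, κn n x * ζ (y + id x)‖
        ≤ ∫ x, (D * polyWeight N y) * ((1 + ‖id x‖) ^ N * ‖κn n x‖) := by
          refine norm_integral_le_of_norm_le (((H.kernel_n n).moments N).const_mul _)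
            (Eventually.of_forall fun x => ?_)
          rw [norm_mul]
          calc _ ≤ ‖κn n x‖ * (D * ((1 + ‖id x‖) ^ N * polyWeight N y)) := by
                gcongr
                exact (hD _).trans (by gcongr; exact polyWeight_add_le N y _)
            _ = _ := by ring
      _ ≤ (D * polyWeight N y) * C := by
          rw [integral_const_mul]
          have := polyWeight_pos N y
          gcongr
          exact hC n
      _ = _ := by ring
  · refine Tendsto.mul_const _ ?_
    simp_rw [e]
    rw [← H.kernel.fourier_smul_fourierInv H.symbol H.growth ζ y, smulLeftCLM_integrand H.growth]
    simp_rw [fun n => smulLeftCLM_integrand (H.growth_n n) ζ y]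
    refine tendsto_integral_of_dominated_convergence (fun w => B * ‖(𝓕⁻ ζ : 𝓢(V, ℂ)) w‖)
      (fun n => ?_) ((𝓕⁻ ζ : 𝓢(V, ℂ)).integrable.norm.const_mul _)
      (fun n => Eventually.of_forall fun w => ?_) (Eventually.of_forall fun w => ?_)
    · have hc : Continuous fun x : V => (𝐞 (-(inner ℝ x y)) : ℂ) := by
        simp only [Real.fourierChar_apply]; fun_prop
      simp only [Circle.smul_def, smul_eq_mul]
      exact (hc.mul ((H.growth_n n).1.continuous.mul
        (SchwartzMap.continuous _))).aestronglyMeasurable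
    · rw [Circle.norm_smul, norm_mul]
      gcongr
      exact hB n w
    · exact ((H.tendsto w).mul_const _).const_smul _

lemma IsTemperedFun.locallyIntegrable (hh : IsTemperedFun N h) : LocallyIntegrable h volume := by
  have h1 : LocallyIntegrable (fun y => polyWeight N y • h y) volume :=
    MeasureTheory.Integrable.locallyIntegrable hh
  have h2 : Continuous fun y : V => (polyWeight N y)⁻¹ :=
    (continuous_polyWeight N).inv₀ fun y => (polyWeight_pos N y).ne'
  rw [← locallyIntegrableOn_univ] at h1 ⊢
  have h3 := h1.continuousOn_smul isOpen_univ.isLocallyClosed h2.continuousOn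
  refine h3.congr ?_
  filter_upwards with y
  rw [smul_smul, inv_mul_cancel₀ (polyWeight_pos N y).ne', one_smul]

/-- A bump function mollifier, as a complex-valued kernel. -/
def mollifier (b : ContDiffBump (0 : V)) (y : V) : ℂ := ((b.normed volume y : ℝ) : ℂ)

lemma continuous_mollifier (b : ContDiffBump (0 : V)) : Continuous (mollifier b) :=
  Complex.continuous_ofReal.comp b.continuous_normed

lemma lintegral_mollifier (b : ContDiffBump (0 : V)) : ∫⁻ y, ‖mollifier b y‖ₑ = 1 := by
  have e : ∀ y, ‖mollifier b y‖ₑ = ENNReal.ofReal (b.normed volume y) := fun y => by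
    rw [mollifier, ← ofReal_norm, Complex.norm_real, Real.norm_of_nonneg (b.nonneg_normed y)]
  simp_rw [e]
  rw [← ofReal_integral_eq_lintegral_ofReal b.integrable_normed
    (Eventually.of_forall fun y => b.nonneg_normed y), b.integral_normed, ENNReal.ofReal_one]

lemma exists_schwartz_mollifier (b : ContDiffBump (0 : V)) (y : V) :
    ∃ ζ : 𝓢(V, ℂ), ∀ z, ζ z = mollifier b (y - z) := by
  have h1 : ContDiff ℝ ∞ fun z => mollifier b (y - z) :=
    Complex.ofRealCLM.contDiff.comp (b.contDiff_normed.comp (contDiff_const.sub contDiff_id))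
  have h2 : HasCompactSupport fun z => mollifier b (y - z) := by
    have h3 : HasCompactSupport (mollifier b) :=
      b.hasCompactSupport_normed.comp_left Complex.ofReal_zero
    exact h3.comp_homeomorph (Homeomorph.subLeft y)
  exact ⟨h2.toSchwartzMap h1, fun z => rfl⟩

lemma kernelConv_mollifier (b : ContDiffBump (0 : V)) (F : V → ℂ) {y : V} {ζ : 𝓢(V, ℂ)}
    (hζ : ∀ z, ζ z = mollifier b (y - z)) :
    kernelConv volume (mollifier b) id F y = ∫ z, ζ z * F z := by
  rw [kernelConv, ← integral_sub_left_eq_self _ volume y]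
  refine integral_congr_ae (Eventually.of_forall fun z => ?_)
  simp [hζ]

/-- Lower semicontinuity of the `L^q` norm under bounded convergence of the symbols. -/
theorem IsMultiplierLimit.eLpNorm_le (H : IsMultiplierLimit κn mn ν κ ι m)
    (hh : IsTemperedFun N h) {q : ℝ≥0∞} (hq : 1 ≤ q) {D : ℝ≥0∞}
    (hD : ∀ n, eLpNorm (kernelConv volume (κn n) id h) q volume ≤ D) :
    eLpNorm (kernelConv ν κ ι h) q volume ≤ D := by
  have hF := H.kernel.isTemperedFun_kernelConv hh
  have hFn := fun n => (H.kernel_n n).isTemperedFun_kernelConv hh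
  -- Only convergence against Schwartz functions is known. The value of a mollification at a point
  -- is such a pairing, so mollified functions converge pointwise and Fatou's lemma applies;
  -- mollifying does not increase the `L^q` norm.
  have hmoll : ∀ b : ContDiffBump (0 : V),
      AEStronglyMeasurable (kernelConv volume (mollifier b) id (kernelConv ν κ ι h)) volume ∧
      eLpNorm (kernelConv volume (mollifier b) id (kernelConv ν κ ι h)) q volume ≤ D := by
    intro b
    have hlim : ∀ᵐ y, Tendsto (fun n => kernelConv volume (mollifier b) id
        (kernelConv volume (κn n) id h) y) atTop
        (𝓝 (kernelConv volume (mollifier b) id (kernelConv ν κ ι h) y)) :=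
      Eventually.of_forall fun y => by
        obtain ⟨ζ, hζ⟩ := exists_schwartz_mollifier b y
        simp_rw [kernelConv_mollifier b _ hζ]
        exact H.tendsto_pairing hh ζ
    have hmeas : ∀ n, AEStronglyMeasurable (kernelConv volume (mollifier b) id
        (kernelConv volume (κn n) id h)) volume := fun n => by
      have : IsMomentKernel volume (mollifier b) (id : V → V) := by
        obtain ⟨ζ, hζ⟩ := exists_schwartz_mollifier b 0
        have e : mollifier b = ζ := by
          funext z
          rw [hζ, mollifier, mollifier, zero_sub, b.normed_neg]
        rw [e]
        exact isMomentKernel_schwartz ζ measurable_id fun _ => rfl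
      exact (this.isTemperedFun_kernelConv (hFn n)).aestronglyMeasurable
    refine ⟨aestronglyMeasurable_of_tendsto_ae atTop hmeas hlim, ?_⟩
    refine (Lp.eLpNorm_lim_le_liminf_eLpNorm hmeas _ hlim).trans ?_
    refine liminf_le_of_le (by isBoundedDefault) fun B hB => ?_
    obtain ⟨n, hn⟩ := hB.exists
    refine hn.trans ((eLpNorm_conv_le (continuous_mollifier b).aestronglyMeasurable
      (hFn n).aestronglyMeasurable hq).trans ?_)
    rw [lintegral_mollifier, one_mul]
    exact hD n
  -- Shrinking mollifiers with comparable inner and outer radii converge to the function almost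
  -- everywhere, which permits a second use of Fatou's lemma.
  set b : ℕ → ContDiffBump (0 : V) := fun n =>
    ⟨1 / ((n : ℝ) + 1), 2 * (1 / ((n : ℝ) + 1)), by positivity, by
      have : 0 < 1 / ((n : ℝ) + 1) := by positivity
      linarith⟩
  have hb : Tendsto (fun n => (b n).rOut) atTop (𝓝 0) := by
    have h1 := (tendsto_one_div_add_atTop_nhds_zero_nat (𝕜 := ℝ)).const_mul 2
    rwa [mul_zero] at h1
  have hlim := ContDiffBump.ae_convolution_tendsto_right_of_locallyIntegrable (μ := volume)
    (K := 2) hb (Eventually.of_forall fun n => le_rfl) hF.locallyIntegrable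
  have hlim' : ∀ᵐ y, Tendsto (fun n => kernelConv volume (mollifier (b n)) id
      (kernelConv ν κ ι h) y) atTop (𝓝 (kernelConv ν κ ι h y)) := by
    filter_upwards [hlim] with y hy
    refine hy.congr fun n => ?_
    simp only [MeasureTheory.convolution, ContinuousLinearMap.lsmul_apply, Complex.real_smul]
    rfl
  refine (Lp.eLpNorm_lim_le_liminf_eLpNorm (fun n => (hmoll (b n)).1) _ hlim').trans ?_
  refine liminf_le_of_le (by isBoundedDefault) fun B hB => ?_
  obtain ⟨n, hn⟩ := hB.exists
  exact hn.trans (hmoll (b n)).2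

end Limit

variable {d : ℕ} {X : ℝ → ℝ} {φ : Space d → ℝ} {a c : ℝ}

/-! ### The limit of blocks as the time frequency cutoff is removed -/

/-- The kernels are dilates of one Schwartz kernel. For `a ≥ 1` the dilation acting on positions has
norm at most `K`, so the moments stay bounded as `a → ∞`, with `c` fixed. -/
lemma exists_moments_blockKernel_le (hX : IsTimeCutoff X) (hφ : IsSpaceCutoff φ) (hc : 0 < c)
    (N : ℕ) : ∃ C : ℝ, ∀ a : ℝ, 1 ≤ a →
      ∫ x, (1 + ‖x‖) ^ N * ‖blockKernel X φ a c x‖ ≤ C := by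
  set K : ℝ := 2 * π + 2 * π / c with hK
  have hK0 : 0 ≤ K := by positivity
  have hsch : ∃ g : 𝓢(SpaceTime d, ℂ), 𝓕⁻ (unitSymbol X φ) = g := by
    have hS : IsSymbolFamily (fun _ => unitSymbol X φ) 3 :=
      ⟨(contDiff_unitSymbol hX hφ).comp contDiff_snd, fun _ _ hw => norm_lt_of_cutoff hX hφ hw⟩
    refine ⟨𝓕⁻ ((hS.hasCompactSupport 0).toSchwartzMap (hS.contDiff 0)), ?_⟩
    rw [SchwartzMap.fourierInv_coe]; rfl
  obtain ⟨g, hg⟩ := hsch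
  have hgm : Integrable fun x => (1 + ‖x‖) ^ N * ‖g x‖ :=
    (isMomentKernel_schwartz g measurable_id fun _ => rfl).moments N
  refine ⟨(1 + K) ^ N * ∫ x, (1 + ‖x‖) ^ N * ‖g x‖, fun a ha => ?_⟩
  have ha0 : 0 < a := by linarith
  have hdil : ∀ z : SpaceTime d, ‖freqDilation a c ha0 hc z‖ ≤ K * ‖z‖ := fun z => by
    have e : freqDilation a c ha0 hc z = pt (2 * π / a * z.fst) 0 + pt 0 ((2 * π / c) • z.snd) := by
      apply WithLp.ofLp_injective
      ext <;> simp [freqDilation, dilation]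
    have h1 : ‖z.fst‖ ≤ ‖z‖ := WithLp.norm_fst_le _ z
    have h2 : ‖z.snd‖ ≤ ‖z‖ := WithLp.norm_snd_le _ z
    have n1 : ‖(pt (2 * π / a * z.fst) 0 : SpaceTime d)‖ = 2 * π / a * ‖z.fst‖ := by
      rw [WithLp.norm_toLp_fst, norm_mul, Real.norm_of_nonneg (by positivity)]
    have n2 : ‖(pt 0 ((2 * π / c) • z.snd) : SpaceTime d)‖ = 2 * π / c * ‖z.snd‖ := by
      rw [WithLp.norm_toLp_snd, norm_smul, Real.norm_of_nonneg (by positivity)]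
    rw [e]
    refine (norm_add_le _ _).trans ?_
    rw [n1, n2, hK, add_mul]
    gcongr
    exact div_le_self (by positivity) ha
  have key : ∫⁻ x, ‖blockKernel X φ a c x‖ₑ * ENNReal.ofReal ((1 + ‖x‖) ^ N) ≤
      ENNReal.ofReal ((1 + K) ^ N * ∫ x, (1 + ‖x‖) ^ N * ‖g x‖) := by
    have h1 := lintegral_fourierInv_comp_symmetric (freqDilation (d := d) a c ha0 hc)
      (inner_dilation _ _ _ _) (unitSymbol X φ) (fun x => ENNReal.ofReal ((1 + ‖x‖) ^ N))
    have h2 : blockKernel X φ a c = 𝓕⁻ (fun w => unitSymbol X φ (freqDilation a c ha0 hc w)) := rfl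
    rw [h2, h1, hg, ← integral_const_mul, ofReal_integral_eq_lintegral_ofReal
      (hgm.const_mul _) (Eventually.of_forall fun x => by positivity)]
    refine lintegral_mono fun x => ?_
    rw [← ofReal_norm, ← ENNReal.ofReal_mul (norm_nonneg _)]
    refine ENNReal.ofReal_le_ofReal ?_
    have h3 : 1 + ‖freqDilation a c ha0 hc x‖ ≤ (1 + K) * (1 + ‖x‖) := by
      nlinarith [hdil x, norm_nonneg x]
    calc _ ≤ ‖g x‖ * ((1 + K) * (1 + ‖x‖)) ^ N := by gcongr
      _ = _ := by rw [mul_pow]; ring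
  have hkm : Integrable fun x => (1 + ‖x‖) ^ N * ‖blockKernel X φ a c x‖ :=
    (isMomentKernel_blockKernel hX hφ ha0 hc).moments N
  rw [integral_eq_lintegral_of_nonneg_ae (Eventually.of_forall fun x => by positivity)
    hkm.aestronglyMeasurable]
  refine ENNReal.toReal_le_of_le_ofReal (by positivity) (le_trans (le_of_eq ?_) key)
  refine lintegral_congr fun x => ?_
  rw [mul_comm, ENNReal.ofReal_mul (norm_nonneg _), ofReal_norm]

/-- The symbol localized to spatial angular frequencies `|ξ| ∼ c`. -/
def spaceSymbol (φ : Space d → ℝ) (c : ℝ) (ξ : Space d) : ℂ := ((φ ((2 * π / c) • ξ) : ℝ) : ℂ)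

lemma exists_schwartz_spaceKernel (hφ : IsSpaceCutoff φ) (hc : 0 < c) :
    ∃ κ : 𝓢(Space d, ℂ), spaceSymbol φ c = (𝓕 κ : 𝓢(Space d, ℂ)) := by
  have h1 : ContDiff ℝ ∞ (spaceSymbol φ c) :=
    Complex.ofRealCLM.contDiff.comp (hφ.smooth.comp (contDiff_const_smul _))
  have hpos : 0 < 2 * π / c := by positivity
  have h2 : HasCompactSupport (spaceSymbol φ c) := by
    refine HasCompactSupport.intro (isCompact_closedBall (0 : Space d) (2 / (2 * π / c)))
      fun ξ hξ => ?_
    have h3 : 2 < ‖(2 * π / c) • ξ‖ := by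
      rw [mem_closedBall_zero_iff, not_le, div_lt_iff₀ hpos] at hξ
      rw [norm_smul, Real.norm_of_nonneg hpos.le, mul_comm]
      exact hξ
    rw [spaceSymbol, Complex.ofReal_eq_zero]
    by_contra hcon
    exact absurd (hφ.support hcon).2 (not_le.2 h3)
  refine ⟨𝓕⁻ (h2.toSchwartzMap h1), ?_⟩
  rw [FourierTransform.fourier_fourierInv_eq]; rfl

lemma inner_spaceEmb (x : Space d) (w : SpaceTime d) :
    (inner ℝ (spaceEmb d x) w : ℝ) = inner ℝ x w.snd := by
  rw [spaceEmb_apply, WithLp.prod_inner_apply]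
  simp

/-- Since `X = 1` near `0`, the time cutoff at scale `n + 1` equals `1` at any given frequency once
`n` is large. What remains depends on `ξ` alone, and its kernel lives on the slice `t = 0`. -/
lemma isMultiplierLimit_blockKernel (hX : IsTimeCutoff X) (hX1 : ∀ τ, |τ| ≤ 1 → X τ = 1)
    (hφ : IsSpaceCutoff φ) (hc : 0 < c) : ∃ κ : 𝓢(Space d, ℂ),
      IsMultiplierLimit (fun n : ℕ => blockKernel X φ (n + 1) c)
        (fun n : ℕ => blockSymbol X φ (n + 1) c) volume κ (spaceEmb d)
        (fun w => spaceSymbol φ c w.snd) := by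
  obtain ⟨κ, hκ⟩ := exists_schwartz_spaceKernel hφ hc
  have hn : ∀ n : ℕ, (0 : ℝ) < n + 1 := fun n => by positivity
  refine ⟨κ, fun n => isMomentKernel_blockKernel hX hφ (hn n) hc,
    fun n w => blockSymbol_eq_integral hX hφ (hn n) hc w,
    fun n => hasTemperateGrowth_blockSymbol hX hφ (hn n) hc,
    isMomentKernel_schwartz κ (spaceEmb d).continuous.measurable norm_spaceEmb_apply,
    fun w => ?_, ?_, fun w => ?_, ?_, fun N => ?_⟩
  · rw [hκ, SchwartzMap.fourier_coe, Real.fourier_eq]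
    simp_rw [inner_spaceEmb]
  · have h1 : Function.HasTemperateGrowth fun w : SpaceTime d => w.snd :=
      (WithLp.sndL 2 ℝ ℝ (Space d)).hasTemperateGrowth
    rw [hκ]
    exact (SchwartzMap.hasTemperateGrowth _).comp h1
  · refine tendsto_const_nhds.congr' ?_
    obtain ⟨n₀, hn₀⟩ := exists_nat_gt (2 * π * |w.fst|)
    filter_upwards [eventually_ge_atTop n₀] with n hnn
    have h1 : (n₀ : ℝ) ≤ n := by exact_mod_cast hnn
    have h2 : X (2 * π / (n + 1) * w.fst) = 1 := by
      refine hX1 _ ?_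
      rw [abs_mul, abs_of_pos (div_pos (by positivity) (hn n)), div_mul_eq_mul_div,
        div_le_one (hn n)]
      linarith
    change spaceSymbol φ c w.snd =
      ((X (2 * π / (n + 1) * w.fst) * φ ((2 * π / c) • w.snd) : ℝ) : ℂ)
    rw [h2, one_mul]
    rfl
  · have hS : IsSymbolFamily (fun _ => unitSymbol X φ) 3 :=
      ⟨(contDiff_unitSymbol hX hφ).comp contDiff_snd, fun _ _ hw => norm_lt_of_cutoff hX hφ hw⟩
    obtain ⟨B, hB⟩ := (hS.contDiff 0).continuous.bounded_above_of_compact_support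
      (hS.hasCompactSupport 0)
    exact ⟨B, fun n w => hB _⟩
  · obtain ⟨C, hC⟩ := exists_moments_blockKernel_le hX hφ hc N
    exact ⟨C, fun n => hC _ (by simp)⟩

lemma DyadicPartition.blockX_eq (P : DyadicPartition d) (j : ℤ) (u : 𝓢'(SpaceTime d, ℂ)) :
    P.blockX j u = TemperedDistribution.fourierMultiplierCLM ℂ
      (fun w : SpaceTime d => spaceSymbol P.φ (2 ^ j) w.snd) u := by
  rw [DyadicPartition.blockX]
  congr 2
  funext w
  have e2 : (2 : ℝ) ^ (-j) • ((2 * π) • w.snd) = (2 * π / 2 ^ j) • w.snd := by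
    rw [smul_smul, zpow_neg]; congr 1; ring
  rw [e2]
  rfl

variable {m γ μ ρ β s p κt κx : ℝ}

/-- For `s = 1` the bound contains no power of `a`. The time cutoff `vBump` includes `τ = 0`, and
the block estimate at `a = n + 1` passes to the limit `n → ∞` by lower semicontinuity. -/
theorem AveragingParameters.exists_cheminLernerNorm_le
    (h : AveragingParameters m γ μ ρ β 1 p κt κx) (P : DyadicPartition d) {r q : ℝ≥0∞} {ϑ : ℝ}
    (hi : InterpolationExponents p r q ϑ) :
    ∃ C : ℝ≥0, ∀ (f : Phase d → ℂ) (g₀ g₁ : RadonMeasure d),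
      AveragingData m γ μ β f g₀ g₁ → MemLp (velocityAverage μ f) r volume →
        P.cheminLernerNorm (ϑ * κx) q (velocityAverage μ f) ≤
          C * (dataNorm γ β f g₀ g₁ + eLpNorm (velocityAverage μ f) r volume) := by
  have hκt : κt = 0 := by rw [h.hκt]; simp
  have hX : IsTimeCutoff (vBump : ℝ → ℝ) :=
    ⟨contDiff_vBump, fun τ hτ => vBump_eq_zero hτ.le⟩
  have hX1 : ∀ τ : ℝ, |τ| ≤ 1 → vBump τ = 1 := fun τ => vBump_eq_one
  obtain ⟨C, hC0, hC⟩ := h.exists_eLpNorm_le (X := vBump) ⟨hX, Or.inr ⟨rfl, hX1⟩⟩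
    P.isSpaceCutoff hi
  refine ⟨C.toNNReal, fun f g₀ g₁ hd hr => ?_⟩
  obtain ⟨N, hN⟩ := isTemperedFun_velocityAverage hd
  obtain ⟨u, hu⟩ := hN.exists_isRepresentedBy
  refine le_mul_of_forall_real_bound hC0
    (ENNReal.add_lt_top.2 ⟨dataNorm_lt_top hd, hr.2⟩) fun A hA hdA => ?_
  refine (iInf₂_le u hu).trans (iSup_le fun j => ?_)
  have hj : (0 : ℝ) < 2 ^ j := by positivity
  obtain ⟨κ, hκ⟩ := isMultiplierLimit_blockKernel hX hX1 P.isSpaceCutoff hj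
  have hrep := hκ.kernel.isRepresentedBy hκ.symbol hκ.growth hN hu
  rw [← P.blockX_eq] at hrep
  rw [← two_rpow_mul_scale (σ := ϑ * κx) (C := C * A) j]
  gcongr
  refine (iInf₂_le _ hrep).trans (hκ.eLpNorm_le hN (hi.one_lt h.one_le_p).le fun n => ?_)
  have := hC (n + 1) (2 ^ j) (by positivity) hj f g₀ g₁ hd A hA hdA
  rwa [hκt, mul_zero, neg_zero, rpow_zero, one_mul] at this

end KineticAveraging

end

/-! ### The averaging lemma -/

theorem lemma4p2 (d : ℕ) (P : KineticAveraging.DyadicPartition d)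
    (m γ μ ρ β s p κt κx : ℝ)
    (hm : 1 < m) (hγ : γ < m) (hμ₁ : 1 ≤ μ) (hμ₂ : μ < m + 1 - γ)
    (hρ₀ : 0 < ρ) (hρ₁ : ρ < 1) (hβ : β.HolderConjugate (1 / ρ))
    (hs : (μ - 2 + γ) / (m - 1) < s) (hs₀ : 0 ≤ s) (hs₁ : s ≤ 1)
    (hp : p = (s * (m - 1) + 1 - γ + ρ) / (ρ * μ + (1 - ρ) * (s * (m - 1) + 1 - γ)))
    (hκt : κt = (1 - s) * (μ - 1 + ρ) / (s * (m - 1) + 1 - γ + ρ))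
    (hκx : κx = 2 * s * (μ - 1 + ρ) / (s * (m - 1) + 1 - γ + ρ)) :
    -- the estimate in the Besov-Lorentz space
    (∃ C : ℝ≥0, ∀ (f : KineticAveraging.Phase d → ℂ) (g₀ g₁ : KineticAveraging.RadonMeasure d),
      KineticAveraging.AveragingData m γ μ β f g₀ g₁ →
        P.weakBesovNorm κt κx p (KineticAveraging.velocityAverage μ f) < ⊤ ∧
        P.weakBesovNorm κt κx p (KineticAveraging.velocityAverage μ f)
          ≤ C * KineticAveraging.dataNorm γ β f g₀ g₁) ∧
    -- the interpolated estimate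
    (∀ (r q : ℝ≥0∞) (ϑ : ℝ), KineticAveraging.InterpolationExponents p r q ϑ →
      ∃ C : ℝ≥0, ∀ (f : KineticAveraging.Phase d → ℂ) (g₀ g₁ : KineticAveraging.RadonMeasure d),
        KineticAveraging.AveragingData m γ μ β f g₀ g₁ →
        MemLp (KineticAveraging.velocityAverage μ f) r volume →
          P.besovNorm (ϑ * κt) (ϑ * κx) q (KineticAveraging.velocityAverage μ f) < ⊤ ∧
          P.besovNorm (ϑ * κt) (ϑ * κx) q (KineticAveraging.velocityAverage μ f)
            ≤ C * (KineticAveraging.dataNorm γ β f g₀ g₁ +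
                eLpNorm (KineticAveraging.velocityAverage μ f) r volume)) ∧
    -- the case without loss in time
    (s = 1 → κt = 0 ∧
      ∀ (r q : ℝ≥0∞) (ϑ : ℝ), KineticAveraging.InterpolationExponents p r q ϑ →
      ∃ C : ℝ≥0, ∀ (f : KineticAveraging.Phase d → ℂ) (g₀ g₁ : KineticAveraging.RadonMeasure d),
        KineticAveraging.AveragingData m γ μ β f g₀ g₁ →
        MemLp (KineticAveraging.velocityAverage μ f) r volume →
          P.cheminLernerNorm (ϑ * κx) q (KineticAveraging.velocityAverage μ f) < ⊤ ∧
          P.cheminLernerNorm (ϑ * κx) q (KineticAveraging.velocityAverage μ f)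
            ≤ C * (KineticAveraging.dataNorm γ β f g₀ g₁ +
                eLpNorm (KineticAveraging.velocityAverage μ f) r volume)) := by
  have h : KineticAveraging.AveragingParameters m γ μ ρ β s p κt κx :=
    ⟨hm, hμ₁, hρ₀, hβ, hs, hs₀, hs₁, hp, hκt, hκx⟩
  refine ⟨?_, fun r q ϑ hi => ?_, fun hs => ⟨by rw [hκt, hs]; simp, fun r q ϑ hi => ?_⟩⟩
  · obtain ⟨C, hC⟩ := h.exists_weakBesovNorm_le P
    exact ⟨C, fun f g₀ g₁ hd => ⟨(hC f g₀ g₁ hd).trans_lt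
      (ENNReal.mul_lt_top ENNReal.coe_lt_top (KineticAveraging.dataNorm_lt_top hd)),
      hC f g₀ g₁ hd⟩⟩
  · obtain ⟨C, hC⟩ := h.exists_besovNorm_le P hi
    exact ⟨C, fun f g₀ g₁ hd hr => ⟨(hC f g₀ g₁ hd hr).trans_lt
      (ENNReal.mul_lt_top ENNReal.coe_lt_top
        (ENNReal.add_lt_top.2 ⟨KineticAveraging.dataNorm_lt_top hd, hr.2⟩)), hC f g₀ g₁ hd hr⟩⟩
  · subst hs
    obtain ⟨C, hC⟩ := h.exists_cheminLernerNorm_le P hi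
    exact ⟨C, fun f g₀ g₁ hd hr => ⟨(hC f g₀ g₁ hd hr).trans_lt
      (ENNReal.mul_lt_top ENNReal.coe_lt_top
        (ENNReal.add_lt_top.2 ⟨KineticAveraging.dataNorm_lt_top hd, hr.2⟩)), hC f g₀ g₁ hd hr⟩⟩
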